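/- Let $1<p<\infty$, $\alpha\in\mathbb{R}$ and $I=(-1,1)$. For $V\in C(\bar I)$ consider the Robin eigenvalue problem for the $p$-Laplacian, $$-(|u'|^{p-2}u')'+V|u|^{p-2}u=\lambda|u|^{p-2}u \ \text{ on } I,\qquad |u'|^{p-2}u'=\mp\alpha|u|^{p-2}u \ \text{ at } x=\pm1,$$ with Rayleigh quotient, for $u\in W^{1,p}(I)\setminus\{0\}$, $$\mathcal{R}_V[u]=\frac{\int_I \big(|u'|^p+V|u|^p\big)\,dx+\alpha\big(|u(1)|^p+|u(-1)|^p\big)}{\int_I|u|^p\,dx},$$ and the Ljusternik--Schnirelmann eigenvalues $$\lambda_i^V=\inf_{A\in\Sigma_i}\ \max_{u\in A}\mathcal{R}_V[u],\qquad i=0,1,2,\dots,$$ where $\Sigma_i$ is the family of all compact sets $A=-A\subset W^{1,p}(I)\setminus\{0\}$ whose Krasnoselskii genus (the least $n$ for which there is an odd continuous map $A\to\mathbb{R}^n\setminus\{0\}$, or $\infty$ if there is none) is at least $i+1$. Let $\Gamma_p(V)=\lambda_1^V-\lambda_0^V$ be the fundamental gap. Then for every $V\in C(\bar I)$ that is convex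 and not affine on $\bar I$, there exists $a\in\mathbb{R}$ such that $$\Gamma_p(V)>\Gamma_p(V_a),\qquad V_a(x)=ax.$$ -/

import Mathlib

noncomputable section

open Set MeasureTheory

namespace RobinGap

/-- Lebesgue measure on the open interval `I = (-1, 1)`. -/
abbrev μI : Measure ℝ := volume.restrict (Ioo (-1) 1)

/-- The closed interval `[-1, 1]`, the closure of `I`. -/
abbrev Ibar : Type := Icc (-1 : ℝ) 1

/-- The left end point `-1` of `I`. -/
def leftEnd : Ibar := ⟨-1, by norm_num, by norm_num⟩

instance factOneLe (p : ℝ) [hp : Fact (1 < p)] : Fact (1 ≤ ENNReal.ofReal p) :=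
  ⟨by simpa using ENNReal.ofReal_le_ofReal hp.out.le⟩

theorem intervalIntegrable_of_Lp {p : ℝ} [Fact (1 < p)] (g : Lp ℝ (ENNReal.ofReal p) μI)
    (x : Ibar) : IntervalIntegrable g volume (-1) x := by
  have h : IntegrableOn g (Ioo (-1) 1) volume := (Lp.memLp g).integrable Fact.out
  rw [intervalIntegrable_iff_integrableOn_Ioo_of_le x.2.1]
  exact h.mono_set (Ioo_subset_Ioo_right x.2.2)

theorem intervalIntegral_congr_of_ae {f g : ℝ → ℝ} (h : f =ᵐ[μI] g) (x : Ibar) :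
    ∫ t in (-1 : ℝ)..x, f t = ∫ t in (-1 : ℝ)..x, g t := by
  rw [intervalIntegral.integral_of_le x.2.1, intervalIntegral.integral_of_le x.2.1,
    integral_Ioc_eq_integral_Ioo, integral_Ioc_eq_integral_Ioo]
  exact integral_congr_ae (ae_mono (Measure.restrict_mono (Ioo_subset_Ioo_right x.2.2) le_rfl) h)

/-- The one-dimensional Sobolev space `W^{1,p}(I)`, in its description by absolutely continuous
representatives: a pair `(u, u')` where `u ∈ C([-1, 1])`, `u' ∈ L^p(I)` and `u` is the integral of
`u'`. The inherited norm `max ‖u‖_∞ ‖u'‖_p` is equivalent to the usual norm of `W^{1,p}(I)`. -/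
def W1p (p : ℝ) [Fact (1 < p)] : Submodule ℝ (C(Ibar, ℝ) × Lp ℝ (ENNReal.ofReal p) μI) where
  carrier := {w | ∀ x : Ibar, w.1 x = w.1 leftEnd + ∫ t in (-1 : ℝ)..x, w.2 t}
  zero_mem' := by
    intro x
    have h := intervalIntegral_congr_of_ae (Lp.coeFn_zero ℝ (ENNReal.ofReal p) μI) x
    simp only [Prod.fst_zero, Prod.snd_zero, ContinuousMap.zero_apply, zero_add]
    rw [h]
    simp
  add_mem' := by
    intro v w hv hw x
    have h := intervalIntegral_congr_of_ae (Lp.coeFn_add v.2 w.2) x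
    simp only [Prod.fst_add, Prod.snd_add, ContinuousMap.add_apply]
    rw [h, hv x, hw x]
    simp only [Pi.add_apply]
    rw [intervalIntegral.integral_add (intervalIntegrable_of_Lp v.2 x)
      (intervalIntegrable_of_Lp w.2 x)]
    ring
  smul_mem' := by
    intro c w hw x
    have h := intervalIntegral_congr_of_ae (Lp.coeFn_smul c w.2) x
    simp only [Prod.smul_fst, Prod.smul_snd, ContinuousMap.smul_apply, smul_eq_mul]
    rw [h, hw x]
    simp only [Pi.smul_apply, smul_eq_mul]
    rw [intervalIntegral.integral_const_mul]
    ring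

/-- The continuous representative of `u ∈ W^{1,p}(I)` on `[-1, 1]`, as a function on `ℝ` (constant
on either side of `[-1, 1]`). -/
def evalAt {p : ℝ} [Fact (1 < p)] (u : W1p p) : ℝ → ℝ :=
  IccExtend (by norm_num : (-1 : ℝ) ≤ 1) u.1.1

/-- The weak derivative of `u ∈ W^{1,p}(I)`. -/
def weakDeriv {p : ℝ} [Fact (1 < p)] (u : W1p p) : ℝ → ℝ := u.1.2

/-- The Rayleigh quotient of `-Δ_p + V |·|^{p-2} ·` with Robin parameter `α`. -/
def rayleigh (p : ℝ) [Fact (1 < p)] (α : ℝ) (V : ℝ → ℝ) (u : W1p p) : ℝ :=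
  ((∫ x in Ioo (-1 : ℝ) 1, (|weakDeriv u x| ^ p + V x * |evalAt u x| ^ p))
      + α * (|evalAt u 1| ^ p + |evalAt u (-1)| ^ p))
    / ∫ x in Ioo (-1 : ℝ) 1, |evalAt u x| ^ p

/-- There is an odd continuous map from the symmetric set `A` to `ℝ^n ∖ {0}`. -/
def HasOddMap {E : Type*} [TopologicalSpace E] [Neg E] (A : Set E) (n : ℕ) : Prop :=
  ∃ f : E → EuclideanSpace ℝ (Fin n),
    ContinuousOn f A ∧ (∀ u ∈ A, f (-u) = -f u) ∧ ∀ u ∈ A, f u ≠ 0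

/-- The Krasnoselskii genus of a symmetric set: the least `n` for which there is an odd continuous
map to `ℝ^n ∖ {0}`, and `⊤` if there is none; the empty set has genus `0`. -/
def genus {E : Type*} [TopologicalSpace E] [Neg E] (A : Set E) : ℕ∞ :=
  ⨅ (n : ℕ) (_ : HasOddMap A n), (n : ℕ∞)

/-- The Ljusternik-Schnirelmann class of level `i`, `i = 0, 1, …`: compact symmetric subsets of
`W^{1,p}(I) ∖ {0}` of genus at least `i + 1`. -/
def LSClass (p : ℝ) [Fact (1 < p)] (i : ℕ) : Set (Set (W1p p)) :=
  {A | IsCompact A ∧ (∀ u ∈ A, -u ∈ A) ∧ 0 ∉ A ∧ ((i + 1 : ℕ) : ℕ∞) ≤ genus A}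

/-- The eigenvalue `λ_i = inf_{A} max_{u ∈ A} R[u]`, `i = 0, 1, …`, the infimum over the
Ljusternik-Schnirelmann class of level `i`, of the Robin problem
`-Δ_p u + V |u|^{p-2} u = λ |u|^{p-2} u` on `I`,
`|u'|^{p-2} u' = ∓ α |u|^{p-2} u` at `±1`. -/
def eigenvalue (p : ℝ) [Fact (1 < p)] (α : ℝ) (V : ℝ → ℝ) (i : ℕ) : ℝ :=
  sInf {m : ℝ | ∃ A ∈ LSClass p i, IsGreatest (rayleigh p α V '' A) m}

/-- The fundamental gap `Γ_p(V) = λ_1 - λ_0`. -/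
def gap (p : ℝ) [Fact (1 < p)] (α : ℝ) (V : ℝ → ℝ) : ℝ :=
  eigenvalue p α V 1 - eigenvalue p α V 0

end RobinGap

end

/-!
The substitution `r = |u'|^{p-2} u' / |u|^{p-2} u` turns the Robin problem into the Riccati equation
`r' = V - λ - (p-1) |r|^q` with `r(±1) = ∓α`. Picone's inequality identifies `λ_0` and `λ_1` with
the parameters for which this equation has a solution on `[-1, 1]`, respectively a solution with a
single pole `c`, the zero of the second eigenfunction.

For convex, non-affine `V` choose `κ x + m` so that `d = V - κ x - m` is orthogonal to `|u_1|^p` on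
either side of `c`. By convexity `d` vanishes once on each side, and on each side the ratio
`|u_1| / u_0` is monotone; comparing with its value at the zero of `d` gives `∫ d |u_0|^p < 0`.
Hence replacing `V` by `V - t d` moves `λ_0` up at first order in `t` and does not move `λ_1` up at
all: the gap decreases when a small part of a convex potential is replaced by a secant of it.

If `V` is Lipschitz, such steps never leave a compact two-parameter family `t V + a x`, on which the
gap is continuous; its minimum can only be attained at `t = 0`, a linear potential. The strict
decrease of one step leaves room for approximating a general convex `V` by its dilations
`x ↦ V(ρ x)`, which are Lipschitz.
-/

open Set MeasureTheory Filter Topology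
open scoped NNReal

namespace RobinGap

/-! ### Elementary one-variable calculus -/

theorem hasDerivAt_of_eqOn_Iic_Ici {f g h : ℝ → ℝ} {a d : ℝ} (hg : HasDerivAt g d a)
    (hh : HasDerivAt h d a) (hfg : EqOn f g (Iic a)) (hfh : EqOn f h (Ici a)) :
    HasDerivAt f d a := by
  have hleft : HasDerivWithinAt f d (Iic a) a :=
    hg.hasDerivWithinAt.congr hfg (hfg self_mem_Iic)
  have hright : HasDerivWithinAt f d (Ici a) a :=
    hh.hasDerivWithinAt.congr hfh (hfh self_mem_Ici)
  simpa using hleft.union hright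

theorem hasDerivAt_max_zero_rpow {p : ℝ} (hp : 1 < p) (x : ℝ) :
    HasDerivAt (fun y : ℝ => max y 0 ^ p) (p * max x 0 ^ (p - 1)) x := by
  have hzero : ∀ y ≤ (0 : ℝ), max y 0 ^ p = 0 := fun y hy => by
    rw [max_eq_right hy, Real.zero_rpow (by linarith)]
  rcases lt_trichotomy x 0 with hx | rfl | hx
  · rw [max_eq_right hx.le, Real.zero_rpow (by linarith), mul_zero]
    refine (hasDerivAt_const x (0 : ℝ)).congr_of_eventuallyEq ?_
    filter_upwards [Iio_mem_nhds hx] with y hy using hzero y (le_of_lt hy)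
  · rw [max_self]
    have hpow : HasDerivAt (fun y : ℝ => y ^ p) (p * 0 ^ (p - 1)) 0 :=
      Real.hasDerivAt_rpow_const (Or.inr hp.le)
    rw [Real.zero_rpow (by linarith), mul_zero] at hpow ⊢
    refine hasDerivAt_of_eqOn_Iic_Ici (hasDerivAt_const 0 (0 : ℝ)) hpow (fun y hy => hzero y hy)
      (fun y hy => ?_)
    rw [max_eq_left hy]
  · rw [max_eq_left hx.le]
    refine (Real.hasDerivAt_rpow_const (Or.inl hx.ne')).congr_of_eventuallyEq ?_
    filter_upwards [Ioi_mem_nhds hx] with y hy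
    rw [max_eq_left (le_of_lt hy)]

/-- The signed power `x ↦ sign x * |x| ^ s`, written with positive and negative parts so that no
division by `|x|` occurs. It turns the Riccati variable `r = |f'|^{p-2} f' / (|f|^{p-2} f)` back
into the logarithmic derivative `f' / f = spow (q - 1) r`, where `1 / p + 1 / q = 1`. -/
noncomputable def spow (s x : ℝ) : ℝ := max x 0 ^ s - max (-x) 0 ^ s

theorem continuous_spow {s : ℝ} (hs : 0 < s) : Continuous (spow s) := by
  unfold spow
  exact ((continuous_id.max continuous_const).rpow_const fun _ => Or.inr hs.le).sub
    ((continuous_neg.max continuous_const).rpow_const fun _ => Or.inr hs.le)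

theorem spow_of_nonneg {s x : ℝ} (hs : 0 < s) (hx : 0 ≤ x) : spow s x = x ^ s := by
  rw [spow, max_eq_left hx, max_eq_right (by linarith : -x ≤ 0), Real.zero_rpow hs.ne', sub_zero]

theorem spow_neg (s x : ℝ) : spow s (-x) = -spow s x := by
  simp [spow]

theorem abs_spow {s : ℝ} (hs : 0 < s) (x : ℝ) : |spow s x| = |x| ^ s := by
  rcases le_total 0 x with hx | hx
  · rw [spow_of_nonneg hs hx, abs_of_nonneg hx, abs_of_nonneg (Real.rpow_nonneg hx s)]
  · rw [← abs_neg, ← spow_neg, spow_of_nonneg hs (by linarith), abs_of_nonpos hx,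
      abs_of_nonneg (Real.rpow_nonneg (by linarith) s)]

theorem mul_spow {s : ℝ} (hs : 0 < s) (x : ℝ) : x * spow s x = |x| ^ (s + 1) := by
  have key : ∀ y : ℝ, 0 ≤ y → y * spow s y = |y| ^ (s + 1) := fun y hy => by
    rw [spow_of_nonneg hs hy, abs_of_nonneg hy, Real.rpow_add_one' hy (by linarith), mul_comm]
  rcases le_total 0 x with hx | hx
  · exact key x hx
  · have := key (-x) (by linarith)
    rwa [spow_neg, neg_mul_neg, abs_neg] at this

theorem strictMono_spow {s : ℝ} (hs : 0 < s) : StrictMono (spow s) := by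
  have key : StrictMonoOn (spow s) (Ici 0) := fun x hx y hy hxy => by
    rw [spow_of_nonneg hs hx, spow_of_nonneg hs hy]
    exact Real.rpow_lt_rpow hx hxy hs
  refine StrictMonoOn.Iic_union_Ici (a := 0) (fun x hx y hy hxy => ?_) key
  have := key (show (0 : ℝ) ≤ -y by simpa using hy) (show (0 : ℝ) ≤ -x by simpa using hx)
    (by linarith)
  rw [spow_neg, spow_neg] at this
  linarith

theorem abs_rpow_eq_add {s : ℝ} (hs : 0 < s) (x : ℝ) : |x| ^ s = max x 0 ^ s + max (-x) 0 ^ s := by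
  rcases le_total 0 x with hx | hx
  · rw [max_eq_left hx, max_eq_right (by linarith : -x ≤ 0), Real.zero_rpow hs.ne', add_zero,
      abs_of_nonneg hx]
  · rw [max_eq_right hx, max_eq_left (by linarith : 0 ≤ -x), Real.zero_rpow hs.ne', zero_add,
      abs_of_nonpos hx]

theorem hasDerivAt_abs_rpow_spow {q : ℝ} (hq : 1 < q) (x : ℝ) :
    HasDerivAt (fun y : ℝ => |y| ^ q) (q * spow (q - 1) x) x := by
  have hpos := hasDerivAt_max_zero_rpow hq x
  have hneg := (hasDerivAt_max_zero_rpow hq (-x)).comp x (hasDerivAt_neg x)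
  have hsum := hpos.add hneg
  refine (hsum.congr_deriv (by rw [spow]; ring)).congr_of_eventuallyEq ?_
  filter_upwards with y
  simpa using abs_rpow_eq_add (by linarith : 0 < q) y

theorem convexOn_abs_rpow {q : ℝ} (hq : 1 < q) : ConvexOn ℝ univ fun x : ℝ => |x| ^ q := by
  have hder := hasDerivAt_abs_rpow_spow hq
  refine Monotone.convexOn_univ_of_deriv (fun x => (hder x).differentiableAt) ?_
  rw [funext fun x => (hder x).deriv]
  exact (strictMono_spow (by linarith)).monotone.const_mul (by linarith)

theorem abs_rpow_sub_le {q : ℝ} (hq : 1 < q) (a b : ℝ) :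
    |b| ^ q - |a| ^ q ≤ q * spow (q - 1) b * (b - a) := by
  have hconv := convexOn_abs_rpow hq
  have hder := hasDerivAt_abs_rpow_spow hq b
  rcases lt_trichotomy a b with h | rfl | h
  · have := hconv.slope_le_of_hasDerivAt (mem_univ a) (mem_univ b) h hder
    rwa [slope_def_field, div_le_iff₀ (sub_pos.2 h)] at this
  · simp
  · have := hconv.le_slope_of_hasDerivAt (mem_univ b) (mem_univ a) h hder
    rw [slope_def_field, le_div_iff₀ (sub_pos.2 h)] at this
    linarith

theorem mul_rpow_le_add {p q : ℝ} (hpq : p.HolderConjugate q) (r t : ℝ) {h : ℝ} (hh : 0 ≤ h) :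
    p * (|r| * h ^ (p - 1) * |t|) ≤ |t| ^ p + (p - 1) * |r| ^ q * h ^ p := by
  have hyoung := Real.young_inequality_of_nonneg (abs_nonneg t)
    (mul_nonneg (abs_nonneg r) (Real.rpow_nonneg hh (p - 1))) hpq
  rw [Real.mul_rpow (abs_nonneg r) (Real.rpow_nonneg hh _), ← Real.rpow_mul hh,
    hpq.sub_one_mul_conj] at hyoung
  have hp := hpq.pos
  have hpq_div : p / q = p - 1 := by
    rw [hpq.conjugate_eq]
    have := hpq.sub_one_pos
    field_simp
  calc p * (|r| * h ^ (p - 1) * |t|) = p * (|t| * (|r| * h ^ (p - 1))) := by ring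
    _ ≤ p * (|t| ^ p / p + |r| ^ q * h ^ p / q) := by gcongr
    _ = |t| ^ p + p / q * |r| ^ q * h ^ p := by field_simp
    _ = _ := by rw [hpq_div]

theorem neg_of_deriv_neg_at_zeros {z z' : ℝ → ℝ} {a b : ℝ}
    (hz : ∀ x ∈ Icc a b, HasDerivAt z (z' x) x) (hneg : ∀ x ∈ Icc a b, z x = 0 → z' x < 0)
    (ha : z a ≤ 0) {x : ℝ} (hx : x ∈ Ioc a b) : z x < 0 := by
  have hle : ∀ ⦃y⦄, y ∈ Icc a b → z y ≤ 0 :=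
    image_le_of_deriv_right_lt_deriv_boundary' (B := fun _ => 0) (B' := fun _ => 0)
      (fun y hy => (hz y hy).continuousAt.continuousWithinAt)
      (fun y hy => (hz y (Ico_subset_Icc_self hy)).hasDerivWithinAt) ha continuousOn_const
      (fun y _ => hasDerivWithinAt_const _ _ _) (fun y hy => hneg y (Ico_subset_Icc_self hy))
  refine (hle ⟨hx.1.le, hx.2⟩).lt_of_ne fun h0 => ?_
  have hd := hz x ⟨hx.1.le, hx.2⟩
  have hlt := hneg x ⟨hx.1.le, hx.2⟩ h0
  have hev := (hd.tendsto_slope.mono_left (nhdsLT_le_nhdsNE x)).eventually (gt_mem_nhds hlt)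
  have hev2 : ∀ᶠ y in 𝓝[<] x, a < y := mem_nhdsWithin_of_mem_nhds (Ioi_mem_nhds hx.1)
  obtain ⟨y, ⟨hy, hay⟩, hyx⟩ := ((hev.and hev2).and self_mem_nhdsWithin).exists
  have hyx' : y < x := hyx
  rw [slope_def_field, h0] at hy
  have := hle ⟨hay.le, hyx'.le.trans hx.2⟩
  rw [div_neg_iff] at hy
  rcases hy with hy | hy <;> linarith

/-! ### Absolutely continuous functions -/

theorem absolutelyContinuousOnInterval_of_dist_le {f g : ℝ → ℝ} {a b K : ℝ}
    (hf : AbsolutelyContinuousOnInterval f a b)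
    (hK : ∀ x ∈ uIcc a b, ∀ y ∈ uIcc a b, dist (g x) (g y) ≤ K * dist (f x) (f y)) :
    AbsolutelyContinuousOnInterval g a b := by
  have hlim : Tendsto (fun E : ℕ × (ℕ → ℝ × ℝ) =>
      K * ∑ i ∈ Finset.range E.1, dist (f (E.2 i).1) (f (E.2 i).2))
      (AbsolutelyContinuousOnInterval.totalLengthFilter ⊓
        𝓟 (AbsolutelyContinuousOnInterval.disjWithin a b)) (𝓝 0) := by
    simpa using Tendsto.const_mul K hf
  refine squeeze_zero' (Eventually.of_forall fun E => Finset.sum_nonneg fun _ _ => dist_nonneg)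
    ?_ hlim
  filter_upwards [mem_inf_of_right (mem_principal_self _)] with E hE
  rw [Finset.mul_sum]
  exact Finset.sum_le_sum fun i hi => hK _ (hE.1 i hi).1 _ (hE.1 i hi).2

/-! ### The space `W1p` -/

section W1p

variable {p : ℝ} [Fact (1 < p)]

theorem continuous_evalAt (u : W1p p) : Continuous (evalAt u) :=
  u.1.1.continuous.Icc_extend'

theorem evalAt_of_mem (u : W1p p) {x : ℝ} (hx : x ∈ Icc (-1 : ℝ) 1) :
    evalAt u x = u.1.1 ⟨x, hx⟩ :=
  IccExtend_of_mem _ _ hx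

theorem evalAt_eq_add_integral (u : W1p p) {x : ℝ} (hx : x ∈ Icc (-1 : ℝ) 1) :
    evalAt u x = evalAt u (-1) + ∫ t in (-1 : ℝ)..x, weakDeriv u t := by
  rw [evalAt_of_mem u hx, evalAt_of_mem u (by norm_num)]
  exact u.2 ⟨x, hx⟩

theorem intervalIntegrable_weakDeriv (u : W1p p) :
    IntervalIntegrable (weakDeriv u) volume (-1) 1 :=
  intervalIntegrable_of_Lp u.1.2 ⟨1, by norm_num, le_rfl⟩

theorem ae_hasDerivAt_evalAt (u : W1p p) :
    ∀ᵐ x, x ∈ Ioo (-1 : ℝ) 1 → HasDerivAt (evalAt u) (weakDeriv u x) x := by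
  filter_upwards [(intervalIntegrable_weakDeriv u).ae_hasDerivAt_integral] with x hx hxI
  rw [uIcc_of_le (by norm_num)] at hx
  have h := hx (Ioo_subset_Icc_self hxI) (-1) (by norm_num)
  refine (h.const_add (evalAt u (-1))).congr_of_eventuallyEq ?_
  filter_upwards [Ioo_mem_nhds hxI.1 hxI.2] with y hy
  exact evalAt_eq_add_integral u (Ioo_subset_Icc_self hy)

theorem absolutelyContinuousOnInterval_evalAt (u : W1p p) :
    AbsolutelyContinuousOnInterval (evalAt u) (-1) 1 := by
  refine absolutelyContinuousOnInterval_of_dist_le (K := 1)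
    ((intervalIntegrable_weakDeriv u).absolutelyContinuousOnInterval_intervalIntegral
      (c := -1) (by simp)) fun x hx y hy => ?_
  rw [uIcc_of_le (by norm_num)] at hx hy
  rw [evalAt_eq_add_integral u hx, evalAt_eq_add_integral u hy, dist_add_left, one_mul]

theorem integrableOn_abs_weakDeriv_rpow (u : W1p p) :
    IntegrableOn (fun x => |weakDeriv u x| ^ p) (Ioo (-1) 1) := by
  have hp : 1 < p := Fact.out
  have h := (Lp.memLp u.1.2).integrable_norm_rpow (by simpa using by linarith) (by simp)
  rw [ENNReal.toReal_ofReal (by linarith)] at h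
  exact h

theorem integral_abs_weakDeriv_rpow (u : W1p p) :
    ∫ x in Ioo (-1 : ℝ) 1, |weakDeriv u x| ^ p = ‖u.1.2‖ ^ p := by
  have hp : 1 < p := Fact.out
  have h := (Lp.memLp u.1.2).eLpNorm_eq_integral_rpow_norm (by simpa using by linarith) (by simp)
  rw [Lp.norm_def, h, ENNReal.toReal_ofReal (by positivity),
    ENNReal.toReal_ofReal (by linarith), ← Real.rpow_mul (by positivity),
    inv_mul_cancel₀ (by linarith), Real.rpow_one]
  rfl

theorem integrableOn_mul_abs_evalAt_rpow {V : ℝ → ℝ} (hV : Continuous V) (u : W1p p) :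
    IntegrableOn (fun x => V x * |evalAt u x| ^ p) (Ioo (-1) 1) := by
  have hp : 1 < p := Fact.out
  have : Continuous fun x => V x * |evalAt u x| ^ p :=
    hV.mul ((continuous_evalAt u).abs.rpow_const fun _ => Or.inr (by linarith))
  exact (this.integrableOn_Icc).mono_set Ioo_subset_Icc_self

theorem integrableOn_abs_evalAt_rpow (u : W1p p) :
    IntegrableOn (fun x => |evalAt u x| ^ p) (Ioo (-1) 1) := by
  simpa using integrableOn_mul_abs_evalAt_rpow continuous_const (V := fun _ => 1) u

/-- The numerator of the Rayleigh quotient: the energy functional of the Robin problem. -/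
noncomputable def energy (p : ℝ) [Fact (1 < p)] (α : ℝ) (V : ℝ → ℝ) (u : W1p p) : ℝ :=
  (∫ x in Ioo (-1 : ℝ) 1, (|weakDeriv u x| ^ p + V x * |evalAt u x| ^ p))
      + α * (|evalAt u 1| ^ p + |evalAt u (-1)| ^ p)

/-- The denominator of the Rayleigh quotient: the normalizing functional `∫ |u|^p`. -/
noncomputable def mass (p : ℝ) [Fact (1 < p)] (u : W1p p) : ℝ :=
  ∫ x in Ioo (-1 : ℝ) 1, |evalAt u x| ^ p

theorem rayleigh_eq (α : ℝ) (V : ℝ → ℝ) (u : W1p p) :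
    rayleigh p α V u = energy p α V u / mass p u := rfl

theorem energy_eq {V : ℝ → ℝ} (hV : Continuous V) (α : ℝ) (u : W1p p) :
    energy p α V u = (∫ x in Ioo (-1 : ℝ) 1, |weakDeriv u x| ^ p)
      + (∫ x in Ioo (-1 : ℝ) 1, V x * |evalAt u x| ^ p)
      + α * (|evalAt u 1| ^ p + |evalAt u (-1)| ^ p) := by
  rw [energy, integral_add (integrableOn_abs_weakDeriv_rpow u)
    (integrableOn_mul_abs_evalAt_rpow hV u)]

theorem eq_zero_of_evalAt_eq_zero {u : W1p p} (h : ∀ x ∈ Icc (-1 : ℝ) 1, evalAt u x = 0) :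
    u = 0 := by
  have hfst : u.1.1 = 0 := by
    ext x
    have := h x x.2
    rwa [evalAt_of_mem u x.2] at this
  have hsnd : u.1.2 = 0 := by
    rw [Lp.eq_zero_iff_ae_eq_zero, Filter.EventuallyEq, ae_restrict_iff' measurableSet_Ioo]
    filter_upwards [ae_hasDerivAt_evalAt u] with x hx hxI
    have hzero : HasDerivAt (evalAt u) 0 x := by
      refine (hasDerivAt_const x (0 : ℝ)).congr_of_eventuallyEq ?_
      filter_upwards [Ioo_mem_nhds hxI.1 hxI.2] with y hy
      exact h y (Ioo_subset_Icc_self hy)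
    exact (hx hxI).unique hzero
  exact Subtype.ext (Prod.ext hfst hsnd)

theorem mass_pos {u : W1p p} (hu : u ≠ 0) : 0 < mass p u := by
  have hp : 1 < p := Fact.out
  have hcont : Continuous fun x => |evalAt u x| ^ p :=
    (continuous_evalAt u).abs.rpow_const fun _ => Or.inr (by linarith)
  obtain ⟨x, hx, hux⟩ : ∃ x ∈ Icc (-1 : ℝ) 1, evalAt u x ≠ 0 := by
    by_contra! h
    exact hu (eq_zero_of_evalAt_eq_zero h)
  have := intervalIntegral.integral_pos (a := -1) (b := 1) (by norm_num) hcont.continuousOn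
    (fun y _ => by positivity) ⟨x, hx, by positivity⟩
  rwa [intervalIntegral.integral_of_le (by norm_num), integral_Ioc_eq_integral_Ioo] at this

theorem continuous_evalAt_const (x : ℝ) : Continuous fun u : W1p p => evalAt u x :=
  (ContinuousEvalConst.continuous_eval_const (F := C(Ibar, ℝ))
    (projIcc (-1) 1 (by norm_num) x)).comp (continuous_fst.comp continuous_subtype_val)

theorem continuous_abs_evalAt_const_rpow (x : ℝ) :
    Continuous fun u : W1p p => |evalAt u x| ^ p := by
  have hp : 1 < p := Fact.out
  exact (continuous_evalAt_const x).abs.rpow_const fun _ => Or.inr (by linarith)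

theorem continuous_integral_mul_abs_evalAt_rpow {V : ℝ → ℝ} (hV : Continuous V) :
    Continuous fun u : W1p p => ∫ x in Ioo (-1 : ℝ) 1, V x * |evalAt u x| ^ p := by
  have hp : 1 < p := Fact.out
  rw [continuous_iff_continuousAt]
  intro u
  have hint : IntegrableOn (fun x => |V x| * (‖u.1.1‖ + 1) ^ p) (Ioo (-1) 1) :=
    ((hV.abs.mul continuous_const).integrableOn_Icc).mono_set Ioo_subset_Icc_self
  have hnorm : ∀ᶠ v : W1p p in 𝓝 u, ‖v.1.1‖ < ‖u.1.1‖ + 1 :=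
    (continuous_fst.comp continuous_subtype_val).norm.continuousAt.eventually
      (gt_mem_nhds (by simp))
  refine continuousAt_of_dominated (Eventually.of_forall fun v =>
    (integrableOn_mul_abs_evalAt_rpow hV v).aestronglyMeasurable) ?_ hint
    (Eventually.of_forall fun x =>
      ((continuous_abs_evalAt_const_rpow x).const_mul _).continuousAt)
  filter_upwards [hnorm] with v hv
  refine Eventually.of_forall fun x => ?_
  rw [norm_mul, Real.norm_eq_abs, Real.norm_of_nonneg (by positivity)]
  gcongr
  exact (v.1.1.norm_coe_le_norm _).trans hv.le

theorem continuous_integral_abs_weakDeriv_rpow :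
    Continuous fun u : W1p p => ∫ x in Ioo (-1 : ℝ) 1, |weakDeriv u x| ^ p := by
  have hp : 1 < p := Fact.out
  simp_rw [integral_abs_weakDeriv_rpow]
  exact ((continuous_snd.comp continuous_subtype_val).norm).rpow_const
    fun _ => Or.inr (by linarith)

theorem continuous_energy {V : ℝ → ℝ} (hV : Continuous V) (α : ℝ) :
    Continuous (energy p α V) :=
  ((continuous_integral_abs_weakDeriv_rpow.add (continuous_integral_mul_abs_evalAt_rpow hV)).add
    (((continuous_abs_evalAt_const_rpow 1).add
      (continuous_abs_evalAt_const_rpow (-1))).const_mul α)).congr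
    fun u => (energy_eq hV α u).symm

theorem continuous_mass : Continuous (mass p) := by
  change Continuous fun u : W1p p => ∫ x in Ioo (-1 : ℝ) 1, |evalAt u x| ^ p
  simpa using continuous_integral_mul_abs_evalAt_rpow (p := p) (V := fun _ => 1) continuous_const

theorem continuousOn_rayleigh {V : ℝ → ℝ} (hV : Continuous V) (α : ℝ) :
    ContinuousOn (rayleigh p α V) {u | u ≠ 0} :=
  (continuous_energy hV α).continuousOn.div continuous_mass.continuousOn
    fun _ hu => (mass_pos hu).ne'

theorem exists_evalAt_eq_weakDeriv_ae_eq {f f' : ℝ → ℝ} {C : ℝ} {s : Set ℝ} (hs : s.Countable)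
    (hf : ContinuousOn f (Icc (-1) 1)) (hf' : ∀ x ∈ Ioo (-1 : ℝ) 1 \ s, HasDerivAt f (f' x) x)
    (hm : AEStronglyMeasurable f' μI) (hC : ∀ x ∈ Ioo (-1 : ℝ) 1, |f' x| ≤ C) :
    ∃ u : W1p p, (∀ x ∈ Icc (-1 : ℝ) 1, evalAt u x = f x) ∧ weakDeriv u =ᵐ[μI] f' := by
  have hmem : MemLp f' (ENNReal.ofReal p) μI := by
    refine MemLp.of_bound hm C ?_
    rw [ae_restrict_iff' measurableSet_Ioo]
    exact Eventually.of_forall hC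
  let F : C(Ibar, ℝ) := ⟨fun x => f x, continuousOn_iff_continuous_domRestrict.1 hf⟩
  have hw : ((F, hmem.toLp f') : C(Ibar, ℝ) × Lp ℝ (ENNReal.ofReal p) μI) ∈ W1p p := by
    intro x
    rw [intervalIntegral_congr_of_ae hmem.coeFn_toLp x]
    change f x = f (-1) + _
    have hint : IntervalIntegrable f' volume (-1) x :=
      ((intervalIntegrable_of_Lp (hmem.toLp f') x).congr_ae
        (by
          rw [uIoc_of_le x.2.1, ← restrict_Ioo_eq_restrict_Ioc]
          exact ae_mono (Measure.restrict_mono (Ioo_subset_Ioo_right x.2.2) le_rfl)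
            hmem.coeFn_toLp))
    rw [integral_eq_of_hasDerivAt_off_countable f f' hs
      (by rw [uIcc_of_le x.2.1]; exact hf.mono (Icc_subset_Icc_right x.2.2))
      (by
        rw [min_eq_left x.2.1, max_eq_right x.2.1]
        exact fun y hy => hf' y ⟨⟨hy.1.1, hy.1.2.trans_le x.2.2⟩, hy.2⟩) hint]
    ring
  exact ⟨⟨_, hw⟩, fun x hx => evalAt_of_mem _ hx, hmem.coeFn_toLp⟩

end W1p

/-! ### Picone's inequality -/

theorem max_abs_sub_rpow {p ε : ℝ} (hp : 0 < p) (hε : 0 ≤ ε) (t : ℝ) :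
    max (|t| - ε) 0 ^ p = max (t - ε) 0 ^ p + max (-t - ε) 0 ^ p := by
  rcases le_total 0 t with ht | ht
  · rw [abs_of_nonneg ht, max_eq_right (by linarith : -t - ε ≤ 0), Real.zero_rpow hp.ne', add_zero]
  · rw [abs_of_nonpos ht, max_eq_right (by linarith : t - ε ≤ 0), Real.zero_rpow hp.ne', zero_add]

theorem hasDerivAt_max_abs_sub_rpow {p ε : ℝ} (hp : 1 < p) (hε : 0 ≤ ε) (t : ℝ) :
    HasDerivAt (fun t : ℝ => max (|t| - ε) 0 ^ p)
      (p * (max (t - ε) 0 ^ (p - 1) - max (-t - ε) 0 ^ (p - 1))) t := by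
  have hpos := (hasDerivAt_max_zero_rpow hp (t - ε)).comp t ((hasDerivAt_id t).sub_const ε)
  have hneg := (hasDerivAt_max_zero_rpow hp (-t - ε)).comp t ((hasDerivAt_neg t).sub_const ε)
  refine ((hpos.add hneg).congr_deriv (by ring)).congr_of_eventuallyEq ?_
  filter_upwards with y
  simpa using max_abs_sub_rpow (by linarith : 0 < p) hε y

theorem abs_deriv_max_abs_sub_rpow_le {p ε : ℝ} (hp : 1 < p) (hε : 0 ≤ ε) (t : ℝ) :
    |p * (max (t - ε) 0 ^ (p - 1) - max (-t - ε) 0 ^ (p - 1))|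
      ≤ p * max (|t| - ε) 0 ^ (p - 1) := by
  rw [max_abs_sub_rpow (by linarith) hε, abs_mul, abs_of_pos (by linarith : 0 < p)]
  have hpos : 0 ≤ max (t - ε) 0 ^ (p - 1) := by positivity
  have hneg : 0 ≤ max (-t - ε) 0 ^ (p - 1) := by positivity
  gcongr
  rw [abs_le]
  constructor <;> linarith

theorem absolutelyContinuousOnInterval_of_hasDerivAt {r r' : ℝ → ℝ} {a b : ℝ} (hab : a ≤ b)
    (hr : ∀ x ∈ Icc a b, HasDerivAt r (r' x) x) (hr' : ContinuousOn r' (Icc a b)) :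
    AbsolutelyContinuousOnInterval r a b := by
  obtain ⟨C, hC⟩ := isCompact_Icc.exists_bound_of_continuousOn hr'
  have hC0 : 0 ≤ C := (norm_nonneg _).trans (hC a ⟨le_rfl, hab⟩)
  have : LipschitzOnWith C.toNNReal r (Icc a b) :=
    (convex_Icc a b).lipschitzOnWith_of_nnnorm_hasDerivWithin_le
      (fun x hx => (hr x hx).hasDerivWithinAt)
      (fun x hx => by
        rw [← NNReal.coe_le_coe, coe_nnnorm, Real.coe_toNNReal C hC0]
        exact hC x hx)
  rw [← uIcc_of_le hab] at this
  exact this.absolutelyContinuousOnInterval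

theorem absolutelyContinuousOnInterval_max_abs_sub_rpow {p ε : ℝ} (hp : 1 < p) (hε : 0 ≤ ε)
    {u : ℝ → ℝ} {a b : ℝ} (hu : AbsolutelyContinuousOnInterval u a b) :
    AbsolutelyContinuousOnInterval (fun x => max (|u x| - ε) 0 ^ p) a b := by
  obtain ⟨M, hM⟩ := hu.exists_bound
  refine absolutelyContinuousOnInterval_of_dist_le (K := p * M ^ (p - 1)) hu fun x hx y hy => ?_
  have hbound : ∀ t ∈ Icc (-M) M,
      ‖p * (max (t - ε) 0 ^ (p - 1) - max (-t - ε) 0 ^ (p - 1))‖ ≤ p * M ^ (p - 1) := by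
    intro t ht
    have htM : |t| ≤ M := abs_le.2 ht
    refine (abs_deriv_max_abs_sub_rpow_le hp hε t).trans ?_
    gcongr
    exact max_le (by linarith) ((abs_nonneg t).trans htM)
  exact (convex_Icc (-M) M).norm_image_sub_le_of_norm_hasDerivWithin_le
    (fun t _ => (hasDerivAt_max_abs_sub_rpow hp hε t).hasDerivWithinAt) hbound
    (abs_le.1 (hM y hy)) (abs_le.1 (hM x hx))

theorem picone_pointwise {p q : ℝ} (hpq : p.HolderConjugate q) {ε : ℝ} (hε : 0 ≤ ε)
    {r r' W t s : ℝ} (hle : r' ≤ W - (p - 1) * |r| ^ q) :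
    r' * max (|t| - ε) 0 ^ p
        + r * (p * (max (t - ε) 0 ^ (p - 1) - max (-t - ε) 0 ^ (p - 1)) * s)
      ≤ |s| ^ p + W * max (|t| - ε) 0 ^ p := by
  set D := p * (max (t - ε) 0 ^ (p - 1) - max (-t - ε) 0 ^ (p - 1))
  have hriccati : r' * max (|t| - ε) 0 ^ p ≤ (W - (p - 1) * |r| ^ q) * max (|t| - ε) 0 ^ p :=
    mul_le_mul_of_nonneg_right hle (by positivity)
  have hyoung := mul_rpow_le_add hpq r s (le_max_right (|t| - ε) 0)
  have hcross : r * (D * s) ≤ p * (|r| * max (|t| - ε) 0 ^ (p - 1) * |s|) :=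
    calc r * (D * s) ≤ |r| * (|D| * |s|) := by rw [← abs_mul, ← abs_mul]; exact le_abs_self _
      _ ≤ |r| * (p * max (|t| - ε) 0 ^ (p - 1) * |s|) := by
        gcongr
        exact abs_deriv_max_abs_sub_rpow_le hpq.lt hε t
      _ = p * (|r| * max (|t| - ε) 0 ^ (p - 1) * |s|) := by ring
  linarith

theorem picone_integral {p q : ℝ} (hpq : p.HolderConjugate q) {u g r r' W : ℝ → ℝ} {a b ε : ℝ}
    (hab : a ≤ b) (hε : 0 ≤ ε) (hu : AbsolutelyContinuousOnInterval u a b)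
    (hg : ∀ᵐ x, x ∈ Ioo a b → HasDerivAt u (g x) x)
    (hgp : IntervalIntegrable (fun x => |g x| ^ p) volume a b)
    (hr : ∀ x ∈ Icc a b, HasDerivAt r (r' x) x) (hr' : ContinuousOn r' (Icc a b))
    (hW : ContinuousOn W (Icc a b)) (hle : ∀ x ∈ Icc a b, r' x ≤ W x - (p - 1) * |r x| ^ q) :
    r b * max (|u b| - ε) 0 ^ p - r a * max (|u a| - ε) 0 ^ p
      ≤ ∫ x in a..b, (|g x| ^ p + W x * max (|u x| - ε) 0 ^ p) := by
  have htrunc := absolutelyContinuousOnInterval_max_abs_sub_rpow hpq.lt hε hu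
  have hprod := (absolutelyContinuousOnInterval_of_hasDerivAt hab hr hr').fun_mul htrunc
  have hint : IntervalIntegrable (fun x => |g x| ^ p + W x * max (|u x| - ε) 0 ^ p) volume a b := by
    refine hgp.add (ContinuousOn.intervalIntegrable ?_)
    have := htrunc.continuousOn
    rw [uIcc_of_le hab] at this ⊢
    exact hW.mul this
  rw [← hprod.integral_deriv_eq_sub]
  refine intervalIntegral.integral_mono_ae_restrict hab hprod.intervalIntegrable_deriv hint ?_
  rw [← restrict_Ioo_eq_restrict_Icc, Filter.EventuallyLE, ae_restrict_iff' measurableSet_Ioo]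
  filter_upwards [hg] with x hx hxI
  have hxc := Ioo_subset_Icc_self hxI
  have hderiv := (hr x hxc).mul ((hasDerivAt_max_abs_sub_rpow hpq.lt hε (u x)).comp x (hx hxI))
  exact hderiv.deriv.trans_le (picone_pointwise hpq hε (hle x hxc))

/-- The Riccati equation `r' = V - l - (p - 1) |r|^q` on `s`, which holds for
`r = |f'|^{p-2} f' / (|f|^{p-2} f)` wherever `f ≠ 0` solves `-(|f'|^{p-2} f')' + V |f|^{p-2} f =
l |f|^{p-2} f`. -/
def IsRiccatiOn (p q : ℝ) (V : ℝ → ℝ) (l : ℝ) (r : ℝ → ℝ) (s : Set ℝ) : Prop :=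
  ∀ x ∈ s, HasDerivAt r (V x - l - (p - 1) * |r x| ^ q) x

section Riccati

variable {p q l : ℝ} {V r : ℝ → ℝ} {s : Set ℝ}

theorem IsRiccatiOn.mono (hr : IsRiccatiOn p q V l r s) {t : Set ℝ} (hts : t ⊆ s) :
    IsRiccatiOn p q V l r t :=
  fun x hx => hr x (hts hx)

theorem IsRiccatiOn.continuousOn (hr : IsRiccatiOn p q V l r s) : ContinuousOn r s :=
  HasDerivAt.continuousOn hr

theorem IsRiccatiOn.continuousOn_deriv (hr : IsRiccatiOn p q V l r s) (hq : 0 ≤ q)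
    (hV : ContinuousOn V s) : ContinuousOn (fun x => V x - l - (p - 1) * |r x| ^ q) s :=
  (hV.sub continuousOn_const).sub
    (continuousOn_const.mul (hr.continuousOn.abs.rpow_const fun _ _ => Or.inr hq))

end Riccati

section Bounds

variable {p : ℝ} [hp : Fact (1 < p)] {q : ℝ}

theorem intervalIntegrable_abs_weakDeriv_rpow (u : W1p p) {a b : ℝ}
    (ha : -1 ≤ a) (hab : a ≤ b) (hb : b ≤ 1) :
    IntervalIntegrable (fun x => |weakDeriv u x| ^ p) volume a b := by
  rw [intervalIntegrable_iff_integrableOn_Ioo_of_le hab]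
  exact (integrableOn_abs_weakDeriv_rpow u).mono_set (Ioo_subset_Ioo ha hb)

theorem continuous_max_abs_evalAt_sub_rpow (u : W1p p) (ε : ℝ) :
    Continuous fun x => max (|evalAt u x| - ε) 0 ^ p :=
  (((continuous_evalAt u).abs.sub continuous_const).max continuous_const).rpow_const
    fun _ => Or.inr (by linarith [hp.out])

theorem intervalIntegrable_truncated_energy (u : W1p p) {W : ℝ → ℝ} (hW : Continuous W) (ε : ℝ)
    {a b : ℝ} (ha : -1 ≤ a) (hab : a ≤ b) (hb : b ≤ 1) :
    IntervalIntegrable (fun x => |weakDeriv u x| ^ p + W x * max (|evalAt u x| - ε) 0 ^ p)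
      volume a b :=
  (intervalIntegrable_abs_weakDeriv_rpow u ha hab hb).add
    ((hW.mul (continuous_max_abs_evalAt_sub_rpow u ε)).intervalIntegrable _ _)

theorem picone_evalAt (hpq : p.HolderConjugate q) (u : W1p p) {r r' W : ℝ → ℝ} {a b ε : ℝ}
    (ha : -1 ≤ a) (hab : a ≤ b) (hb : b ≤ 1) (hε : 0 ≤ ε)
    (hr : ∀ x ∈ Icc a b, HasDerivAt r (r' x) x) (hr' : ContinuousOn r' (Icc a b))
    (hW : Continuous W) (hle : ∀ x ∈ Icc a b, r' x ≤ W x - (p - 1) * |r x| ^ q) :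
    r b * max (|evalAt u b| - ε) 0 ^ p - r a * max (|evalAt u a| - ε) 0 ^ p
      ≤ ∫ x in a..b, (|weakDeriv u x| ^ p + W x * max (|evalAt u x| - ε) 0 ^ p) := by
  have hsub : uIcc a b ⊆ uIcc (-1) 1 := by
    rw [uIcc_of_le hab, uIcc_of_le (by norm_num)]
    exact Icc_subset_Icc ha hb
  refine picone_integral hpq hab hε ((absolutelyContinuousOnInterval_evalAt u).mono hsub) ?_
    (intervalIntegrable_abs_weakDeriv_rpow u ha hab hb) hr hr' hW.continuousOn hle
  filter_upwards [ae_hasDerivAt_evalAt u] with x hx hxI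
  exact hx (Ioo_subset_Ioo ha hb hxI)

theorem energy_sub_eq {V : ℝ → ℝ} (hV : Continuous V) (α l : ℝ) (u : W1p p) :
    energy p α V u - l * mass p u
      = (∫ x in (-1 : ℝ)..1, (|weakDeriv u x| ^ p + (V x - l) * |evalAt u x| ^ p))
        + α * (|evalAt u 1| ^ p + |evalAt u (-1)| ^ p) := by
  have hW : Continuous fun x => V x - l := hV.sub continuous_const
  rw [intervalIntegral.integral_of_le (by norm_num), integral_Ioc_eq_integral_Ioo,
    energy_eq hV, mass, integral_add (integrableOn_abs_weakDeriv_rpow u)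
      (integrableOn_mul_abs_evalAt_rpow hW u)]
  simp_rw [sub_mul]
  rw [integral_sub (integrableOn_mul_abs_evalAt_rpow hV u)
      (integrableOn_mul_abs_evalAt_rpow continuous_const u), integral_const_mul]
  ring

theorem mul_mass_le_energy_of_subsolution (hpq : p.HolderConjugate q) {V : ℝ → ℝ}
    (hV : Continuous V) {α l : ℝ} {r r' : ℝ → ℝ}
    (hr : ∀ x ∈ Icc (-1 : ℝ) 1, HasDerivAt r (r' x) x) (hr' : ContinuousOn r' (Icc (-1) 1))
    (hle : ∀ x ∈ Icc (-1 : ℝ) 1, r' x ≤ V x - l - (p - 1) * |r x| ^ q)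
    (hright : r 1 = -α) (hleft : r (-1) = α) (u : W1p p) : l * mass p u ≤ energy p α V u := by
  have hW : Continuous fun x => V x - l := hV.sub continuous_const
  have h := picone_evalAt hpq u le_rfl (by norm_num) le_rfl le_rfl hr hr' hW hle
  simp only [sub_zero, abs_nonneg, sup_of_le_left, hright, hleft] at h
  have := energy_sub_eq hV α l u
  linarith

theorem exists_mul_mass_le_energy {V : ℝ → ℝ} (hV : Continuous V) (α : ℝ) :
    ∃ l : ℝ, ∀ u : W1p p, l * mass p u ≤ energy p α V u := by
  have hpq := Real.HolderConjugate.conjExponent hp.out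
  set q := p.conjExponent
  obtain ⟨C, hC⟩ := (isCompact_Icc (a := (-1 : ℝ)) (b := 1)).exists_bound_of_continuousOn
    hV.continuousOn
  refine ⟨-C - |α| - (p - 1) * |α| ^ q, fun u => mul_mass_le_energy_of_subsolution hpq hV
    (r := fun x => -α * x) (r' := fun _ => -α)
    (fun x _ => by simpa using (hasDerivAt_id x).const_mul (-α))
    continuousOn_const (fun x hx => ?_) (by simp) (by simp) u⟩
  have hVx := neg_le_of_abs_le (hC x hx)
  have hrpow : (p - 1) * |(-α) * x| ^ q ≤ (p - 1) * |α| ^ q := by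
    refine mul_le_mul_of_nonneg_left (Real.rpow_le_rpow (abs_nonneg _) ?_ hpq.symm.nonneg)
      hpq.sub_one_pos.le
    rw [abs_mul, abs_neg]
    exact mul_le_of_le_one_right (abs_nonneg _) (abs_le.2 hx)
  linarith [neg_abs_le α, neg_le_abs α]

theorem continuous_integral_max_abs_sub_rpow (u : W1p p) {W : ℝ → ℝ} (hW : Continuous W)
    {a b : ℝ} : Continuous fun ε : ℝ => ∫ x in a..b, W x * max (|evalAt u x| - ε) 0 ^ p := by
  refine intervalIntegral.continuous_parametric_intervalIntegral_of_continuous' ?_ a b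
  have hev := (continuous_evalAt u).comp (continuous_snd (X := ℝ) (Y := ℝ))
  exact (hW.comp continuous_snd).mul (((hev.abs.sub continuous_fst).max continuous_const).rpow_const
    fun _ => Or.inr (by linarith [hp.out]))

theorem le_integral_of_forall_truncated_le (u : W1p p) {W : ℝ → ℝ} (hW : Continuous W)
    {a b B e : ℝ} (ha : -1 ≤ a) (hab : a ≤ b) (hb : b ≤ 1)
    (h : ∀ ε > 0, B * max (|evalAt u e| - ε) 0 ^ p
      ≤ ∫ x in a..b, (|weakDeriv u x| ^ p + W x * max (|evalAt u x| - ε) 0 ^ p)) :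
    B * |evalAt u e| ^ p ≤ ∫ x in a..b, (|weakDeriv u x| ^ p + W x * |evalAt u x| ^ p) := by
  have hsplit : ∀ ε : ℝ, ∫ x in a..b, (|weakDeriv u x| ^ p + W x * max (|evalAt u x| - ε) 0 ^ p)
      = (∫ x in a..b, |weakDeriv u x| ^ p)
        + ∫ x in a..b, W x * max (|evalAt u x| - ε) 0 ^ p := fun ε =>
    intervalIntegral.integral_add (intervalIntegrable_abs_weakDeriv_rpow u ha hab hb)
      ((hW.mul (continuous_max_abs_evalAt_sub_rpow u ε)).intervalIntegrable _ _)
  have hL : Continuous fun ε : ℝ => B * max (|evalAt u e| - ε) 0 ^ p :=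
    continuous_const.mul (((continuous_const.sub continuous_id).max continuous_const).rpow_const
      fun _ => Or.inr (by linarith [hp.out]))
  have hR : Continuous fun ε : ℝ =>
      ∫ x in a..b, (|weakDeriv u x| ^ p + W x * max (|evalAt u x| - ε) 0 ^ p) := by
    simp_rw [hsplit]
    exact continuous_const.add (continuous_integral_max_abs_sub_rpow u hW)
  have := le_of_tendsto_of_tendsto (b := 𝓝[>] (0 : ℝ))
    ((hL.tendsto 0).mono_left nhdsWithin_le_nhds) ((hR.tendsto 0).mono_left nhdsWithin_le_nhds)
    (by filter_upwards [self_mem_nhdsWithin] with ε hε using h ε hε)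
  simpa only [sub_zero, abs_nonneg, sup_of_le_left] using this

theorem integral_truncated_nonneg (u : W1p p) (W : ℝ → ℝ) {a b ε : ℝ} (hab : a ≤ b)
    (hsmall : ∀ x ∈ Icc a b, |evalAt u x| ≤ ε) :
    0 ≤ ∫ x in a..b, (|weakDeriv u x| ^ p + W x * max (|evalAt u x| - ε) 0 ^ p) := by
  refine intervalIntegral.integral_nonneg hab fun x hx => ?_
  rw [max_eq_right (sub_nonpos.2 (hsmall x hx)), Real.zero_rpow (by linarith [hp.out]), mul_zero,
    add_zero]
  positivity

theorem exists_forall_abs_evalAt_le (u : W1p p) {c ε : ℝ} (hε : 0 < ε) (hu : evalAt u c = 0) :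
    ∃ δ > 0, ∀ x ∈ Icc (c - δ) (c + δ), |evalAt u x| ≤ ε := by
  have hev : ∀ᶠ x in 𝓝 c, |evalAt u x| ≤ ε := by
    refine (continuous_evalAt u).abs.continuousAt.eventually_le_const ?_
    simpa only [hu, abs_zero] using hε
  obtain ⟨δ, hδ, hsub⟩ := (Metric.nhds_basis_closedBall (x := c)).eventually_iff.1 hev
  rw [Real.closedBall_eq_Icc] at hsub
  exact ⟨δ, hδ, hsub⟩

theorem mul_truncated_le_integral_of_riccati (hpq : p.HolderConjugate q) {V : ℝ → ℝ}
    (hV : Continuous V) {l a b ε : ℝ} {r : ℝ → ℝ} (ha : -1 ≤ a) (hab : a ≤ b) (hb : b ≤ 1)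
    (hε : 0 ≤ ε) (hr : IsRiccatiOn p q V l r (Icc a b)) (u : W1p p) :
    r b * max (|evalAt u b| - ε) 0 ^ p - r a * max (|evalAt u a| - ε) 0 ^ p
      ≤ ∫ x in a..b, (|weakDeriv u x| ^ p + (V x - l) * max (|evalAt u x| - ε) 0 ^ p) :=
  picone_evalAt hpq u ha hab hb hε hr (hr.continuousOn_deriv hpq.symm.nonneg hV.continuousOn)
    (hV.sub continuous_const) fun _ _ => le_rfl

theorem mul_le_integral_right_of_node (hpq : p.HolderConjugate q) {V : ℝ → ℝ} (hV : Continuous V)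
    {l c : ℝ} {r : ℝ → ℝ} (hc : c ∈ Ioo (-1 : ℝ) 1) (hr : IsRiccatiOn p q V l r (Ioc c 1))
    {u : W1p p} (hu : evalAt u c = 0) :
    r 1 * |evalAt u 1| ^ p
      ≤ ∫ x in c..1, (|weakDeriv u x| ^ p + (V x - l) * |evalAt u x| ^ p) := by
  have hW : Continuous fun x => V x - l := hV.sub continuous_const
  refine le_integral_of_forall_truncated_le u hW hc.1.le hc.2.le le_rfl fun ε hε => ?_
  obtain ⟨δ, hδ, hsmall⟩ := exists_forall_abs_evalAt_le u hε hu
  set a := min (c + δ) 1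
  have hca : c < a := lt_min (by linarith) hc.2
  have ha1 : a ≤ 1 := min_le_right _ _
  have hnear : ∀ x ∈ Icc c a, |evalAt u x| ≤ ε := fun x hx =>
    hsmall x ⟨by linarith [hx.1], hx.2.trans (min_le_left _ _)⟩
  have hfar := mul_truncated_le_integral_of_riccati hpq hV (hc.1.trans hca).le ha1 le_rfl hε.le
    (hr.mono fun x hx => ⟨hca.trans_le hx.1, hx.2⟩) u
  rw [max_eq_right (sub_nonpos.2 (hnear a ⟨hca.le, le_rfl⟩)), Real.zero_rpow hpq.ne_zero, mul_zero,
    sub_zero] at hfar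
  rw [← intervalIntegral.integral_add_adjacent_intervals
    (intervalIntegrable_truncated_energy u hW ε hc.1.le hca.le ha1)
    (intervalIntegrable_truncated_energy u hW ε (hc.1.trans hca).le ha1 le_rfl)]
  exact hfar.trans (le_add_of_nonneg_left (integral_truncated_nonneg u _ hca.le hnear))

theorem neg_mul_le_integral_left_of_node (hpq : p.HolderConjugate q) {V : ℝ → ℝ}
    (hV : Continuous V) {l c : ℝ} {r : ℝ → ℝ} (hc : c ∈ Ioo (-1 : ℝ) 1)
    (hr : IsRiccatiOn p q V l r (Ico (-1) c)) {u : W1p p} (hu : evalAt u c = 0) :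
    -r (-1) * |evalAt u (-1)| ^ p
      ≤ ∫ x in (-1)..c, (|weakDeriv u x| ^ p + (V x - l) * |evalAt u x| ^ p) := by
  have hW : Continuous fun x => V x - l := hV.sub continuous_const
  refine le_integral_of_forall_truncated_le u hW le_rfl hc.1.le hc.2.le fun ε hε => ?_
  obtain ⟨δ, hδ, hsmall⟩ := exists_forall_abs_evalAt_le u hε hu
  set b := max (c - δ) (-1)
  have hbc : b < c := max_lt (by linarith) hc.1
  have hb1 : -1 ≤ b := le_max_right _ _
  have hnear : ∀ x ∈ Icc b c, |evalAt u x| ≤ ε := fun x hx =>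
    hsmall x ⟨(le_max_left _ _).trans hx.1, by linarith [hx.2]⟩
  have hfar := mul_truncated_le_integral_of_riccati hpq hV le_rfl hb1 (hbc.trans hc.2).le hε.le
    (hr.mono fun x hx => ⟨hx.1, hx.2.trans_lt hbc⟩) u
  rw [max_eq_right (sub_nonpos.2 (hnear b ⟨le_rfl, hbc.le⟩)), Real.zero_rpow hpq.ne_zero, mul_zero,
    zero_sub, ← neg_mul] at hfar
  rw [← intervalIntegral.integral_add_adjacent_intervals
    (intervalIntegrable_truncated_energy u hW ε le_rfl hb1 (hbc.trans hc.2).le)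
    (intervalIntegrable_truncated_energy u hW ε hb1 hbc.le hc.2.le)]
  exact hfar.trans (le_add_of_nonneg_right (integral_truncated_nonneg u _ hbc.le hnear))

theorem mul_mass_le_energy_of_node (hpq : p.HolderConjugate q) {V : ℝ → ℝ} (hV : Continuous V)
    {α l c : ℝ} {r s : ℝ → ℝ} (hc : c ∈ Ioo (-1 : ℝ) 1)
    (hr : IsRiccatiOn p q V l r (Ioc c 1)) (hr1 : r 1 = -α)
    (hs : IsRiccatiOn p q V l s (Ico (-1) c)) (hs1 : s (-1) = α)
    {u : W1p p} (hu : evalAt u c = 0) : l * mass p u ≤ energy p α V u := by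
  have hright := mul_le_integral_right_of_node hpq hV hc hr hu
  have hleft := neg_mul_le_integral_left_of_node hpq hV hc hs hu
  rw [hr1] at hright
  rw [hs1] at hleft
  have hint : ∀ a b : ℝ, -1 ≤ a → a ≤ b → b ≤ 1 → IntervalIntegrable
      (fun x => |weakDeriv u x| ^ p + (V x - l) * |evalAt u x| ^ p) volume a b := by
    simpa only [Pi.sub_apply, sub_zero, abs_nonneg, sup_of_le_left] using fun a b =>
      intervalIntegrable_truncated_energy u (hV.sub (continuous_const (y := l))) 0 (a := a) (b := b)
  have henergy := energy_sub_eq hV α l u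
  rw [← intervalIntegral.integral_add_adjacent_intervals (hint (-1) c le_rfl hc.1.le hc.2.le)
    (hint c 1 hc.1.le hc.2.le le_rfl)] at henergy
  linarith

end Bounds

/-! ### Genus and the minimax values -/

theorem abs_add_rpow_of_mul_eq_zero {p x y : ℝ} (hp0 : 0 < p) (a b : ℝ) (h : x * y = 0) :
    |a * x + b * y| ^ p = |a| ^ p * |x| ^ p + |b| ^ p * |y| ^ p := by
  rcases mul_eq_zero.1 h with rfl | rfl <;>
  simp [abs_mul, Real.mul_rpow (abs_nonneg _) (abs_nonneg _), Real.zero_rpow hp0.ne']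

section Minimax

variable {p : ℝ} [hp : Fact (1 < p)]

theorem genus_le_of_hasOddMap {E : Type*} [TopologicalSpace E] [Neg E] {A : Set E} {n : ℕ}
    (h : HasOddMap A n) : genus A ≤ n :=
  iInf₂_le n h

theorem LSClass_nonempty_of_mem {i : ℕ} {A : Set (W1p p)} (hA : A ∈ LSClass p i) :
    A.Nonempty := by
  rw [nonempty_iff_ne_empty]
  rintro rfl
  have h : genus (∅ : Set (W1p p)) ≤ (0 : ℕ) :=
    genus_le_of_hasOddMap ⟨fun _ => 0, by simp, by simp, by simp⟩
  have := hA.2.2.2.trans h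
  norm_cast at this

theorem ne_zero_of_mem_LSClass {i : ℕ} {A : Set (W1p p)} (hA : A ∈ LSClass p i) {u : W1p p}
    (hu : u ∈ A) : u ≠ 0 :=
  fun h => hA.2.2.1 (h ▸ hu)

theorem exists_isGreatest_rayleigh {V : ℝ → ℝ} (hV : Continuous V) (α : ℝ) {i : ℕ}
    {A : Set (W1p p)} (hA : A ∈ LSClass p i) : ∃ m, IsGreatest (rayleigh p α V '' A) m := 
  (hA.1.image_of_continuousOn ((continuousOn_rayleigh hV α).mono fun _ =>
    ne_zero_of_mem_LSClass hA)).exists_isGreatest ((LSClass_nonempty_of_mem hA).image _)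

theorem le_rayleigh_iff {V : ℝ → ℝ} {α l : ℝ} {u : W1p p} (hu : u ≠ 0) :
    l ≤ rayleigh p α V u ↔ l * mass p u ≤ energy p α V u := by
  rw [rayleigh_eq, le_div_iff₀ (mass_pos hu)]

theorem rayleigh_le_iff {V : ℝ → ℝ} {α l : ℝ} {u : W1p p} (hu : u ≠ 0) :
    rayleigh p α V u ≤ l ↔ energy p α V u ≤ l * mass p u := by
  rw [rayleigh_eq, div_le_iff₀ (mass_pos hu)]

theorem eigenvalue_le {V : ℝ → ℝ} (hV : Continuous V) {α m : ℝ} {i : ℕ} {A : Set (W1p p)}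
    (hA : A ∈ LSClass p i) (hm : ∀ u ∈ A, rayleigh p α V u ≤ m) : eigenvalue p α V i ≤ m := by
  obtain ⟨l, hl⟩ := exists_mul_mass_le_energy (p := p) hV α
  obtain ⟨M, hM⟩ := exists_isGreatest_rayleigh hV α hA
  have hMm : M ≤ m := by
    obtain ⟨u, hu, rfl⟩ := hM.1
    exact hm u hu
  have hbdd : BddBelow {m : ℝ | ∃ A ∈ LSClass p i, IsGreatest (rayleigh p α V '' A) m} := by
    refine ⟨l, ?_⟩
    rintro k ⟨B, hB, hk⟩
    obtain ⟨u, hu, rfl⟩ := hk.1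
    exact (le_rayleigh_iff (ne_zero_of_mem_LSClass hB hu)).2 (hl u)
  exact (csInf_le hbdd ⟨A, hA, hM⟩).trans hMm

theorem le_eigenvalue {V : ℝ → ℝ} (hV : Continuous V) {α m : ℝ} {i : ℕ}
    (hne : (LSClass p i).Nonempty) (hm : ∀ A ∈ LSClass p i, ∃ u ∈ A, m ≤ rayleigh p α V u) :
    m ≤ eigenvalue p α V i := by
  obtain ⟨A, hA⟩ := hne
  obtain ⟨M, hM⟩ := exists_isGreatest_rayleigh hV α hA
  refine le_csInf ⟨M, A, hA, hM⟩ ?_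
  rintro k ⟨B, hB, hk⟩
  obtain ⟨u, hu, hmu⟩ := hm B hB
  exact hmu.trans (hk.2 ⟨u, hu, rfl⟩)

theorem not_hasOddMap_zero {E : Type*} [TopologicalSpace E] [Neg E] {A : Set E}
    (hA : A.Nonempty) : ¬ HasOddMap A 0 := by
  rintro ⟨f, -, -, hf⟩
  obtain ⟨u, hu⟩ := hA
  exact hf u hu (Subsingleton.elim _ _)

theorem pair_mem_LSClass {u : W1p p} (hu : u ≠ 0) : ({u, -u} : Set (W1p p)) ∈ LSClass p 0 := by
  refine ⟨(Set.toFinite _).isCompact, ?_, ?_, ?_⟩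
  · rintro v (rfl | rfl) <;> simp
  · rintro (h | h)
    · exact hu h.symm
    · exact hu (by simpa using h.symm)
  · refine le_iInf₂ fun n hn => ?_
    rcases n with _ | n
    · exact absurd hn (not_hasOddMap_zero ⟨u, by simp⟩)
    · exact_mod_cast Nat.succ_le_succ (Nat.zero_le n)

theorem not_hasOddMap_one_range {E : Type*} [TopologicalSpace E] [Neg E] {γ : ℝ → E}
    (hγ : Continuous γ) {T : ℝ} (hT : ∀ t, γ (t + T) = -γ t) : ¬ HasOddMap (range γ) 1 := by
  rintro ⟨f, hfc, hfo, hf0⟩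
  have hfγ : Continuous fun t : ℝ => f (γ t) := hfc.comp_continuous hγ fun t => mem_range_self t
  have hgc : Continuous fun t : ℝ => f (γ t) 0 :=
    (EuclideanSpace.proj (𝕜 := ℝ) (0 : Fin 1)).continuous.comp hfγ
  have hodd : f (γ (0 + T)) 0 = -f (γ 0) 0 := by
    rw [hT, hfo _ (mem_range_self _)]
    rfl
  have hzero : ∃ t, f (γ t) 0 = 0 := by
    rcases le_total (f (γ 0) 0) 0 with h | h
    · exact mem_range_of_exists_le_of_exists_ge hgc ⟨0, h⟩ ⟨0 + T, by rw [hodd]; linarith⟩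
    · exact mem_range_of_exists_le_of_exists_ge hgc ⟨0 + T, by rw [hodd]; linarith⟩ ⟨0, h⟩
  obtain ⟨t, ht⟩ := hzero
  refine hf0 _ (mem_range_self t) ?_
  ext j
  rw [Subsingleton.elim j 0]
  exact ht

/-- The closed curve `cos t • u + sin t • v` in the plane spanned by `u` and `v`, the symmetric
test set of genus `2` from which upper bounds for `λ_1` are obtained. -/
def circleSet (u v : W1p p) : Set (W1p p) :=
  range fun t : ℝ => Real.cos t • u + Real.sin t • v

theorem circleSet_mem_LSClass {u v : W1p p} (huv : ∀ a b : ℝ, a • u + b • v = 0 → a = 0 ∧ b = 0) :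
    circleSet u v ∈ LSClass p 1 := by
  have hcont : Continuous fun t : ℝ => Real.cos t • u + Real.sin t • v := by fun_prop
  have hpi : ∀ t : ℝ, Real.cos (t + Real.pi) • u + Real.sin (t + Real.pi) • v
      = -(Real.cos t • u + Real.sin t • v) := fun t => by
    rw [Real.cos_add_pi, Real.sin_add_pi]
    module
  refine ⟨?_, ?_, ?_, ?_⟩
  · have hper : Function.Periodic (fun t : ℝ => Real.cos t • u + Real.sin t • v)
        (2 * Real.pi) := fun t => by simp
    rw [circleSet, ← hper.image_Icc (by positivity) 0]
    exact isCompact_Icc.image hcont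
  · rintro _ ⟨t, rfl⟩
    exact ⟨t + Real.pi, hpi t⟩
  · rintro ⟨t, ht⟩
    obtain ⟨h1, h2⟩ := huv _ _ ht
    have := Real.cos_sq_add_sin_sq t
    simp [h1, h2] at this
  · refine le_iInf₂ fun n hn => ?_
    rcases n with _ | _ | n
    · exact absurd hn (not_hasOddMap_zero ⟨_, mem_range_self 0⟩)
    · exact absurd hn (not_hasOddMap_one_range hcont hpi)
    · exact_mod_cast Nat.succ_le_succ (Nat.succ_le_succ (Nat.zero_le n))

theorem evalAt_smul_add_smul (a b : ℝ) (u v : W1p p) (x : ℝ) :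
    evalAt (a • u + b • v) x = a * evalAt u x + b * evalAt v x := rfl

theorem weakDeriv_smul_add_smul (a b : ℝ) (u v : W1p p) :
    weakDeriv (a • u + b • v) =ᵐ[μI] fun x => a * weakDeriv u x + b * weakDeriv v x := by
  have hadd := Lp.coeFn_add (a • u.1.2) (b • v.1.2)
  have hsmul_u := Lp.coeFn_smul a u.1.2
  have hsmul_v := Lp.coeFn_smul b v.1.2
  filter_upwards [hadd, hsmul_u, hsmul_v] with x hadd hsmul_u hsmul_v
  change (a • u.1.2 + b • v.1.2 : Lp ℝ (ENNReal.ofReal p) μI) x = _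
  rw [hadd, Pi.add_apply, hsmul_u, hsmul_v]
  rfl

theorem LSClass_one_nonempty : (LSClass p 1).Nonempty := by
  obtain ⟨u, hu, -⟩ := exists_evalAt_eq_weakDeriv_ae_eq (p := p) (f := fun _ => 1)
    (f' := fun _ => 0) (C := 0) countable_empty continuousOn_const (fun x _ => hasDerivAt_const x 1)
    aestronglyMeasurable_const (by simp)
  obtain ⟨v, hv, -⟩ := exists_evalAt_eq_weakDeriv_ae_eq (p := p) (f := fun x => x)
    (f' := fun _ => 1) (C := 1) countable_empty continuousOn_id (fun x _ => hasDerivAt_id x)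
    aestronglyMeasurable_const (by simp)
  refine ⟨circleSet u v, circleSet_mem_LSClass fun a b hab => ?_⟩
  have hvanish : ∀ x ∈ Icc (-1 : ℝ) 1, a + b * x = 0 := fun x hx => by
    have := evalAt_smul_add_smul a b u v x
    rw [hab, hu x hx, hv x hx, mul_one] at this
    exact this.symm
  have hvanish₀ := hvanish 0 (by norm_num)
  have hvanish₁ := hvanish 1 (by norm_num)
  constructor <;> linarith

theorem LSClass_zero_nonempty : (LSClass p 0).Nonempty := by
  obtain ⟨A, hA⟩ := LSClass_one_nonempty (p := p)
  obtain ⟨u, hu⟩ := LSClass_nonempty_of_mem hA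
  exact ⟨_, pair_mem_LSClass (ne_zero_of_mem_LSClass hA hu)⟩

theorem le_eigenvalue_zero {V : ℝ → ℝ} (hV : Continuous V) {α l : ℝ}
    (h : ∀ u : W1p p, l * mass p u ≤ energy p α V u) : l ≤ eigenvalue p α V 0 :=
  le_eigenvalue hV LSClass_zero_nonempty fun A hA => by
    obtain ⟨u, hu⟩ := LSClass_nonempty_of_mem hA
    exact ⟨u, hu, (le_rayleigh_iff (ne_zero_of_mem_LSClass hA hu)).2 (h u)⟩

theorem exists_mem_evalAt_eq_zero {A : Set (W1p p)} (hA : A ∈ LSClass p 1) (c : ℝ) :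
    ∃ u ∈ A, evalAt u c = 0 := by
  by_contra! h
  have hodd : HasOddMap A 1 := by
    refine ⟨fun u => WithLp.toLp 2 fun _ => evalAt u c, Continuous.continuousOn ?_, ?_, ?_⟩
    · exact (PiLp.continuous_toLp 2 _).comp (continuous_pi fun _ => continuous_evalAt_const c)
    · intro u _
      ext j
      rfl
    · intro u hu h0
      exact h u hu (congrArg (fun w : EuclideanSpace ℝ (Fin 1) => w 0) h0)
  have := hA.2.2.2.trans (genus_le_of_hasOddMap hodd)
  norm_cast at this

theorem le_eigenvalue_one {V : ℝ → ℝ} (hV : Continuous V) {α l c : ℝ}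
    (h : ∀ u : W1p p, evalAt u c = 0 → l * mass p u ≤ energy p α V u) :
    l ≤ eigenvalue p α V 1 :=
  le_eigenvalue hV LSClass_one_nonempty fun A hA => by
    obtain ⟨u, hu, huc⟩ := exists_mem_evalAt_eq_zero hA c
    exact ⟨u, hu, (le_rayleigh_iff (ne_zero_of_mem_LSClass hA hu)).2 (h u huc)⟩

theorem mass_neg (u : W1p p) : mass p (-u) = mass p u := by
  have h : ∀ x, evalAt (-u) x = -evalAt u x := fun _ => rfl
  simp only [mass, h, abs_neg]

theorem energy_neg {V : ℝ → ℝ} (hV : Continuous V) (α : ℝ) (u : W1p p) :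
    energy p α V (-u) = energy p α V u := by
  have h : ∀ x, evalAt (-u) x = -evalAt u x := fun _ => rfl
  have hweak : (-u).1.2 = -u.1.2 := rfl
  rw [energy_eq hV, energy_eq hV, integral_abs_weakDeriv_rpow, integral_abs_weakDeriv_rpow, hweak,
    norm_neg]
  simp only [h, abs_neg]

theorem eigenvalue_zero_le {V : ℝ → ℝ} (hV : Continuous V) {α l : ℝ} {u : W1p p} (hu : u ≠ 0)
    (h : energy p α V u ≤ l * mass p u) : eigenvalue p α V 0 ≤ l := by
  refine eigenvalue_le hV (pair_mem_LSClass hu) ?_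
  rintro v (rfl | rfl)
  · exact (rayleigh_le_iff hu).2 h
  · refine (rayleigh_le_iff (neg_ne_zero.2 hu)).2 ?_
    rwa [energy_neg hV, mass_neg]

theorem mass_smul_add_smul {u v : W1p p}
    (huv : ∀ x ∈ Icc (-1 : ℝ) 1, evalAt u x * evalAt v x = 0) (a b : ℝ) :
    mass p (a • u + b • v) = |a| ^ p * mass p u + |b| ^ p * mass p v := by
  rw [mass, mass, mass, ← integral_const_mul, ← integral_const_mul,
    ← integral_add ((integrableOn_abs_evalAt_rpow u).const_mul _)
      ((integrableOn_abs_evalAt_rpow v).const_mul _)]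
  refine setIntegral_congr_fun measurableSet_Ioo fun x hx => ?_
  simp only [evalAt_smul_add_smul]
  exact abs_add_rpow_of_mul_eq_zero (zero_lt_one.trans hp.out) a b
    (huv x (Ioo_subset_Icc_self hx))

theorem integral_abs_weakDeriv_smul_add_smul {u v : W1p p}
    (huv : ∀ᵐ x ∂μI, weakDeriv u x * weakDeriv v x = 0) (a b : ℝ) :
    ∫ x in Ioo (-1 : ℝ) 1, |weakDeriv (a • u + b • v) x| ^ p
      = |a| ^ p * (∫ x in Ioo (-1 : ℝ) 1, |weakDeriv u x| ^ p)
        + |b| ^ p * ∫ x in Ioo (-1 : ℝ) 1, |weakDeriv v x| ^ p := by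
  rw [← integral_const_mul, ← integral_const_mul,
    ← integral_add ((integrableOn_abs_weakDeriv_rpow u).const_mul _)
      ((integrableOn_abs_weakDeriv_rpow v).const_mul _)]
  refine integral_congr_ae ?_
  filter_upwards [weakDeriv_smul_add_smul a b u v, huv] with x hx hx0
  rw [hx]
  exact abs_add_rpow_of_mul_eq_zero (zero_lt_one.trans hp.out) a b hx0

theorem integral_mul_abs_evalAt_smul_add_smul {V : ℝ → ℝ} (hV : Continuous V) {u v : W1p p}
    (huv : ∀ x ∈ Icc (-1 : ℝ) 1, evalAt u x * evalAt v x = 0) (a b : ℝ) :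
    ∫ x in Ioo (-1 : ℝ) 1, V x * |evalAt (a • u + b • v) x| ^ p
      = |a| ^ p * (∫ x in Ioo (-1 : ℝ) 1, V x * |evalAt u x| ^ p)
        + |b| ^ p * ∫ x in Ioo (-1 : ℝ) 1, V x * |evalAt v x| ^ p := by
  rw [← integral_const_mul, ← integral_const_mul,
    ← integral_add ((integrableOn_mul_abs_evalAt_rpow hV u).const_mul _)
      ((integrableOn_mul_abs_evalAt_rpow hV v).const_mul _)]
  refine setIntegral_congr_fun measurableSet_Ioo fun x hx => ?_
  simp only [evalAt_smul_add_smul]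
  rw [abs_add_rpow_of_mul_eq_zero (zero_lt_one.trans hp.out) a b
    (huv x (Ioo_subset_Icc_self hx))]
  ring

theorem energy_smul_add_smul {V : ℝ → ℝ} (hV : Continuous V) (α : ℝ) {u v : W1p p}
    (huv : ∀ x ∈ Icc (-1 : ℝ) 1, evalAt u x * evalAt v x = 0)
    (huv' : ∀ᵐ x ∂μI, weakDeriv u x * weakDeriv v x = 0) (a b : ℝ) :
    energy p α V (a • u + b • v) = |a| ^ p * energy p α V u + |b| ^ p * energy p α V v := by
  have hp0 : 0 < p := zero_lt_one.trans hp.out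
  rw [energy_eq hV, energy_eq hV, energy_eq hV, integral_abs_weakDeriv_smul_add_smul huv',
    integral_mul_abs_evalAt_smul_add_smul hV huv, evalAt_smul_add_smul, evalAt_smul_add_smul,
    abs_add_rpow_of_mul_eq_zero hp0 a b (huv 1 (by norm_num)),
    abs_add_rpow_of_mul_eq_zero hp0 a b (huv (-1) (by norm_num))]
  ring

theorem eq_zero_of_smul_add_smul_eq_zero {u v : W1p p} (hu : u ≠ 0) (hv : v ≠ 0)
    (huv : ∀ x ∈ Icc (-1 : ℝ) 1, evalAt u x * evalAt v x = 0) {a b : ℝ}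
    (hab : a • u + b • v = 0) : a = 0 ∧ b = 0 := by
  have hp0 : 0 < p := zero_lt_one.trans hp.out
  have hzero : mass p (0 : W1p p) = 0 := by
    have h : ∀ x, evalAt (0 : W1p p) x = 0 := fun _ => rfl
    simp [mass, h, Real.zero_rpow hp0.ne']
  have hsum := mass_smul_add_smul huv a b
  rw [hab, hzero, eq_comm,
    add_eq_zero_iff_of_nonneg (mul_nonneg (by positivity) (mass_pos hu).le)
      (mul_nonneg (by positivity) (mass_pos hv).le),
    mul_eq_zero_iff_right (mass_pos hu).ne', mul_eq_zero_iff_right (mass_pos hv).ne',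
    Real.rpow_eq_zero (abs_nonneg _) hp0.ne', Real.rpow_eq_zero (abs_nonneg _) hp0.ne',
    abs_eq_zero, abs_eq_zero] at hsum
  exact hsum

theorem eigenvalue_one_le {V : ℝ → ℝ} (hV : Continuous V) {α l : ℝ} {u v : W1p p} (hu : u ≠ 0)
    (hv : v ≠ 0) (huv : ∀ x ∈ Icc (-1 : ℝ) 1, evalAt u x * evalAt v x = 0)
    (huv' : ∀ᵐ x ∂μI, weakDeriv u x * weakDeriv v x = 0)
    (hul : energy p α V u ≤ l * mass p u) (hvl : energy p α V v ≤ l * mass p v) :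
    eigenvalue p α V 1 ≤ l := by
  have hmem := circleSet_mem_LSClass fun a b => eq_zero_of_smul_add_smul_eq_zero hu hv huv
  refine eigenvalue_le hV hmem fun w hw => (rayleigh_le_iff (ne_zero_of_mem_LSClass hmem hw)).2 ?_
  obtain ⟨t, rfl⟩ := hw
  calc energy p α V (Real.cos t • u + Real.sin t • v)
      = |Real.cos t| ^ p * energy p α V u + |Real.sin t| ^ p * energy p α V v :=
        energy_smul_add_smul hV α huv huv' _ _
    _ ≤ |Real.cos t| ^ p * (l * mass p u) + |Real.sin t| ^ p * (l * mass p v) := by gcongr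
    _ = l * mass p (Real.cos t • u + Real.sin t • v) := by
        rw [mass_smul_add_smul huv]
        ring

theorem energy_le_add_mul_mass {V W : ℝ → ℝ} (hV : Continuous V) (hW : Continuous W) {α b : ℝ}
    (h : ∀ x ∈ Icc (-1 : ℝ) 1, V x ≤ W x + b) (u : W1p p) :
    energy p α V u ≤ energy p α W u + b * mass p u := by
  have hpot : ∫ x in Ioo (-1 : ℝ) 1, V x * |evalAt u x| ^ p
      ≤ (∫ x in Ioo (-1 : ℝ) 1, W x * |evalAt u x| ^ p)
        + b * ∫ x in Ioo (-1 : ℝ) 1, |evalAt u x| ^ p := by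
    rw [← integral_const_mul, ← integral_add (integrableOn_mul_abs_evalAt_rpow hW u)
      ((integrableOn_abs_evalAt_rpow u).const_mul _)]
    refine setIntegral_mono_on (integrableOn_mul_abs_evalAt_rpow hV u)
      ((integrableOn_mul_abs_evalAt_rpow hW u).add
        ((integrableOn_abs_evalAt_rpow u).const_mul _)) measurableSet_Ioo fun x hx => ?_
    rw [← add_mul]
    exact mul_le_mul_of_nonneg_right (h x (Ioo_subset_Icc_self hx)) (by positivity)
  rw [energy_eq hV, energy_eq hW, mass]
  linarith

theorem eigenvalue_le_add {V W : ℝ → ℝ} (hV : Continuous V) (hW : Continuous W) {α b : ℝ} {i : ℕ}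
    (hne : (LSClass p i).Nonempty) (h : ∀ x ∈ Icc (-1 : ℝ) 1, V x ≤ W x + b) :
    eigenvalue p α V i ≤ eigenvalue p α W i + b := by
  rw [← sub_le_iff_le_add]
  obtain ⟨A, hA⟩ := hne
  obtain ⟨M, hM⟩ := exists_isGreatest_rayleigh hW α hA
  refine le_csInf ⟨M, A, hA, hM⟩ ?_
  rintro m ⟨B, hB, hm⟩
  rw [sub_le_iff_le_add]
  refine eigenvalue_le hV hB fun u hu => ?_
  have hu0 := ne_zero_of_mem_LSClass hB hu
  calc rayleigh p α V u ≤ rayleigh p α W u + b := by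
        rw [rayleigh_le_iff hu0, add_mul, rayleigh_eq, div_mul_cancel₀ _ (mass_pos hu0).ne']
        exact energy_le_add_mul_mass hV hW h u
    _ ≤ m + b := add_le_add_left (hm.2 ⟨u, hu, rfl⟩) b

theorem gap_le_add {V W : ℝ → ℝ} (hV : Continuous V) (hW : Continuous W) {α b b' : ℝ}
    (h : ∀ x ∈ Icc (-1 : ℝ) 1, V x ≤ W x + b) (h' : ∀ x ∈ Icc (-1 : ℝ) 1, W x ≤ V x + b') :
    gap p α V ≤ gap p α W + (b + b') := by
  have hone := eigenvalue_le_add (p := p) (α := α) hV hW LSClass_one_nonempty h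
  have hzero := eigenvalue_le_add (p := p) (α := α) hW hV LSClass_zero_nonempty h'
  rw [gap, gap]
  linarith

theorem gap_congr {V W : ℝ → ℝ} {α : ℝ} (h : ∀ x ∈ Icc (-1 : ℝ) 1, V x = W x) :
    gap p α V = gap p α W := by
  have : rayleigh p α V = rayleigh p α W := by
    funext u
    rw [rayleigh, rayleigh]
    congr 2
    refine setIntegral_congr_fun measurableSet_Ioo fun x hx => ?_
    simp only [h x (Ioo_subset_Icc_self hx)]
  simp only [gap, eigenvalue, this]

end Minimax

/-! ### An angular coordinate for the Riccati equation

The Riccati equation `r' = V - l - (p - 1) |r| ^ q` blows up in finite time. In the coordinate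
`θ ∈ (-p, p)` with `r = riccatiChart p θ` it becomes an equation with a bounded and Lipschitz right
hand side, in which a solution passes smoothly through `r = ∓∞`. -/

/-- The weight of `V - l` in the angular equation: `dθ/dr` for the coordinate change
`r = riccatiChart p θ`, extended by `0` to `p ≤ |θ|`. -/
noncomputable def linearWeight (p θ : ℝ) : ℝ := max 0 (min 1 ((p - |θ|) / (p - 1))) ^ p

/-- The weight of `-(p - 1)` in the angular equation: `|r| ^ q * dθ/dr` for the coordinate change
`r = riccatiChart p θ`, extended by `1` to `p ≤ |θ|`. -/
noncomputable def powerWeight (q θ : ℝ) : ℝ := min 1 |θ| ^ q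

theorem abs_rpow_sub_rpow_le {s x y : ℝ} (hs : 1 ≤ s) (hx : x ∈ Icc (0 : ℝ) 1)
    (hy : y ∈ Icc (0 : ℝ) 1) : |x ^ s - y ^ s| ≤ s * |x - y| := by
  refine (convex_Icc (0 : ℝ) 1).norm_image_sub_le_of_norm_hasDerivWithin_le
    (f := fun x : ℝ => x ^ s) (f' := fun x => s * x ^ (s - 1))
    (fun z _ => (Real.hasDerivAt_rpow_const (Or.inr hs)).hasDerivWithinAt) (fun z hz => ?_) hy hx
  have hpow0 : 0 ≤ z ^ (s - 1) := Real.rpow_nonneg hz.1 _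
  have hpow1 : z ^ (s - 1) ≤ 1 := Real.rpow_le_one hz.1 hz.2 (by linarith)
  rw [Real.norm_of_nonneg (by positivity)]
  nlinarith

theorem linearWeight_base_mem (p θ : ℝ) : max 0 (min 1 ((p - |θ|) / (p - 1))) ∈ Icc (0 : ℝ) 1 :=
  ⟨le_max_left _ _, max_le zero_le_one (min_le_left _ _)⟩

theorem powerWeight_base_mem (θ : ℝ) : min 1 |θ| ∈ Icc (0 : ℝ) 1 :=
  ⟨le_min zero_le_one (abs_nonneg _), min_le_left _ _⟩

section Angle

variable {p q : ℝ}

theorem linearWeight_nonneg (θ : ℝ) : 0 ≤ linearWeight p θ :=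
  Real.rpow_nonneg (linearWeight_base_mem p θ).1 _

theorem linearWeight_le_one (hp : 1 < p) (θ : ℝ) : linearWeight p θ ≤ 1 :=
  Real.rpow_le_one (linearWeight_base_mem p θ).1 (linearWeight_base_mem p θ).2 (by linarith)

theorem powerWeight_nonneg (θ : ℝ) : 0 ≤ powerWeight q θ :=
  Real.rpow_nonneg (powerWeight_base_mem θ).1 _

theorem powerWeight_le_one (hq : 1 < q) (θ : ℝ) : powerWeight q θ ≤ 1 :=
  Real.rpow_le_one (powerWeight_base_mem θ).1 (powerWeight_base_mem θ).2 (by linarith)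

theorem abs_linearWeight_sub_le (hp : 1 < p) (x y : ℝ) :
    |linearWeight p x - linearWeight p y| ≤ p / (p - 1) * |x - y| := by
  refine (abs_rpow_sub_rpow_le hp.le (linearWeight_base_mem p x)
    (linearWeight_base_mem p y)).trans ?_
  have hclamp : |max 0 (min 1 ((p - |x|) / (p - 1))) - max 0 (min 1 ((p - |y|) / (p - 1)))|
      ≤ |(p - |x|) / (p - 1) - (p - |y|) / (p - 1)| := by
    refine (abs_max_sub_max_le_max 0 _ 0 _).trans ?_
    rw [sub_self, abs_zero, max_eq_right (abs_nonneg _)]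
    refine (abs_min_sub_min_le_max 1 _ 1 _).trans ?_
    rw [sub_self, abs_zero, max_eq_right (abs_nonneg _)]
  have haffine : |(p - |x|) / (p - 1) - (p - |y|) / (p - 1)| ≤ |x - y| / (p - 1) := by
    rw [← sub_div, abs_div, abs_of_pos (by linarith : 0 < p - 1)]
    refine div_le_div_of_nonneg_right ?_ (by linarith)
    rw [show p - |x| - (p - |y|) = |y| - |x| by ring, abs_sub_comm x y]
    exact abs_abs_sub_abs_le_abs_sub y x
  calc p * |_| ≤ p * (|x - y| / (p - 1)) := by gcongr; exact hclamp.trans haffine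
    _ = _ := by ring

theorem abs_powerWeight_sub_le (hq : 1 < q) (x y : ℝ) :
    |powerWeight q x - powerWeight q y| ≤ q * |x - y| := by
  refine (abs_rpow_sub_rpow_le hq.le (powerWeight_base_mem x) (powerWeight_base_mem y)).trans ?_
  refine mul_le_mul_of_nonneg_left ?_ (by linarith)
  refine (abs_min_sub_min_le_max 1 _ 1 _).trans ?_
  rw [sub_self, abs_zero, max_eq_right (abs_nonneg _)]
  exact abs_abs_sub_abs_le_abs_sub x y

theorem linearWeight_eq_zero (hp : 1 < p) {θ : ℝ} (h : p ≤ |θ|) : linearWeight p θ = 0 := by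
  have : (p - |θ|) / (p - 1) ≤ 0 := div_nonpos_of_nonpos_of_nonneg (by linarith) (by linarith)
  rw [linearWeight, max_eq_left ((min_le_right _ _).trans this), Real.zero_rpow (by linarith)]

theorem powerWeight_eq_one {θ : ℝ} (h : 1 ≤ |θ|) : powerWeight q θ = 1 := by
  rw [powerWeight, min_eq_left h, Real.one_rpow]

theorem linearWeight_pos (hp : 1 < p) {θ : ℝ} (h : |θ| < p) : 0 < linearWeight p θ := by
  have : 0 < (p - |θ|) / (p - 1) := div_pos (by linarith) (by linarith)
  exact Real.rpow_pos_of_pos (lt_max_of_lt_right (lt_min one_pos this)) _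

theorem linearWeight_le_of_abs_le (hp : 1 < p) {θ η : ℝ} (h : |θ| ≤ |η|) :
    linearWeight p η ≤ linearWeight p θ := by
  have : 0 < p - 1 := by linarith
  refine Real.rpow_le_rpow (linearWeight_base_mem p η).1 ?_ (by linarith)
  gcongr

theorem linearWeight_eq_one (hp : 1 < p) {θ : ℝ} (h : |θ| ≤ 1) : linearWeight p θ = 1 := by
  have : 1 ≤ (p - |θ|) / (p - 1) := (one_le_div (by linarith)).2 (by linarith)
  rw [linearWeight, min_eq_left this, max_eq_right zero_le_one, Real.one_rpow]

theorem linearWeight_neg (θ : ℝ) : linearWeight p (-θ) = linearWeight p θ := by simp [linearWeight]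

theorem powerWeight_neg (θ : ℝ) : powerWeight q (-θ) = powerWeight q θ := by simp [powerWeight]

theorem linearWeight_of_one_le (hp : 1 < p) {θ : ℝ} (h1 : 1 ≤ θ) (h2 : θ < p) :
    linearWeight p θ = ((p - θ) / (p - 1)) ^ p := by
  have hle1 : (p - θ) / (p - 1) ≤ 1 := (div_le_one (by linarith)).2 (by linarith)
  have hle0 : 0 ≤ (p - θ) / (p - 1) := div_nonneg (by linarith) (by linarith)
  rw [linearWeight, abs_of_nonneg (by linarith), min_eq_right hle1, max_eq_right hle0]

/-- The coordinate change on the half line `(-∞, p)`, unbounded only at `p`; `riccatiChart` glues it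
to its reflection. -/
noncomputable def halfChart (p θ : ℝ) : ℝ := if θ ≤ 1 then θ else ((p - θ) / (p - 1)) ^ (1 - p)

/-- The coordinate change `r = riccatiChart p θ`, an increasing bijection of `(-p, p)` onto `ℝ`: the
identity on `[-1, 1]` and `± ((p - |θ|) / (p - 1)) ^ (1 - p)` outside. Only its values on `(-p, p)`
are meaningful. -/
noncomputable def riccatiChart (p θ : ℝ) : ℝ := halfChart p θ - halfChart p (-θ) - θ

theorem riccatiChart_neg (θ : ℝ) : riccatiChart p (-θ) = -riccatiChart p θ := by
  simp only [riccatiChart, neg_neg]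
  ring

theorem riccatiChart_of_abs_le {θ : ℝ} (h : |θ| ≤ 1) : riccatiChart p θ = θ := by
  rw [abs_le] at h
  rw [riccatiChart, halfChart, halfChart, if_pos h.2, if_pos (by linarith)]
  ring

theorem riccatiChart_of_one_lt {θ : ℝ} (h : 1 < θ) :
    riccatiChart p θ = ((p - θ) / (p - 1)) ^ (1 - p) := by
  rw [riccatiChart, halfChart, halfChart, if_neg (by linarith), if_pos (by linarith)]
  ring

theorem hasDerivAt_halfChart (hp : 1 < p) {θ : ℝ} (hθ : θ < p) :
    HasDerivAt (halfChart p) (if θ ≤ 1 then 1 else ((p - θ) / (p - 1)) ^ (-p)) θ := by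
  have hp1 : 0 < p - 1 := by linarith
  have hpow : ∀ η < p, HasDerivAt (fun θ : ℝ => ((p - θ) / (p - 1)) ^ (1 - p))
      (((p - η) / (p - 1)) ^ (-p)) η := fun η hη => by
    have haffine : HasDerivAt (fun θ : ℝ => (p - θ) / (p - 1)) (-1 / (p - 1)) η := by
      simpa using ((hasDerivAt_id η).const_sub p).div_const (p - 1)
    have hcomp := haffine.rpow_const (p := 1 - p) (Or.inl (div_pos (by linarith) hp1).ne')
    refine hcomp.congr_deriv ?_
    rw [show 1 - p - 1 = -p by ring]
    field_simp
    ring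
  rcases lt_trichotomy θ 1 with h | rfl | h
  · rw [if_pos h.le]
    refine (hasDerivAt_id θ).congr_of_eventuallyEq ?_
    filter_upwards [Iio_mem_nhds h] with y hy
    rw [halfChart, if_pos (le_of_lt hy), id]
  · rw [if_pos le_rfl]
    have hpow1 := hpow 1 hθ
    rw [div_self hp1.ne', Real.one_rpow] at hpow1
    refine hasDerivAt_of_eqOn_Iic_Ici (hasDerivAt_id 1) hpow1
      (fun y hy => by rw [halfChart, if_pos (mem_Iic.1 hy), id]) (fun y hy => ?_)
    rcases eq_or_lt_of_le (show (1 : ℝ) ≤ y from hy) with rfl | hy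
    · simp [halfChart, div_self hp1.ne']
    · rw [halfChart, if_neg (by linarith)]
  · rw [if_neg (by linarith)]
    refine (hpow θ hθ).congr_of_eventuallyEq ?_
    filter_upwards [Ioi_mem_nhds h] with y hy
    rw [halfChart, if_neg (not_le.2 hy)]

theorem hasDerivAt_riccatiChart (hp : 1 < p) {θ : ℝ} (hθ : |θ| < p) :
    HasDerivAt (riccatiChart p) (linearWeight p θ)⁻¹ θ := by
  obtain ⟨h1, h2⟩ := abs_lt.1 hθ
  have hd := ((hasDerivAt_halfChart hp h2).sub
    ((hasDerivAt_halfChart hp (by linarith : -θ < p)).comp θ (hasDerivAt_neg θ))).sub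
    (hasDerivAt_id θ)
  refine hd.congr_deriv ?_
  rcases lt_or_ge 1 θ with h | h
  · rw [if_neg (by linarith), if_pos (by linarith), linearWeight_of_one_le hp h.le h2,
      ← Real.rpow_neg (div_nonneg (by linarith) (by linarith))]
    ring
  · rcases lt_or_ge θ (-1) with h' | h'
    · rw [if_pos (by linarith), if_neg (by linarith), ← linearWeight_neg,
        linearWeight_of_one_le hp (by linarith) (by linarith),
        ← Real.rpow_neg (div_nonneg (by linarith) (by linarith))]
      ring
    · rw [if_pos (by linarith), if_pos (by linarith), linearWeight_eq_one hp (abs_le.2 ⟨h', h⟩)]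
      ring

theorem linearWeight_mul_abs_riccatiChart (hpq : p.HolderConjugate q) {θ : ℝ} (hθ : |θ| < p) :
    linearWeight p θ * |riccatiChart p θ| ^ q = powerWeight q θ := by
  have hp := hpq.lt
  have hpos : ∀ θ : ℝ, 1 < θ → θ < p →
      linearWeight p θ * |riccatiChart p θ| ^ q = powerWeight q θ := fun θ h1 h2 => by
    have hy : 0 < (p - θ) / (p - 1) := div_pos (by linarith) (by linarith)
    rw [powerWeight_eq_one (by rw [abs_of_pos (by linarith)]; exact h1.le),
      riccatiChart_of_one_lt h1, linearWeight_of_one_le hp h1.le h2,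
      abs_of_pos (Real.rpow_pos_of_pos hy _), ← Real.rpow_mul hy.le,
      ← Real.rpow_add hy, show p + (1 - p) * q = p - (p - 1) * q by ring, hpq.sub_one_mul_conj,
      sub_self, Real.rpow_zero]
  obtain ⟨h1, h2⟩ := abs_lt.1 hθ
  rcases le_or_gt |θ| 1 with h | h
  · rw [riccatiChart_of_abs_le h, linearWeight_eq_one hp h, powerWeight, min_eq_right h, one_mul]
  · rcases lt_abs.1 h with h | h
    · exact hpos θ h h2
    · have := hpos (-θ) h (by linarith)
      rwa [linearWeight_neg, powerWeight_neg, riccatiChart_neg, abs_neg] at this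

theorem exists_riccatiChart_eq (hp : 1 < p) (β : ℝ) : ∃ τ, |τ| < p ∧ riccatiChart p τ = β := by
  have hnonneg : ∀ β : ℝ, 0 ≤ β → ∃ τ, |τ| < p ∧ riccatiChart p τ = β := fun β hβ => by
    rcases le_or_gt β 1 with h | h
    · have hb : |β| ≤ 1 := by rwa [abs_of_nonneg hβ]
      exact ⟨β, by linarith, riccatiChart_of_abs_le hb⟩
    · have hp1 : 0 < p - 1 := by linarith
      set y := β ^ (-(p - 1)⁻¹) with hy
      have hy0 : 0 < y := Real.rpow_pos_of_pos (by linarith) _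
      have hy1 : y < 1 := Real.rpow_lt_one_of_one_lt_of_neg h (by simpa using hp)
      have hτ : 1 < p - (p - 1) * y := by nlinarith
      refine ⟨p - (p - 1) * y, ?_, ?_⟩
      · rw [abs_of_pos (by linarith)]
        nlinarith
      · rw [riccatiChart_of_one_lt hτ, sub_sub_cancel, mul_div_cancel_left₀ _ hp1.ne', hy,
          ← Real.rpow_mul (by linarith), show -(p - 1)⁻¹ * (1 - p) = 1 by field_simp; ring,
          Real.rpow_one]
  rcases le_total 0 β with h | h
  · exact hnonneg β h
  · obtain ⟨τ, h1, h2⟩ := hnonneg (-β) (by linarith)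
    exact ⟨-τ, by rwa [abs_neg], by rw [riccatiChart_neg, h2, neg_neg]⟩

theorem strictMonoOn_riccatiChart (hp : 1 < p) : StrictMonoOn (riccatiChart p) (Ioo (-p) p) := by
  have hd : ∀ θ ∈ Ioo (-p) p, HasDerivAt (riccatiChart p) (linearWeight p θ)⁻¹ θ := fun θ hθ =>
    hasDerivAt_riccatiChart hp (abs_lt.2 hθ)
  refine strictMonoOn_of_deriv_pos (convex_Ioo _ _)
    (fun θ hθ => (hd θ hθ).continuousAt.continuousWithinAt) fun θ hθ => ?_
  rw [interior_Ioo] at hθ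
  rw [(hd θ hθ).deriv]
  exact inv_pos.2 (linearWeight_pos hp (abs_lt.2 hθ))

theorem tendsto_riccatiChart (hp : 1 < p) : Tendsto (riccatiChart p) (𝓝[<] p) atTop := by
  rw [tendsto_atTop]
  intro M
  obtain ⟨τ, hτ, hM⟩ := exists_riccatiChart_eq hp M
  rw [abs_lt] at hτ
  filter_upwards [Ioo_mem_nhdsLT hτ.2] with θ hθ
  rw [← hM]
  exact (strictMonoOn_riccatiChart hp hτ ⟨hτ.1.trans hθ.1, hθ.2⟩ hθ.1).le

/-! ### The angular equation -/

/-- The right hand side of the angular equation. Two charts of length `2 p` are covered, one around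
`0` and one around `-2 p`, so that a solution can run through one singularity of the Riccati
equation. -/
noncomputable def angleField (p q : ℝ) (V : ℝ → ℝ) (l x θ : ℝ) : ℝ :=
  (V x - l) * (linearWeight p θ + linearWeight p (θ + 2 * p))
    - (p - 1) * (powerWeight q θ + powerWeight q (θ + 2 * p) - 1)

/-- `θ` solves the angular equation with potential `V` and spectral parameter `l` on `[-1, 1]`. -/
def IsAngleSolution (p q : ℝ) (V : ℝ → ℝ) (l : ℝ) (θ : ℝ → ℝ) : Prop :=
  ∀ x ∈ Icc (-1 : ℝ) 1, HasDerivAt θ (angleField p q V l x (θ x)) x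

theorem angleField_of_ge (hp : 1 < p) {V : ℝ → ℝ} {l x θ : ℝ} (h : -p ≤ θ) :
    angleField p q V l x θ = (V x - l) * linearWeight p θ - (p - 1) * powerWeight q θ := by
  have habs : p ≤ |θ + 2 * p| := (by linarith : p ≤ θ + 2 * p).trans (le_abs_self _)
  rw [angleField, linearWeight_eq_zero hp habs, powerWeight_eq_one (hp.le.trans habs)]
  ring

theorem angleField_of_le (hp : 1 < p) {V : ℝ → ℝ} {l x θ : ℝ} (h : θ ≤ -p) :
    angleField p q V l x θ
      = (V x - l) * linearWeight p (θ + 2 * p) - (p - 1) * powerWeight q (θ + 2 * p) := by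
  have habs : p ≤ |θ| := (by linarith : p ≤ -θ).trans (neg_le_abs _)
  rw [angleField, linearWeight_eq_zero hp habs, powerWeight_eq_one (hp.le.trans habs)]
  ring

theorem angleField_of_mem_nodes (hp : 1 < p) {V : ℝ → ℝ} {l x θ : ℝ}
    (hθ : θ ∈ ({p, -p, -3 * p} : Set ℝ)) : angleField p q V l x θ = -(p - 1) := by
  have hpow : ∀ η, p ≤ |η| → powerWeight q η = 1 := fun η hη => powerWeight_eq_one (hp.le.trans hη)
  have habs : p ≤ |θ| ∧ p ≤ |θ + 2 * p| := by
    rcases hθ with rfl | rfl | rfl <;> constructor <;> rw [le_abs'] <;>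
      first | (left; linarith) | (right; linarith)
  rw [angleField, linearWeight_eq_zero hp habs.1, linearWeight_eq_zero hp habs.2, hpow _ habs.1,
    hpow _ habs.2]
  ring

theorem lipschitzWith_angleField (hp : 1 < p) (hq : 1 < q) {V : ℝ → ℝ} {l x M : ℝ}
    (hM : |V x| ≤ M) :
    LipschitzWith ((M + |l|) * (2 * (p / (p - 1))) + (p - 1) * (2 * q)).toNNReal
      (angleField p q V l x) := by
  refine LipschitzWith.of_dist_le_mul fun θ η => ?_
  rw [Real.dist_eq, Real.dist_eq]
  refine le_trans ?_ (mul_le_mul_of_nonneg_right (Real.le_coe_toNNReal _) (abs_nonneg _))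
  have hA := abs_linearWeight_sub_le hp θ η
  have hA' := abs_linearWeight_sub_le hp (θ + 2 * p) (η + 2 * p)
  have hB := abs_powerWeight_sub_le hq θ η
  have hB' := abs_powerWeight_sub_le hq (θ + 2 * p) (η + 2 * p)
  rw [add_sub_add_right_eq_sub] at hA' hB'
  have hv : |V x - l| ≤ M + |l| := (abs_sub _ _).trans (by linarith)
  calc |angleField p q V l x θ - angleField p q V l x η|
      = |(V x - l) * ((linearWeight p θ - linearWeight p η)
            + (linearWeight p (θ + 2 * p) - linearWeight p (η + 2 * p)))
          - (p - 1) * ((powerWeight q θ - powerWeight q η)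
            + (powerWeight q (θ + 2 * p) - powerWeight q (η + 2 * p)))| := by
        rw [angleField, angleField]
        congr 1
        ring
    _ ≤ (M + |l|) * (p / (p - 1) * |θ - η| + p / (p - 1) * |θ - η|)
          + (p - 1) * (q * |θ - η| + q * |θ - η|) := by
        refine (abs_sub _ _).trans ?_
        rw [abs_mul, abs_mul, abs_of_pos (by linarith : 0 < p - 1)]
        gcongr
        · exact (abs_nonneg _).trans hv
        · exact (abs_add_le _ _).trans (add_le_add hA hA')
        · exact (abs_add_le _ _).trans (add_le_add hB hB')
    _ = _ := by ring

theorem abs_linearWeight_add_le (hp : 1 < p) (θ η : ℝ) :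
    |linearWeight p θ + linearWeight p η| ≤ 2 := by
  rw [abs_of_nonneg (add_nonneg (linearWeight_nonneg θ) (linearWeight_nonneg η))]
  linarith [linearWeight_le_one hp θ, linearWeight_le_one hp η]

theorem abs_angleField_le (hp : 1 < p) (hq : 1 < q) {V : ℝ → ℝ} {l x M : ℝ}
    (hM : |V x| ≤ M) (θ : ℝ) : |angleField p q V l x θ| ≤ (M + |l|) * 2 + (p - 1) := by
  have hv : |V x - l| ≤ M + |l| := (abs_sub _ _).trans (by linarith)
  have hB : |powerWeight q θ + powerWeight q (θ + 2 * p) - 1| ≤ 1 :=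
    abs_le.2 ⟨by linarith [powerWeight_nonneg (q := q) θ, powerWeight_nonneg (q := q) (θ + 2 * p)],
      by linarith [powerWeight_le_one hq θ, powerWeight_le_one hq (θ + 2 * p)]⟩
  have hM0 : 0 ≤ M + |l| := (abs_nonneg _).trans hv
  calc |angleField p q V l x θ| ≤ (M + |l|) * 2 + (p - 1) * 1 := by
        refine (abs_sub _ _).trans ?_
        rw [abs_mul, abs_mul, abs_of_pos (by linarith : 0 < p - 1)]
        gcongr
        exact abs_linearWeight_add_le hp _ _
    _ = _ := by ring

theorem abs_angleField_sub_angleField_le (hp : 1 < p) (V : ℝ → ℝ) (l l' x θ : ℝ) :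
    |angleField p q V l' x θ - angleField p q V l x θ| ≤ |l' - l| * 2 := by
  rw [show angleField p q V l' x θ - angleField p q V l x θ
      = -((l' - l) * (linearWeight p θ + linearWeight p (θ + 2 * p))) by
    rw [angleField, angleField]; ring, abs_neg, abs_mul]
  gcongr
  exact abs_linearWeight_add_le hp _ _

theorem exists_isAngleSolution (hp : 1 < p) (hq : 1 < q) {V : ℝ → ℝ} (hV : Continuous V)
    (l θ₀ : ℝ) : ∃ θ : ℝ → ℝ, θ (-1) = θ₀ ∧ IsAngleSolution p q V l θ := by
  obtain ⟨M, hM⟩ := (isCompact_Icc (a := (-2 : ℝ)) (b := 2)).exists_bound_of_continuousOn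
    hV.continuousOn
  have hPL : IsPicardLindelof (angleField p q V l) (tmin := -2) (tmax := 2)
      ⟨-1, by norm_num⟩ θ₀ (((M + |l|) * 2 + (p - 1)).toNNReal * 3) 0
      ((M + |l|) * 2 + (p - 1)).toNNReal
      ((M + |l|) * (2 * (p / (p - 1))) + (p - 1) * (2 * q)).toNNReal := by
    refine ⟨fun x hx => (lipschitzWith_angleField hp hq (hM x hx)).lipschitzOnWith,
      fun θ _ => ?_, fun x hx θ _ => ?_, ?_⟩
    · exact (((hV.sub continuous_const).mul continuous_const).sub
        continuous_const).continuousOn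
    · exact (abs_angleField_le hp hq (hM x hx) θ).trans (Real.le_coe_toNNReal _)
    · norm_num
  obtain ⟨θ, hθ₀, hθ⟩ := hPL.exists_eq_forall_mem_Icc_hasDerivWithinAt₀
  exact ⟨θ, hθ₀, fun x hx => (hθ x ⟨by linarith [hx.1], by linarith [hx.2]⟩).hasDerivAt
    (Icc_mem_nhds (by linarith [hx.1]) (by linarith [hx.2]))⟩

theorem IsAngleSolution.continuousOn {V : ℝ → ℝ} {l : ℝ} {θ : ℝ → ℝ}
    (hθ : IsAngleSolution p q V l θ) : ContinuousOn θ (Icc (-1) 1) :=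
  fun x hx => (hθ x hx).continuousAt.continuousWithinAt

theorem exists_forall_dist_le_gronwallBound (hp : 1 < p) (hq : 1 < q) {V : ℝ → ℝ}
    (hV : Continuous V) {l : ℝ} {θ : ℝ → ℝ} (hθ : IsAngleSolution p q V l θ) :
    ∃ K, ∀ l' θ', IsAngleSolution p q V l' θ' → θ' (-1) = θ (-1) →
      dist (θ' 1) (θ 1) ≤ gronwallBound 0 K (|l' - l| * 2) 2 := by
  obtain ⟨M, hM⟩ := (isCompact_Icc (a := (-1 : ℝ)) (b := 1)).exists_bound_of_continuousOn
    hV.continuousOn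
  refine ⟨((M + |l|) * (2 * (p / (p - 1))) + (p - 1) * (2 * q)).toNNReal, fun l' θ' hθ' h0 => ?_⟩
  have hgronwall := dist_le_of_approx_trajectories_ODE_of_mem (v := angleField p q V l)
    (s := fun _ => univ) (a := -1) (b := 1) (δ := 0) (εf := |l' - l| * 2) (εg := 0)
    (fun x hx => (lipschitzWith_angleField hp hq (hM x (Ico_subset_Icc_self hx))).lipschitzOnWith)
    hθ'.continuousOn (fun x hx => (hθ' x (Ico_subset_Icc_self hx)).hasDerivWithinAt)
    (fun x _ => (Real.dist_eq _ _).trans_le (abs_angleField_sub_angleField_le hp V l l' x _))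
    (fun _ _ => mem_univ _)
    hθ.continuousOn (fun x hx => (hθ x (Ico_subset_Icc_self hx)).hasDerivWithinAt)
    (fun x _ => (dist_self _).le) (fun _ _ => mem_univ _) (by rw [h0, dist_self])
    1 (by norm_num)
  rwa [add_zero, show (1 : ℝ) - -1 = 2 by norm_num] at hgronwall

theorem continuous_angle_solution (hp : 1 < p) (hq : 1 < q) {V : ℝ → ℝ} (hV : Continuous V)
    {θ₀ : ℝ} {θ : ℝ → ℝ → ℝ} (h0 : ∀ l, θ l (-1) = θ₀)
    (hθ : ∀ l, IsAngleSolution p q V l (θ l)) : Continuous fun l => θ l 1 := by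
  refine continuous_iff_continuousAt.2 fun l => ?_
  obtain ⟨K, hK⟩ := exists_forall_dist_le_gronwallBound hp hq hV (hθ l)
  have hcont : Continuous fun l' : ℝ => gronwallBound 0 K (|l' - l| * 2) 2 :=
    (gronwallBound_continuous_ε 0 K 2).comp (by fun_prop)
  have hlim : Tendsto (fun l' : ℝ => gronwallBound 0 K (|l' - l| * 2) 2) (𝓝 l) (𝓝 0) := by
    simpa [gronwallBound_ε0_δ0] using hcont.tendsto l
  exact tendsto_iff_dist_tendsto_zero.2 (squeeze_zero (fun _ => dist_nonneg)
    (fun l' => hK l' _ (hθ l') ((h0 l').trans (h0 l).symm)) hlim)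

end Angle

/-! ### Shooting -/

theorem exists_forall_sub_mul_neg {X : Type*} [TopologicalSpace X] {s : Set X} (hs : IsCompact s)
    {w f : X → ℝ} (hw : Continuous w) (hw0 : ∀ x, 0 ≤ w x) (hf : Continuous f)
    (h : ∀ x ∈ s, w x = 0 → f x < 0) : ∃ K, ∀ k ≥ K, ∀ x ∈ s, f x - k * w x < 0 := by
  refine hs.induction_on (p := fun t => ∃ K, ∀ k ≥ K, ∀ x ∈ t, f x - k * w x < 0) ⟨0, by simp⟩
    (fun t t' htt' ⟨K, hK⟩ => ⟨K, fun k hk x hx => hK k hk x (htt' hx)⟩)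
    (fun t t' ⟨K, hK⟩ ⟨K', hK'⟩ => ⟨max K K', fun k hk x hx => hx.elim
      (hK k ((le_max_left _ _).trans hk) x) (hK' k ((le_max_right _ _).trans hk) x)⟩)
    fun x hx => ?_
  obtain ⟨K, hK⟩ : ∃ K, f x - K * w x < 0 := by
    rcases (hw0 x).eq_or_lt' with hzero | hpos
    · exact ⟨0, by simpa using h x hx hzero⟩
    · exact ⟨(f x + 1) / w x, by rw [div_mul_cancel₀ _ hpos.ne']; linarith⟩
  have hopen : IsOpen {y | f y - K * w y < 0} :=
    isOpen_lt (hf.sub (hw.const_mul K)) continuous_const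
  refine ⟨_, mem_nhdsWithin_of_mem_nhds (hopen.mem_nhds hK), K, fun k hk y hy => ?_⟩
  have hyK : f y - K * w y < 0 := hy
  linarith [mul_le_mul_of_nonneg_right hk (hw0 y)]

section Shooting

variable {p q : ℝ}

theorem continuous_linearWeight (hp : 1 < p) : Continuous (linearWeight p) := by
  unfold linearWeight
  exact (continuous_const.max (continuous_const.min
    ((continuous_const.sub continuous_abs).div_const _))).rpow_const
      fun _ => Or.inr (by linarith)

theorem continuous_powerWeight (hq : 1 < q) : Continuous (powerWeight q) := by
  unfold powerWeight
  exact (continuous_const.min continuous_abs).rpow_const fun _ => Or.inr (by linarith)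

theorem IsAngleSolution.lt_of_deriv_lt {V : ℝ → ℝ} {l : ℝ} {θ σ σ' : ℝ → ℝ} {a x : ℝ}
    (hθ : IsAngleSolution p q V l θ) (ha : -1 ≤ a) (hσ : ∀ y, HasDerivAt σ (σ' y) y)
    (hcross : ∀ y ∈ Icc (-1 : ℝ) 1, angleField p q V l y (σ y) < σ' y) (hle : θ a ≤ σ a)
    (hx : x ∈ Ioc a 1) : θ x < σ x := by
  have hneg := neg_of_deriv_neg_at_zeros (z := fun y => θ y - σ y)
    (z' := fun y => angleField p q V l y (θ y) - σ' y)
    (fun y hy => (hθ y ⟨ha.trans hy.1, hy.2⟩).sub (hσ y))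
    (fun y hy hzero => by
      rw [sub_eq_zero.1 hzero]
      exact sub_neg.2 (hcross y ⟨ha.trans hy.1, hy.2⟩)) (by linarith) hx
  linarith

theorem IsAngleSolution.lt_node (hp : 1 < p) {V : ℝ → ℝ} {l : ℝ} {θ : ℝ → ℝ} {k a x : ℝ}
    (hθ : IsAngleSolution p q V l θ) (hk : k ∈ ({p, -p, -3 * p} : Set ℝ)) (ha : -1 ≤ a)
    (hle : θ a ≤ k) (hx : x ∈ Ioc a 1) : θ x < k :=
  hθ.lt_of_deriv_lt (σ := fun _ => k) (σ' := fun _ => 0) ha (fun y => hasDerivAt_const y k)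
    (fun y _ => by rw [angleField_of_mem_nodes hp hk]; linarith) hle hx

theorem exists_lt_angle_solution (hp : 1 < p) (hq : 1 < q) {V : ℝ → ℝ} (hV : Continuous V)
    {τ : ℝ} (hτ : |τ| < p) :
    ∃ l, ∀ θ, IsAngleSolution p q V l θ → θ (-1) = -τ → τ < θ 1 := by
  obtain ⟨M, hM⟩ := (isCompact_Icc (a := (-1 : ℝ)) (b := 1)).exists_bound_of_continuousOn
    hV.continuousOn
  have hweight := linearWeight_pos hp hτ
  refine ⟨-M - (|τ| + p) / linearWeight p τ, fun θ hθ h0 => ?_⟩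
  have hneg := neg_of_deriv_neg_at_zeros (z := fun x => τ * x - θ x)
    (z' := fun x => τ - angleField p q V (-M - (|τ| + p) / linearWeight p τ) x (θ x))
    (a := -1) (b := 1) (x := 1)
    (fun x hx => (((hasDerivAt_id x).const_mul τ).sub (hθ x hx)).congr_deriv (by simp))
    (fun x hx hzero => ?_) (by simp [h0]) (by norm_num)
  · linarith
  · have habs : |τ * x| ≤ |τ| := by
      rw [abs_mul]
      exact mul_le_of_le_one_right (abs_nonneg _) (abs_le.2 hx)
    have hlinear : |τ| + p ≤
        (V x - (-M - (|τ| + p) / linearWeight p τ)) * linearWeight p (τ * x) :=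
      calc |τ| + p = (|τ| + p) / linearWeight p τ * linearWeight p τ := by field_simp
        _ ≤ _ := by
          have := neg_le_of_abs_le (hM x hx)
          gcongr
          · linarith [div_nonneg (by positivity : 0 ≤ |τ| + p) hweight.le]
          · linarith
          · exact linearWeight_le_of_abs_le hp habs
    have hpower := mul_le_mul_of_nonneg_left (powerWeight_le_one hq (τ * x)) (sub_pos.2 hp).le
    rw [show θ x = τ * x by linarith, angleField_of_ge hp (abs_le.1 (habs.trans hτ.le)).1]
    linarith [le_abs_self τ]

/-- A curve decreasing through the singular values `p`, `-p`, `-3 p` of the angular equation at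
`-1`, `0`, `1`, and stationary at these points. For large `l` solutions cannot cross it upwards,
which forces them through a whole period. -/
noncomputable def barrier (p x : ℝ) : ℝ := -p - p * (x ^ 3 * (5 - 3 * x ^ 2))

theorem hasDerivAt_barrier (p x : ℝ) :
    HasDerivAt (barrier p) (-15 * p * (x ^ 2 * (1 - x ^ 2))) x := by
  refine ((((hasDerivAt_pow 3 x).mul (((hasDerivAt_pow 2 x).const_mul 3).const_sub 5)).const_mul
    p).const_sub (-p)).congr_deriv ?_
  push_cast
  ring

theorem barrier_neg (p x : ℝ) : barrier p (-x) = -(barrier p x + 2 * p) := by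
  rw [barrier, barrier]
  ring

theorem abs_barrier_add_lt (hp : 0 < p) {x : ℝ} (h0 : 0 < x) (h1 : x < 1) :
    |barrier p x + 2 * p| < p := by
  have hpos : 0 < x ^ 3 * (5 - 3 * x ^ 2) := mul_pos (by positivity) (by nlinarith)
  have hlt : 0 < 2 - x ^ 3 * (5 - 3 * x ^ 2) := by
    rw [show 2 - x ^ 3 * (5 - 3 * x ^ 2)
      = (1 - x) ^ 2 * (2 + 4 * x + 6 * x ^ 2 + 3 * x ^ 3) by ring]
    have : 0 < 1 - x := by linarith
    positivity
  rw [abs_lt, barrier]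
  constructor <;> nlinarith

theorem linearWeight_barrier_pos (hp : 1 < p) {x : ℝ} (hx : x ∈ Icc (-1 : ℝ) 1)
    (hx' : x ∉ ({-1, 0, 1} : Set ℝ)) :
    0 < linearWeight p (barrier p x) + linearWeight p (barrier p x + 2 * p) := by
  have hp0 : 0 < p := by linarith
  simp only [mem_insert_iff, mem_singleton_iff, not_or] at hx'
  rcases lt_or_gt_of_ne hx'.2.1 with hneg | hpos
  · have h := abs_barrier_add_lt hp0 (neg_pos.2 hneg) (neg_lt.1 (hx.1.lt_of_ne' hx'.1))
    rw [barrier_neg, neg_add, neg_add_cancel_right, abs_neg] at h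
    exact add_pos_of_pos_of_nonneg (linearWeight_pos hp h) (linearWeight_nonneg _)
  · exact add_pos_of_nonneg_of_pos (linearWeight_nonneg _)
      (linearWeight_pos hp (abs_barrier_add_lt hp0 hpos (hx.2.lt_of_ne hx'.2.2)))

theorem barrier_mem_nodes {x : ℝ} (hx : x ∈ ({-1, 0, 1} : Set ℝ)) :
    barrier p x ∈ ({p, -p, -3 * p} : Set ℝ) := by
  rcases hx with rfl | rfl | rfl
  · left; rw [barrier]; ring
  · right; left; rw [barrier]; ring
  · right; right; rw [mem_singleton_iff, barrier]; ring

theorem exists_forall_angleField_barrier_lt (hp : 1 < p) (hq : 1 < q) {V : ℝ → ℝ}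
    (hV : Continuous V) : ∃ L, ∀ l ≥ L, ∀ x ∈ Icc (-1 : ℝ) 1,
      angleField p q V l x (barrier p x) < -15 * p * (x ^ 2 * (1 - x ^ 2)) := by
  have hbarrier : Continuous (barrier p) := by unfold barrier; fun_prop
  have hA := continuous_linearWeight hp
  have hB := continuous_powerWeight hq
  have hdegenerate : ∀ x ∈ Icc (-1 : ℝ) 1,
      linearWeight p (barrier p x) + linearWeight p (barrier p x + 2 * p) = 0 →
      angleField p q V 0 x (barrier p x) - -15 * p * (x ^ 2 * (1 - x ^ 2)) < 0 := by
    intro x hx hzero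
    have hnode : x ∈ ({-1, 0, 1} : Set ℝ) := by
      by_contra h
      exact (linearWeight_barrier_pos hp hx h).ne' hzero
    have hderiv : x ^ 2 * (1 - x ^ 2) = 0 := by rcases hnode with rfl | rfl | rfl <;> norm_num
    rw [angleField_of_mem_nodes hp (barrier_mem_nodes hnode), hderiv]
    linarith
  obtain ⟨L, hL⟩ := exists_forall_sub_mul_neg isCompact_Icc (by fun_prop)
    (fun x => add_nonneg (linearWeight_nonneg _) (linearWeight_nonneg _))
    (by unfold angleField; fun_prop) hdegenerate
  refine ⟨L, fun l hl x hx => ?_⟩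
  have := hL l hl x hx
  simp only [angleField] at this ⊢
  linarith

theorem exists_forall_angle_solution_lt (hp : 1 < p) (hq : 1 < q) {V : ℝ → ℝ}
    (hV : Continuous V) :
    ∃ L, ∀ l ≥ L, ∀ θ, IsAngleSolution p q V l θ → θ (-1) ≤ p → θ 1 < -3 * p := by
  obtain ⟨L, hL⟩ := exists_forall_angleField_barrier_lt hp hq hV
  refine ⟨L, fun l hl θ hθ h0 => ?_⟩
  have hlt := hθ.lt_of_deriv_lt le_rfl (hasDerivAt_barrier p) (hL l hl) (x := 1)
    (by rw [barrier]; linarith) (by norm_num)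
  rw [barrier] at hlt
  linarith

theorem hasDerivAt_riccatiChart_comp (hpq : p.HolderConjugate q) {θ : ℝ → ℝ} {x v : ℝ}
    (hθ : |θ x| < p)
    (h : HasDerivAt θ (v * linearWeight p (θ x) - (p - 1) * powerWeight q (θ x)) x) :
    HasDerivAt (fun y => riccatiChart p (θ y))
      (v - (p - 1) * |riccatiChart p (θ x)| ^ q) x := by
  refine ((hasDerivAt_riccatiChart hpq.lt hθ).comp x h).congr_deriv ?_
  have := linearWeight_pos hpq.lt hθ
  rw [← linearWeight_mul_abs_riccatiChart hpq hθ]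
  field_simp

/-- `r = |u'|^(p-2) u' / |u|^(p-2) u` for a positive solution `u` of the Robin problem with
eigenvalue `l`. -/
structure IsGroundRiccati (p q α : ℝ) (V : ℝ → ℝ) (l : ℝ) (r : ℝ → ℝ) : Prop where
  riccati : IsRiccatiOn p q V l r (Icc (-1) 1)
  right : r 1 = -α
  left : r (-1) = α

/-- `|u'|^(p-2) u' / |u|^(p-2) u` for a solution `u` of the Robin problem with eigenvalue `l` and a
single zero `c`: `r` to the right of `c` and `s` to the left. -/
structure IsNodalRiccati (p q α : ℝ) (V : ℝ → ℝ) (l c : ℝ) (r s : ℝ → ℝ) : Prop where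
  node_mem : c ∈ Ioo (-1 : ℝ) 1
  riccati_right : IsRiccatiOn p q V l r (Ioc c 1)
  right : r 1 = -α
  tendsto_right : Tendsto r (𝓝[>] c) atTop
  riccati_left : IsRiccatiOn p q V l s (Ico (-1) c)
  left : s (-1) = α
  tendsto_left : Tendsto s (𝓝[<] c) atBot

theorem IsAngleSolution.lt_of_lt_right (hp : 1 < p) {V : ℝ → ℝ} {l : ℝ} {θ : ℝ → ℝ} {k b x : ℝ}
    (hθ : IsAngleSolution p q V l θ) (hk : k ∈ ({p, -p, -3 * p} : Set ℝ)) (hb : b ≤ 1)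
    (hkb : k ≤ θ b) (hx : x ∈ Ico (-1) b) : k < θ x := by
  by_contra! h
  exact (hθ.lt_node hp hk hx.1 h ⟨hx.2, hb⟩).not_ge hkb

theorem IsAngleSolution.lt_node_of_left_lt (hp : 1 < p) {V : ℝ → ℝ} {l : ℝ} {θ : ℝ → ℝ}
    {k x : ℝ} (hθ : IsAngleSolution p q V l θ) (hk : k ∈ ({p, -p, -3 * p} : Set ℝ))
    (hleft : θ (-1) < k) (hx : x ∈ Icc (-1 : ℝ) 1) : θ x < k := by
  rcases eq_or_lt_of_le hx.1 with rfl | hx1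
  · exact hleft
  · exact hθ.lt_node hp hk le_rfl hleft.le ⟨hx1, hx.2⟩

theorem IsAngleSolution.node_lt_of_lt_right (hp : 1 < p) {V : ℝ → ℝ} {l : ℝ} {θ : ℝ → ℝ}
    {k x : ℝ} (hθ : IsAngleSolution p q V l θ) (hk : k ∈ ({p, -p, -3 * p} : Set ℝ))
    (hright : k < θ 1) (hx : x ∈ Icc (-1 : ℝ) 1) : k < θ x := by
  rcases eq_or_lt_of_le hx.2 with rfl | hx1
  · exact hright
  · exact hθ.lt_of_lt_right hp hk le_rfl hright.le ⟨hx.1, hx1⟩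

theorem IsAngleSolution.isGroundRiccati (hpq : p.HolderConjugate q) {V : ℝ → ℝ} {l τ : ℝ}
    {θ : ℝ → ℝ} (hθ : IsAngleSolution p q V l θ) (hτ : |τ| < p) (h0 : θ (-1) = -τ)
    (h1 : θ 1 = τ) :
    IsGroundRiccati p q (-riccatiChart p τ) V l fun x => riccatiChart p (θ x) := by
  have hτ' := (abs_lt.1 hτ).1
  have hupper : ∀ x ∈ Icc (-1 : ℝ) 1, θ x < p := fun x hx =>
    hθ.lt_node_of_left_lt hpq.lt (by simp) (by linarith) hx
  have hlower : ∀ x ∈ Icc (-1 : ℝ) 1, -p < θ x := fun x hx =>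
    hθ.node_lt_of_lt_right hpq.lt (by simp) (by linarith) hx
  refine ⟨fun x hx => hasDerivAt_riccatiChart_comp hpq (abs_lt.2 ⟨hlower x hx, hupper x hx⟩) ?_,
    ?_, ?_⟩
  · rw [← angleField_of_ge hpq.lt (hlower x hx).le]
    exact hθ x hx
  · rw [h1, neg_neg]
  · rw [h0, riccatiChart_neg]

theorem tendsto_riccatiChart_nhdsGT_neg (hp : 1 < p) :
    Tendsto (riccatiChart p) (𝓝[>] (-p)) atBot := by
  have hneg : Tendsto (fun θ : ℝ => -θ) (𝓝[>] (-p)) (𝓝[<] p) := by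
    simpa using tendsto_neg_nhdsGT (a := -p)
  refine (tendsto_neg_atTop_atBot.comp ((tendsto_riccatiChart hp).comp hneg)).congr fun θ => ?_
  simp only [Function.comp_apply, riccatiChart_neg, neg_neg]

theorem IsAngleSolution.exists_isNodalRiccati (hpq : p.HolderConjugate q) {V : ℝ → ℝ} {l τ : ℝ}
    {θ : ℝ → ℝ} (hθ : IsAngleSolution p q V l θ) (hτ : |τ| < p) (h0 : θ (-1) = -τ)
    (h1 : θ 1 = τ - 2 * p) :
    ∃ c r s, IsNodalRiccati p q (-riccatiChart p τ) V l c r s := by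
  have hp := hpq.lt
  obtain ⟨hτ1, hτ2⟩ := abs_lt.1 hτ
  obtain ⟨c, hc, hcθ⟩ : -p ∈ θ '' Ioo (-1) 1 :=
    intermediate_value_Ioo' (by norm_num) hθ.continuousOn ⟨by linarith, by linarith⟩
  have hcI := Ioo_subset_Icc_self hc
  have hright : ∀ x ∈ Ioc c 1, |θ x + 2 * p| < p := fun x hx => by
    have hlt := hθ.lt_node hp (by simp) hcI.1 hcθ.le hx
    have hlow : -3 * p < θ x :=
      hθ.node_lt_of_lt_right hp (by simp) (by linarith) ⟨hcI.1.trans hx.1.le, hx.2⟩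
    exact abs_lt.2 ⟨by linarith, by linarith⟩
  have hleft : ∀ x ∈ Ico (-1) c, |θ x| < p := fun x hx =>
    abs_lt.2 ⟨hθ.lt_of_lt_right hp (by simp) hcI.2 hcθ.ge hx,
      hθ.lt_node_of_left_lt hp (by simp) (by linarith) ⟨hx.1, hx.2.le.trans hcI.2⟩⟩
  have hcont : Tendsto θ (𝓝 c) (𝓝 (-p)) := hcθ ▸ (hθ c hcI).continuousAt
  refine ⟨c, fun x => riccatiChart p (θ x + 2 * p), fun x => riccatiChart p (θ x), hc,
    fun x hx => ?_, ?_, ?_, fun x hx => ?_, ?_, ?_⟩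
  · refine hasDerivAt_riccatiChart_comp hpq (θ := fun x => θ x + 2 * p) (hright x hx) ?_
    rw [← angleField_of_le hp (by linarith [(abs_lt.1 (hright x hx)).2])]
    exact (hθ x ⟨hcI.1.trans hx.1.le, hx.2⟩).add_const _
  · rw [h1, sub_add_cancel, neg_neg]
  · refine (tendsto_riccatiChart hp).comp (tendsto_nhdsWithin_iff.2 ⟨?_, ?_⟩)
    · have := (hcont.add_const (2 * p)).mono_left (nhdsWithin_le_nhds (s := Ioi c))
      rwa [show -p + 2 * p = p by ring] at this
    · filter_upwards [Ioc_mem_nhdsGT hc.2] with x hx using (abs_lt.1 (hright x hx)).2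
  · refine hasDerivAt_riccatiChart_comp hpq (hleft x hx) ?_
    rw [← angleField_of_ge hp (abs_lt.1 (hleft x hx)).1.le]
    exact hθ x ⟨hx.1, hx.2.le.trans hcI.2⟩
  · rw [h0, riccatiChart_neg]
  · refine (tendsto_riccatiChart_nhdsGT_neg hp).comp (tendsto_nhdsWithin_iff.2
      ⟨hcont.mono_left nhdsWithin_le_nhds, ?_⟩)
    filter_upwards [Ico_mem_nhdsLT hc.1] with x hx using (abs_lt.1 (hleft x hx)).1

theorem exists_isGroundRiccati_isNodalRiccati (hpq : p.HolderConjugate q) {V : ℝ → ℝ}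
    (hV : Continuous V) (α : ℝ) : ∃ (l₀ l₁ c : ℝ) (r₀ r s : ℝ → ℝ),
      l₀ < l₁ ∧ IsGroundRiccati p q α V l₀ r₀ ∧ IsNodalRiccati p q α V l₁ c r s := by
  have hp := hpq.lt
  have hq := hpq.symm.lt
  obtain ⟨τ, hτ, hτα⟩ := exists_riccatiChart_eq hp (-α)
  have hτ' := (abs_lt.1 hτ).1
  obtain rfl : α = -riccatiChart p τ := by rw [hτα, neg_neg]
  choose θ h0 hθ using fun l => exists_isAngleSolution hp hq hV l (-τ)
  have hcont := continuous_angle_solution hp hq hV h0 hθ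
  obtain ⟨k, hk⟩ := exists_lt_angle_solution hp hq hV hτ
  obtain ⟨L, hL⟩ := exists_forall_angle_solution_lt hp hq hV
  have hlow : ∀ l ≥ L, θ l 1 < -3 * p := fun l hl => hL l hl _ (hθ l) (by linarith [h0 l])
  obtain ⟨l₀, hl₀⟩ : ∃ l, θ l 1 = τ := mem_range_of_exists_le_of_exists_ge hcont
    ⟨L, by linarith [hlow L le_rfl]⟩ ⟨k, (hk _ (hθ k) (h0 k)).le⟩
  obtain ⟨l₁, hl₁, hl₁'⟩ : τ - 2 * p ∈ (fun l => θ l 1) '' Icc l₀ (max L l₀) :=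
    intermediate_value_Icc' (le_max_right _ _) hcont.continuousOn
      ⟨by linarith [hlow _ (le_max_left L l₀)], by simp only [hl₀]; linarith⟩
  have hne : l₀ ≠ l₁ := by
    rintro rfl
    exact absurd (hl₀.symm.trans hl₁') (by linarith)
  obtain ⟨c, r, s, hnodal⟩ := (hθ l₁).exists_isNodalRiccati hpq hτ (h0 l₁) hl₁'
  exact ⟨l₀, l₁, c, _, r, s, hl₁.1.lt_of_ne hne, (hθ l₀).isGroundRiccati hpq hτ (h0 l₀) hl₀, hnodal⟩

end Shooting

/-! ### Eigenfunctions recovered from the Riccati equation -/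

section Profiles

variable {p q : ℝ} {V : ℝ → ℝ} {l c : ℝ} {r f : ℝ → ℝ}

theorem sub_one_mul_sub_one (hpq : p.HolderConjugate q) : (p - 1) * (q - 1) = 1 := by
  linarith [hpq.sub_one_mul_conj]

theorem abs_spow_mul_rpow (hpq : p.HolderConjugate q) (y : ℝ) {z : ℝ} (hz : 0 ≤ z) :
    |spow (q - 1) y * z| ^ p = |y| ^ q * z ^ p := by
  rw [abs_mul, abs_spow hpq.symm.sub_one_pos, abs_of_nonneg hz, Real.mul_rpow (by positivity) hz,
    ← Real.rpow_mul (abs_nonneg _), hpq.symm.sub_one_mul_conj]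

theorem hasDerivAt_mul_rpow (hpq : p.HolderConjugate q) {x v : ℝ}
    (hr : HasDerivAt r (v - (p - 1) * |r x| ^ q) x)
    (hf : HasDerivAt f (spow (q - 1) (r x) * f x) x) (hfx : 0 < f x) :
    HasDerivAt (fun y => r y * f y ^ p) (|spow (q - 1) (r x) * f x| ^ p + v * f x ^ p) x := by
  refine (hr.mul (hf.rpow_const (Or.inl hfx.ne'))).congr_deriv ?_
  have hspow := mul_spow hpq.symm.sub_one_pos (r x)
  rw [sub_add_cancel] at hspow
  rw [abs_spow_mul_rpow hpq _ hfx.le]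
  calc _ = v * f x ^ p - (p - 1) * |r x| ^ q * f x ^ p
        + p * (r x * spow (q - 1) (r x)) * (f x ^ (p - 1) * f x) := by ring
    _ = _ := by rw [hspow, ← Real.rpow_add_one hfx.ne', sub_add_cancel]; ring

theorem hasDerivAt_mul_rpow_sub_one (hpq : p.HolderConjugate q) {x v : ℝ}
    (hr : HasDerivAt r (v - (p - 1) * |r x| ^ q) x)
    (hf : HasDerivAt f (spow (q - 1) (r x) * f x) x) (hfx : 0 < f x) :
    HasDerivAt (fun y => r y * f y ^ (p - 1)) (v * f x ^ (p - 1)) x := by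
  refine (hr.mul (hf.rpow_const (Or.inl hfx.ne'))).congr_deriv ?_
  have hspow := mul_spow hpq.symm.sub_one_pos (r x)
  rw [sub_add_cancel] at hspow
  calc _ = v * f x ^ (p - 1) - (p - 1) * |r x| ^ q * f x ^ (p - 1)
        + (p - 1) * (r x * spow (q - 1) (r x)) * (f x ^ (p - 1 - 1) * f x) := by ring
    _ = _ := by rw [hspow, ← Real.rpow_add_one hfx.ne', sub_add_cancel]; ring

theorem hasDerivAt_exp_integral {g : ℝ → ℝ} {s : Set ℝ} (hs : IsOpen s) (hs' : s.OrdConnected)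
    (hg : ContinuousOn g s) {a x : ℝ} (ha : a ∈ s) (hx : x ∈ s) :
    HasDerivAt (fun y => Real.exp (∫ t in a..y, g t)) (g x * Real.exp (∫ t in a..x, g t)) x := by
  have hint : IntervalIntegrable g volume a x :=
    (hg.mono (hs'.uIcc_subset ha hx)).intervalIntegrable
  exact (intervalIntegral.integral_hasDerivAt_right hint (hg.stronglyMeasurableAtFilter hs x hx)
    (hg.continuousAt (hs.mem_nhds hx))).exp.congr_deriv (mul_comm _ _)

/-- `f` is a nonnegative solution on `[-1, 1]` of the eigenvalue equation with
`|f'|^(p-2) f' = r f^(p-1)`; the classical equation is only required outside the set `t` of nodes.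
The flux `r f^p = |f'|^(p-2) f' f` is the boundary term of integration by parts. -/
structure IsProfile (p q : ℝ) (V : ℝ → ℝ) (l : ℝ) (r f : ℝ → ℝ) (t : Set ℝ) : Prop where
  continuous : Continuous f
  nonneg : ∀ x, 0 ≤ f x
  hasDerivAt : ∀ x ∈ Icc (-1 : ℝ) 1 \ t, HasDerivAt f (spow (q - 1) (r x) * f x) x
  exists_bound : ∃ C, ∀ x ∈ Icc (-1 : ℝ) 1, |spow (q - 1) (r x) * f x| ≤ C
  continuousOn_flux : ContinuousOn (fun x => r x * f x ^ p) (Icc (-1) 1)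
  hasDerivAt_flux : ∀ x ∈ Icc (-1 : ℝ) 1 \ t, HasDerivAt (fun x => r x * f x ^ p)
    (|spow (q - 1) (r x) * f x| ^ p + (V x - l) * f x ^ p) x

theorem IsProfile.comp_neg {t : Set ℝ} (h : IsProfile p q (fun x => V (-x)) l r f t) :
    IsProfile p q V l (fun x => -r (-x)) (fun x => f (-x)) (Neg.neg ⁻¹' t) where
  continuous := h.continuous.comp continuous_neg
  nonneg x := h.nonneg (-x)
  hasDerivAt x hx :=
    ((h.hasDerivAt (-x) ⟨neg_mem_Icc_iff.2 (by simpa using hx.1), hx.2⟩).comp x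
      (hasDerivAt_neg x)).congr_deriv (by rw [spow_neg]; ring)
  exists_bound := by
    obtain ⟨C, hC⟩ := h.exists_bound
    refine ⟨C, fun x hx => ?_⟩
    rw [spow_neg, neg_mul, abs_neg]
    exact hC (-x) (neg_mem_Icc_iff.2 (by simpa using hx))
  continuousOn_flux := by
    simp only [neg_mul]
    exact (h.continuousOn_flux.comp continuous_neg.continuousOn
      fun x hx => neg_mem_Icc_iff.2 (by simpa using hx)).neg
  hasDerivAt_flux x hx := by
    simp only [neg_mul, spow_neg, abs_neg]
    refine (((h.hasDerivAt_flux (-x) ⟨neg_mem_Icc_iff.2 (by simpa using hx.1), hx.2⟩).comp x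
      (hasDerivAt_neg x)).neg).congr_deriv ?_
    simp only [neg_neg, mul_neg, mul_one]

theorem IsRiccatiOn.comp_neg {s : Set ℝ} (hr : IsRiccatiOn p q V l r s) :
    IsRiccatiOn p q (fun x => V (-x)) l (fun x => -r (-x)) (Neg.neg ⁻¹' s) := fun x hx => by
  refine ((hr (-x) hx).comp x (hasDerivAt_neg x)).neg.congr_deriv ?_
  rw [abs_neg]
  ring

theorem IsRiccatiOn.exists_isProfile (hpq : p.HolderConjugate q)
    (hr : IsRiccatiOn p q V l r (Icc (-1) 1)) :
    ∃ v : ℝ → ℝ, (∀ x, 0 < v x) ∧ IsProfile p q V l r v ∅ := by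
  have hspow := continuous_spow hpq.symm.sub_one_pos
  have hI : (-1 : ℝ) ≤ 1 := by norm_num
  have hψ : Continuous fun x => spow (q - 1) (r (projIcc (-1) 1 hI x)) := hspow.comp
    (hr.continuousOn.comp_continuous (continuous_subtype_val.comp continuous_projIcc)
      fun x => Subtype.prop _)
  set v : ℝ → ℝ := fun x => Real.exp (∫ t in (-1)..x, spow (q - 1) (r (projIcc (-1) 1 hI t)))
  have hv0 : ∀ x, 0 < v x := fun x => Real.exp_pos _
  have hvderiv : ∀ x, HasDerivAt v (spow (q - 1) (r (projIcc (-1) 1 hI x)) * v x) x := fun x =>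
    hasDerivAt_exp_integral isOpen_univ ordConnected_univ hψ.continuousOn (mem_univ _) (mem_univ x)
  have hvderiv' : ∀ x ∈ Icc (-1 : ℝ) 1, HasDerivAt v (spow (q - 1) (r x) * v x) x :=
    fun x hx => by simpa only [projIcc_of_mem hI hx] using hvderiv x
  have hvcont : Continuous v := continuous_iff_continuousAt.2 fun x => (hvderiv x).continuousAt
  refine ⟨v, hv0, hvcont, fun x => (hv0 x).le, fun x hx => hvderiv' x hx.1, ?_, ?_,
    fun x hx => hasDerivAt_mul_rpow hpq (hr x hx.1) (hvderiv' x hx.1) (hv0 x)⟩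
  · exact isCompact_Icc.exists_bound_of_continuousOn
      ((hspow.comp_continuousOn hr.continuousOn).mul hvcont.continuousOn)
  · exact hr.continuousOn.mul (hvcont.rpow_const fun _ => Or.inr hpq.nonneg).continuousOn

/-- The solution of `f' = |r|^(q-2) r f` on `(c, 1]` with `f 1 = 1`, extended by zero to the left.
To the right of `1` it is continued with `r` frozen at `r 1`. -/
noncomputable def rightProfile (q c : ℝ) (r : ℝ → ℝ) (x : ℝ) : ℝ :=
  if x ≤ c then 0 else Real.exp (∫ t in 1..x, spow (q - 1) (r (min t 1)))

theorem rightProfile_of_le {x : ℝ} (hx : x ≤ c) : rightProfile q c r x = 0 := if_pos hx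

theorem rightProfile_eventuallyEq_zero {x : ℝ} (hx : x < c) :
    rightProfile q c r =ᶠ[𝓝 x] fun _ => 0 := by
  filter_upwards [Iio_mem_nhds hx] with y hy using rightProfile_of_le (le_of_lt hy)

theorem rightProfile_of_lt {x : ℝ} (hx : c < x) :
    rightProfile q c r x = Real.exp (∫ t in 1..x, spow (q - 1) (r (min t 1))) :=
  if_neg (not_le.2 hx)

theorem rightProfile_pos {x : ℝ} (hx : c < x) : 0 < rightProfile q c r x := by
  rw [rightProfile_of_lt hx]
  exact Real.exp_pos _

theorem rightProfile_nonneg (x : ℝ) : 0 ≤ rightProfile q c r x := by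
  rcases le_or_gt x c with h | h
  · exact (rightProfile_of_le h).ge
  · exact (rightProfile_pos h).le

theorem hasDerivAt_rightProfile (hq : 1 < q) (hc : c < 1) (hr : ContinuousOn r (Ioc c 1)) {x : ℝ}
    (hx : c < x) : HasDerivAt (rightProfile q c r)
      (spow (q - 1) (r (min x 1)) * rightProfile q c r x) x := by
  have hψ : ContinuousOn (fun x => spow (q - 1) (r (min x 1))) (Ioi c) :=
    (continuous_spow (sub_pos.2 hq)).comp_continuousOn
      (hr.comp (continuous_id.min continuous_const).continuousOn
        fun y hy => ⟨lt_min hy hc, min_le_right _ _⟩)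
  rw [rightProfile_of_lt hx]
  refine (hasDerivAt_exp_integral isOpen_Ioi ordConnected_Ioi hψ hc hx).congr_of_eventuallyEq ?_
  filter_upwards [Ioi_mem_nhds hx] with y hy using rightProfile_of_lt hy

theorem hasDerivAt_rightProfile_of_mem (hq : 1 < q) (hr : ContinuousOn r (Ioc c 1)) {x : ℝ}
    (hx : x ∈ Ioc c 1) :
    HasDerivAt (rightProfile q c r) (spow (q - 1) (r x) * rightProfile q c r x) x := by
  simpa only [min_eq_left hx.2] using
    hasDerivAt_rightProfile hq (hx.1.trans_le hx.2) hr hx.1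

theorem exists_rightProfile_le (hq : 1 < q) (hc : c < 1) (hr : ContinuousOn r (Ioc c 1))
    (hnode : Tendsto r (𝓝[>] c) atTop) : ∃ F, ∀ x ∈ Ioc c 1, rightProfile q c r x ≤ F := by
  obtain ⟨b, hb, hrb⟩ := (mem_nhdsGT_iff_exists_mem_Ioc_Ioo_subset hc).1
    (hnode.eventually (eventually_ge_atTop 0))
  have hderiv := fun x hx => hasDerivAt_rightProfile_of_mem (x := x) hq hr hx
  have hcont : ContinuousOn (rightProfile q c r) (Ioc c 1) := fun x hx =>
    (hderiv x hx).continuousAt.continuousWithinAt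
  obtain ⟨F, hF⟩ := isCompact_Icc.exists_bound_of_continuousOn
    (hcont.mono fun x (hx : x ∈ Icc b 1) => ⟨hb.1.trans_le hx.1, hx.2⟩)
  refine ⟨F, fun x hx => ?_⟩
  rcases le_total b x with h | h
  · exact (le_abs_self _).trans (hF x ⟨h, hx.2⟩)
  have hmono : MonotoneOn (rightProfile q c r) (Ioc c b) := by
    have hIoo : ∀ y ∈ interior (Ioc c b), y ∈ Ioo c b := fun y hy => by rwa [interior_Ioc] at hy
    refine monotoneOn_of_deriv_nonneg (convex_Ioc _ _) (hcont.mono (Ioc_subset_Ioc_right hb.2))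
      (fun y hy => ?_) fun y hy => ?_
    all_goals have hyb := hIoo y hy
    all_goals have hy := hderiv y ⟨hyb.1, hyb.2.le.trans hb.2⟩
    · exact hy.differentiableAt.differentiableWithinAt
    · rw [hy.deriv, spow_of_nonneg (sub_pos.2 hq) (hrb hyb)]
      exact mul_nonneg (Real.rpow_nonneg (hrb hyb) _) (rightProfile_nonneg y)
  exact (hmono ⟨hx.1, h⟩ ⟨hb.1, le_rfl⟩ h).trans
    ((le_abs_self _).trans (hF b ⟨le_rfl, hb.2⟩))

theorem exists_abs_mul_rightProfile_rpow_le (hpq : p.HolderConjugate q) (hV : Continuous V)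
    (hc : c < 1) (hr : IsRiccatiOn p q V l r (Ioc c 1)) (hnode : Tendsto r (𝓝[>] c) atTop) :
    ∃ C, ∀ x ∈ Ioc c 1, |r x * rightProfile q c r x ^ (p - 1)| ≤ C := by
  obtain ⟨F, hF⟩ := exists_rightProfile_le hpq.symm.lt hc hr.continuousOn hnode
  obtain ⟨M, hM⟩ := (isCompact_Icc (a := c) (b := 1)).exists_bound_of_continuousOn
    (hV.sub (continuous_const (y := l))).continuousOn
  have hM0 : 0 ≤ M := (norm_nonneg _).trans (hM 1 ⟨hc.le, le_rfl⟩)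
  have hF0 : 0 ≤ F := (rightProfile_nonneg 1).trans (hF 1 ⟨hc, le_rfl⟩)
  set flux : ℝ → ℝ := fun x => r x * rightProfile q c r x ^ (p - 1)
  have hderiv : ∀ x ∈ Ioc c 1, HasDerivWithinAt flux
      ((V x - l) * rightProfile q c r x ^ (p - 1)) (Ioc c 1) x := fun x hx =>
    (hasDerivAt_mul_rpow_sub_one hpq (hr x hx)
      (hasDerivAt_rightProfile_of_mem hpq.symm.lt hr.continuousOn hx)
      (rightProfile_pos hx.1)).hasDerivWithinAt
  have hbound : ∀ x ∈ Ioc c 1,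
      ‖(V x - l) * rightProfile q c r x ^ (p - 1)‖ ≤ M * F ^ (p - 1) := fun x hx => by
    have hf0 := rightProfile_nonneg (q := q) (c := c) (r := r) x
    rw [norm_mul, Real.norm_of_nonneg (Real.rpow_nonneg hf0 _)]
    exact mul_le_mul (hM x (Ioc_subset_Icc_self hx))
      (Real.rpow_le_rpow hf0 (hF x hx) hpq.sub_one_pos.le) (Real.rpow_nonneg hf0 _) hM0
  refine ⟨|flux 1| + M * F ^ (p - 1) * (1 - c), fun x hx => ?_⟩
  have hmvt : |flux x - flux 1| ≤ M * F ^ (p - 1) * |x - 1| :=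
    (convex_Ioc c 1).norm_image_sub_le_of_norm_hasDerivWithin_le hderiv hbound ⟨hc, le_rfl⟩ hx
  have hdist : |x - 1| ≤ 1 - c := abs_le.2 ⟨by linarith [hx.1], by linarith [hx.2]⟩
  calc |flux x| ≤ |flux 1| + |flux x - flux 1| := by
        linarith [abs_sub_abs_le_abs_sub (flux x) (flux 1)]
    _ ≤ |flux 1| + M * F ^ (p - 1) * |x - 1| := by gcongr
    _ ≤ |flux 1| + M * F ^ (p - 1) * (1 - c) := by gcongr

theorem rpow_sub_one_rpow_sub_one (hpq : p.HolderConjugate q) {x : ℝ} (hx : 0 ≤ x) :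
    (x ^ (p - 1)) ^ (q - 1) = x := by
  rw [← Real.rpow_mul hx, sub_one_mul_sub_one hpq, Real.rpow_one]

theorem tendsto_rightProfile (hpq : p.HolderConjugate q) (hc : c < 1)
    (hnode : Tendsto r (𝓝[>] c) atTop) {C : ℝ}
    (hC : ∀ x ∈ Ioc c 1, |r x * rightProfile q c r x ^ (p - 1)| ≤ C) :
    Tendsto (rightProfile q c r) (𝓝[>] c) (𝓝 0) := by
  have hq : 0 < q - 1 := hpq.symm.sub_one_pos
  have hpow : Tendsto (fun x => rightProfile q c r x ^ (p - 1)) (𝓝[>] c) (𝓝 0) := by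
    refine squeeze_zero' (.of_forall fun x => Real.rpow_nonneg (rightProfile_nonneg x) _) ?_
      (hnode.const_div_atTop C)
    filter_upwards [Ioc_mem_nhdsGT hc, hnode.eventually (eventually_gt_atTop 0)] with x hx hrx
    rw [le_div_iff₀ hrx, mul_comm]
    exact (le_abs_self _).trans (hC x hx)
  have hlim := hpow.rpow_const (p := q - 1) (Or.inr hq.le)
  simpa only [rpow_sub_one_rpow_sub_one hpq (rightProfile_nonneg _), Real.zero_rpow hq.ne']
    using hlim

theorem continuous_rightProfile (hq : 1 < q) (hc : c < 1) (hr : ContinuousOn r (Ioc c 1))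
    (hlim : Tendsto (rightProfile q c r) (𝓝[>] c) (𝓝 0)) : Continuous (rightProfile q c r) := by
  rw [continuous_iff_continuousAt]
  intro x
  rcases lt_trichotomy x c with h | rfl | h
  · exact continuousAt_const.congr (rightProfile_eventuallyEq_zero h).symm
  · rw [continuousAt_iff_continuous_left'_right']
    constructor
    · refine (continuousWithinAt_const (b := (0 : ℝ))).congr_of_eventuallyEq ?_
        (rightProfile_of_le le_rfl)
      filter_upwards [self_mem_nhdsWithin] with y hy using rightProfile_of_le (le_of_lt hy)
    · rw [ContinuousWithinAt, rightProfile_of_le le_rfl]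
      exact hlim
  · exact (hasDerivAt_rightProfile hq hc hr h).continuousAt

theorem abs_spow_mul_rightProfile_le (hpq : p.HolderConjugate q) {C : ℝ}
    (hC : ∀ x ∈ Ioc c 1, |r x * rightProfile q c r x ^ (p - 1)| ≤ C) {x : ℝ} (hx : x ∈ Ioc c 1) :
    |spow (q - 1) (r x) * rightProfile q c r x| ≤ C ^ (q - 1) := by
  have hq : 0 < q - 1 := hpq.symm.sub_one_pos
  have hf := rightProfile_nonneg (q := q) (c := c) (r := r) x
  calc |spow (q - 1) (r x) * rightProfile q c r x|
      = |r x * rightProfile q c r x ^ (p - 1)| ^ (q - 1) := by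
        rw [abs_mul, abs_spow hq, abs_of_nonneg hf, abs_mul,
          abs_of_nonneg (Real.rpow_nonneg hf _), Real.mul_rpow (abs_nonneg _) (by positivity),
          rpow_sub_one_rpow_sub_one hpq hf]
    _ ≤ C ^ (q - 1) := Real.rpow_le_rpow (abs_nonneg _) (hC x hx) hq.le

theorem continuousAt_mul_rightProfile_rpow_node (hpq : p.HolderConjugate q) (hc : c < 1) {C : ℝ}
    (hC : ∀ x ∈ Ioc c 1, |r x * rightProfile q c r x ^ (p - 1)| ≤ C)
    (hcont : Continuous (rightProfile q c r)) :
    ContinuousAt (fun x => r x * rightProfile q c r x ^ p) c := by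
  have hzero : r c * rightProfile q c r c ^ p = 0 := by
    rw [rightProfile_of_le le_rfl, Real.zero_rpow hpq.ne_zero, mul_zero]
  have hlim : Tendsto (fun x => C * rightProfile q c r x) (𝓝 c) (𝓝 0) := by
    simpa only [rightProfile_of_le le_rfl, mul_zero] using (hcont.tendsto c).const_mul C
  rw [ContinuousAt, hzero]
  refine squeeze_zero_norm' ?_ hlim
  filter_upwards [Iio_mem_nhds hc] with x hx1
  rcases le_or_gt x c with h | h
  · rw [rightProfile_of_le h, Real.zero_rpow hpq.ne_zero, mul_zero, mul_zero, norm_zero]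
  · have hf := rightProfile_pos (q := q) (r := r) h
    rw [← sub_add_cancel p 1, Real.rpow_add_one hf.ne', ← mul_assoc, norm_mul,
      Real.norm_of_nonneg hf.le]
    exact mul_le_mul_of_nonneg_right (hC x ⟨h, le_of_lt hx1⟩) hf.le

theorem isProfile_rightProfile (hpq : p.HolderConjugate q) (hV : Continuous V) (hc : c < 1)
    (hr : IsRiccatiOn p q V l r (Ioc c 1)) (hnode : Tendsto r (𝓝[>] c) atTop) :
    IsProfile p q V l r (rightProfile q c r) {c} := by
  obtain ⟨C, hC⟩ := exists_abs_mul_rightProfile_rpow_le hpq hV hc hr hnode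
  have hcont := continuous_rightProfile hpq.symm.lt hc hr.continuousOn
    (tendsto_rightProfile hpq hc hnode hC)
  have hderiv : ∀ x ∈ Ioc c 1, HasDerivAt (rightProfile q c r) _ x := fun x =>
    hasDerivAt_rightProfile_of_mem hpq.symm.lt hr.continuousOn
  have hflux : ∀ x ∈ Icc (-1 : ℝ) 1 \ {c}, HasDerivAt (fun x => r x * rightProfile q c r x ^ p)
      (|spow (q - 1) (r x) * rightProfile q c r x| ^ p
        + (V x - l) * rightProfile q c r x ^ p) x := fun x ⟨hx, hxc⟩ => by
    rcases lt_or_gt_of_ne hxc with h | h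
    · simp only [rightProfile_of_le h.le, mul_zero, abs_zero, Real.zero_rpow hpq.ne_zero, add_zero]
      refine (hasDerivAt_const x (0 : ℝ)).congr_of_eventuallyEq ?_
      filter_upwards [rightProfile_eventuallyEq_zero h] with y hy
      rw [hy, Real.zero_rpow hpq.ne_zero, mul_zero]
    · exact hasDerivAt_mul_rpow hpq (hr x ⟨h, hx.2⟩) (hderiv x ⟨h, hx.2⟩) (rightProfile_pos h)
  refine ⟨hcont, rightProfile_nonneg, fun x ⟨hx, hxc⟩ => ?_, ⟨max (C ^ (q - 1)) 0, fun x hx => ?_⟩,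
    fun x hx => ?_, hflux⟩
  · rcases lt_or_gt_of_ne hxc with h | h
    · rw [rightProfile_of_le h.le, mul_zero]
      exact (hasDerivAt_const x (0 : ℝ)).congr_of_eventuallyEq (rightProfile_eventuallyEq_zero h)
    · exact hderiv x ⟨h, hx.2⟩
  · rcases le_or_gt x c with h | h
    · rw [rightProfile_of_le h, mul_zero, abs_zero]
      exact le_max_right _ _
    · exact (abs_spow_mul_rightProfile_le hpq hC ⟨h, hx.2⟩).trans (le_max_left _ _)
  · rcases eq_or_ne x c with rfl | h
    · exact (continuousAt_mul_rightProfile_rpow_node hpq hc hC hcont).continuousWithinAt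
    · exact (hflux x ⟨hx, h⟩).continuousAt.continuousWithinAt

end Profiles

/-! ### Eigenfunctions as elements of `W1p` -/

section TestFunctions

variable {p : ℝ} [hp : Fact (1 < p)] {q : ℝ} {V : ℝ → ℝ} {α l : ℝ} {r f : ℝ → ℝ}

theorem ne_zero_of_evalAt_pos {u : W1p p} {x : ℝ} (h : 0 < evalAt u x) : u ≠ 0 := by
  rintro rfl
  exact h.ne' rfl

/-- `u ∈ W^{1,p}(I)` is represented by the function `f` with derivative `f'`. -/
structure IsRepresentedBy (u : W1p p) (f f' : ℝ → ℝ) : Prop where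
  evalAt_eq : ∀ x ∈ Icc (-1 : ℝ) 1, evalAt u x = f x
  weakDeriv_eq : weakDeriv u =ᵐ[μI] f'

theorem IsProfile.exists_isRepresentedBy {t : Set ℝ} (ht : t.Countable)
    (h : IsProfile p q V l r f t) :
    ∃ u : W1p p, IsRepresentedBy u f fun x => spow (q - 1) (r x) * f x := by
  obtain ⟨C, hC⟩ := h.exists_bound
  have hderiv : deriv f =ᵐ[μI] fun x => spow (q - 1) (r x) * f x := by
    filter_upwards [ae_restrict_mem measurableSet_Ioo,
      ae_restrict_of_ae (ht.ae_notMem volume)] with x hx hxt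
    exact (h.hasDerivAt x ⟨Ioo_subset_Icc_self hx, hxt⟩).deriv
  obtain ⟨u, hu, hu'⟩ := exists_evalAt_eq_weakDeriv_ae_eq (p := p) ht
    h.continuous.continuousOn
    (fun x hx => h.hasDerivAt x ⟨Ioo_subset_Icc_self hx.1, hx.2⟩)
    ((measurable_deriv f).aestronglyMeasurable.congr hderiv)
    fun x hx => hC x (Ioo_subset_Icc_self hx)
  exact ⟨u, hu, hu'⟩

theorem IsProfile.energy_eq {t : Set ℝ} (ht : t.Countable) (hV : Continuous V)
    (h : IsProfile p q V l r f t)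
    (hbdry : r 1 * f 1 ^ p - r (-1) * f (-1) ^ p = -α * (f 1 ^ p + f (-1) ^ p)) {u : W1p p}
    (hu : IsRepresentedBy u f fun x => spow (q - 1) (r x) * f x) :
    energy p α V u = l * mass p u := by
  have hae : ∀ᵐ x ∂μI, |weakDeriv u x| ^ p + (V x - l) * |evalAt u x| ^ p
      = |spow (q - 1) (r x) * f x| ^ p + (V x - l) * f x ^ p := by
    filter_upwards [hu.weakDeriv_eq, ae_restrict_mem measurableSet_Ioo] with x hx hxI
    rw [hx, hu.evalAt_eq x (Ioo_subset_Icc_self hxI), abs_of_nonneg (h.nonneg x)]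
  have hint : IntervalIntegrable
      (fun x => |weakDeriv u x| ^ p + (V x - l) * |evalAt u x| ^ p) volume (-1) 1 :=
    (intervalIntegrable_abs_weakDeriv_rpow u le_rfl (by norm_num) le_rfl).add
      (Continuous.intervalIntegrable ((hV.sub continuous_const).mul
        ((continuous_evalAt u).abs.rpow_const fun _ => Or.inr (by linarith [hp.out]))) _ _)
  have hflux : ∫ x in (-1)..1, (|weakDeriv u x| ^ p + (V x - l) * |evalAt u x| ^ p)
      = r 1 * f 1 ^ p - r (-1) * f (-1) ^ p := by
    rw [intervalIntegral_congr_of_ae hae ⟨1, by norm_num⟩]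
    refine integral_eq_of_hasDerivAt_off_countable (fun x => r x * f x ^ p)
      (fun x => |spow (q - 1) (r x) * f x| ^ p + (V x - l) * f x ^ p) ht ?_ (fun x hx => ?_) ?_
    · rw [uIcc_of_le (by norm_num)]
      exact h.continuousOn_flux
    · rw [min_eq_left (by norm_num), max_eq_right (by norm_num)] at hx
      exact h.hasDerivAt_flux x ⟨Ioo_subset_Icc_self hx.1, hx.2⟩
    · refine hint.congr_ae ?_
      rwa [uIoc_of_le (by norm_num), ← restrict_Ioo_eq_restrict_Ioc]
  have hsub := energy_sub_eq hV α l u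
  rw [hflux, hbdry, hu.evalAt_eq 1 (by norm_num), hu.evalAt_eq (-1) (by norm_num),
    abs_of_nonneg (h.nonneg 1), abs_of_nonneg (h.nonneg (-1))] at hsub
  linarith

theorem IsGroundRiccati.eigenvalue_zero_le (hpq : p.HolderConjugate q) (hV : Continuous V)
    (hr : IsGroundRiccati p q α V l r) : eigenvalue p α V 0 ≤ l := by
  obtain ⟨v, hv0, hv⟩ := hr.riccati.exists_isProfile hpq
  obtain ⟨u, hu⟩ := hv.exists_isRepresentedBy countable_empty
  refine RobinGap.eigenvalue_zero_le hV (ne_zero_of_evalAt_pos (x := 0) ?_)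
    (hv.energy_eq countable_empty hV ?_ hu).le
  · rw [hu.evalAt_eq 0 (by norm_num)]
    exact hv0 0
  · rw [hr.right, hr.left]
    ring

end TestFunctions

section NodalProfiles

variable {p q : ℝ} {V : ℝ → ℝ} {α l c : ℝ} {r s f g : ℝ → ℝ}

/-- The two halves of a solution with a single zero `c`: `f` is positive to the right of `c`, `g`
to the left, and each is extended by zero across `c`. -/
structure IsNodalProfile (p q : ℝ) (V : ℝ → ℝ) (l c : ℝ) (r s f g : ℝ → ℝ) : Prop where
  right : IsProfile p q V l r f {c}
  right_pos : ∀ x, c < x → 0 < f x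
  right_zero : ∀ x ≤ c, f x = 0
  left : IsProfile p q V l s g {c}
  left_pos : ∀ x < c, 0 < g x
  left_zero : ∀ x, c ≤ x → g x = 0

theorem IsNodalRiccati.exists_isNodalProfile (hpq : p.HolderConjugate q) (hV : Continuous V)
    (h : IsNodalRiccati p q α V l c r s) : ∃ f g, IsNodalProfile p q V l c r s f g := by
  have hleft : IsRiccatiOn p q (fun x => V (-x)) l (fun x => -s (-x)) (Ioc (-c) 1) :=
    h.riccati_left.comp_neg.mono fun x hx => ⟨neg_le_neg hx.2, neg_lt.1 hx.1⟩
  have hnode : Tendsto (fun x => -s (-x)) (𝓝[>] (-c)) atTop := by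
    refine tendsto_neg_atBot_atTop.comp (h.tendsto_left.comp ?_)
    simpa only [neg_neg] using tendsto_neg_nhdsGT (a := -c)
  have hprofile := (isProfile_rightProfile hpq (hV.comp continuous_neg)
    (neg_lt.1 h.node_mem.1) hleft hnode).comp_neg
  simp only [neg_neg, neg_preimage, neg_singleton] at hprofile
  exact ⟨_, _, {
    right := isProfile_rightProfile hpq hV h.node_mem.2 h.riccati_right h.tendsto_right
    right_pos := fun x hx => rightProfile_pos hx
    right_zero := fun x hx => rightProfile_of_le hx
    left := hprofile
    left_pos := fun x hx => rightProfile_pos (neg_lt_neg hx)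
    left_zero := fun x hx => rightProfile_of_le (neg_le_neg hx) }⟩

theorem IsNodalProfile.mul_eq_zero (h : IsNodalProfile p q V l c r s f g) (x : ℝ) :
    f x * g x = 0 := by
  rcases le_total x c with hx | hx
  · rw [h.right_zero x hx, zero_mul]
  · rw [h.left_zero x hx, mul_zero]

theorem IsNodalProfile.integral_mul_right_rpow (hp : 0 < p) (h : IsNodalProfile p q V l c r s f g)
    {d : ℝ → ℝ} (hd : Continuous d) (hc : -1 ≤ c) :
    ∫ x in (-1)..1, d x * f x ^ p = ∫ x in c..1, d x * f x ^ p := by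
  have hcont : Continuous fun x => d x * f x ^ p :=
    hd.mul (h.right.continuous.rpow_const fun _ => Or.inr hp.le)
  rw [← intervalIntegral.integral_add_adjacent_intervals (hcont.intervalIntegrable (-1) c)
    (hcont.intervalIntegrable c 1), add_eq_right]
  refine intervalIntegral.integral_zero_ae (ae_of_all _ fun x hx => ?_)
  rw [uIoc_of_le hc] at hx
  rw [h.right_zero x hx.2, Real.zero_rpow hp.ne', mul_zero]

theorem IsNodalProfile.integral_mul_left_rpow (hp : 0 < p) (h : IsNodalProfile p q V l c r s f g)
    {d : ℝ → ℝ} (hd : Continuous d) (hc : c ≤ 1) :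
    ∫ x in (-1)..1, d x * g x ^ p = ∫ x in (-1)..c, d x * g x ^ p := by
  have hcont : Continuous fun x => d x * g x ^ p :=
    hd.mul (h.left.continuous.rpow_const fun _ => Or.inr hp.le)
  rw [← intervalIntegral.integral_add_adjacent_intervals (hcont.intervalIntegrable (-1) c)
    (hcont.intervalIntegrable c 1), add_eq_left]
  refine intervalIntegral.integral_zero_ae (ae_of_all _ fun x hx => ?_)
  rw [uIoc_of_le hc] at hx
  rw [h.left_zero x hx.1.le, Real.zero_rpow hp.ne', mul_zero]

variable [hp : Fact (1 < p)]

theorem IsNodalRiccati.le_eigenvalue_one (hpq : p.HolderConjugate q) (hV : Continuous V)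
    (h : IsNodalRiccati p q α V l c r s) : l ≤ eigenvalue p α V 1 :=
  RobinGap.le_eigenvalue_one hV fun _ hu => mul_mass_le_energy_of_node hpq hV h.node_mem
    h.riccati_right h.right h.riccati_left h.left hu

theorem integral_mul_abs_evalAt_rpow (hf : ∀ x, 0 ≤ f x) {u : W1p p} {f' : ℝ → ℝ}
    (hu : IsRepresentedBy u f f') (d : ℝ → ℝ) :
    ∫ x in (-1)..1, d x * |evalAt u x| ^ p = ∫ x in (-1)..1, d x * f x ^ p := by
  refine intervalIntegral.integral_congr fun x hx => ?_
  rw [uIcc_of_le (by norm_num)] at hx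
  simp only [hu.evalAt_eq x hx, abs_of_nonneg (hf x)]

theorem energy_eq_sub_integral {W : ℝ → ℝ} (hV : Continuous V) (hW : Continuous W) (u : W1p p) :
    energy p α W u = energy p α V u - ∫ x in (-1)..1, (V x - W x) * |evalAt u x| ^ p := by
  rw [energy_eq hV, energy_eq hW, intervalIntegral.integral_of_le (by norm_num),
    integral_Ioc_eq_integral_Ioo]
  simp_rw [sub_mul]
  rw [integral_sub (integrableOn_mul_abs_evalAt_rpow hV u) (integrableOn_mul_abs_evalAt_rpow hW u)]
  ring

theorem energy_sub_mul_add_const {d : ℝ → ℝ} (hV : Continuous V) (hd : Continuous d)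
    {u : W1p p} (horth : ∫ x in (-1)..1, d x * |evalAt u x| ^ p = 0) (t m : ℝ) :
    energy p α (fun x => V x - (t * d x + m)) u = energy p α V u - m * mass p u := by
  have hup : Continuous fun x => |evalAt u x| ^ p :=
    (continuous_evalAt u).abs.rpow_const fun _ => Or.inr (by linarith [hp.out])
  have hdu : Continuous fun x => d x * |evalAt u x| ^ p := hd.mul hup
  have hW : Continuous fun x => V x - (t * d x + m) :=
    hV.sub ((hd.const_mul t).add continuous_const)
  rw [energy_eq_sub_integral hV hW]
  simp only [sub_sub_cancel, add_mul, mul_assoc]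
  rw [intervalIntegral.integral_add ((hdu.const_mul t).intervalIntegrable _ _)
    ((hup.const_mul m).intervalIntegrable _ _), intervalIntegral.integral_const_mul,
    intervalIntegral.integral_const_mul, horth, mul_zero, zero_add,
    intervalIntegral.integral_of_le (by norm_num), integral_Ioc_eq_integral_Ioo, mass]

theorem IsNodalRiccati.eigenvalue_one_sub_le (hpq : p.HolderConjugate q) (hV : Continuous V)
    (h : IsNodalRiccati p q α V l c r s) (hfg : IsNodalProfile p q V l c r s f g)
    {d : ℝ → ℝ} (hd : Continuous d) (hright : ∫ x in c..1, d x * f x ^ p = 0)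
    (hleft : ∫ x in (-1)..c, d x * g x ^ p = 0) (t m : ℝ) :
    eigenvalue p α (fun x => V x - (t * d x + m)) 1 ≤ l - m := by
  have hp0 := hpq.pos
  have hW : Continuous fun x => V x - (t * d x + m) :=
    hV.sub ((hd.const_mul t).add continuous_const)
  have hf1 : f (-1) = 0 := hfg.right_zero (-1) h.node_mem.1.le
  have hg1 : g 1 = 0 := hfg.left_zero 1 h.node_mem.2.le
  obtain ⟨u, hu⟩ := hfg.right.exists_isRepresentedBy (countable_singleton c)
  obtain ⟨w, hw⟩ := hfg.left.exists_isRepresentedBy (countable_singleton c)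
  have hu_energy : energy p α V u = l * mass p u :=
    hfg.right.energy_eq (countable_singleton c) hV
      (by rw [h.right, hf1, Real.zero_rpow hp0.ne']; ring) hu
  have hw_energy : energy p α V w = l * mass p w :=
    hfg.left.energy_eq (countable_singleton c) hV
      (by rw [h.left, hg1, Real.zero_rpow hp0.ne']; ring) hw
  have hu_orth : ∫ x in (-1)..1, d x * |evalAt u x| ^ p = 0 := by
    rw [integral_mul_abs_evalAt_rpow hfg.right.nonneg hu,
      hfg.integral_mul_right_rpow hp0 hd h.node_mem.1.le, hright]
  have hw_orth : ∫ x in (-1)..1, d x * |evalAt w x| ^ p = 0 := by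
    rw [integral_mul_abs_evalAt_rpow hfg.left.nonneg hw,
      hfg.integral_mul_left_rpow hp0 hd h.node_mem.2.le, hleft]
  refine eigenvalue_one_le hW (u := u) (v := w) (ne_zero_of_evalAt_pos (x := 1) ?_)
    (ne_zero_of_evalAt_pos (x := -1) ?_) (fun x hx => ?_) ?_ ?_ ?_
  · exact (hu.evalAt_eq 1 (by norm_num)).symm ▸ hfg.right_pos 1 h.node_mem.2
  · exact (hw.evalAt_eq (-1) (by norm_num)).symm ▸ hfg.left_pos (-1) h.node_mem.1
  · rw [hu.evalAt_eq x hx, hw.evalAt_eq x hx, hfg.mul_eq_zero]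
  · filter_upwards [hu.weakDeriv_eq, hw.weakDeriv_eq] with x hux hwx
    rw [hux, hwx, mul_mul_mul_comm, hfg.mul_eq_zero, mul_zero]
  · rw [energy_sub_mul_add_const hV hd hu_orth, hu_energy, sub_mul]
  · rw [energy_sub_mul_add_const hV hd hw_orth, hw_energy, sub_mul]

end NodalProfiles

/-! ### Monotonicity of the ratio of eigenfunctions -/

section Comparison

variable {p q α l₀ l₁ c : ℝ} {V r₀ r s v f g : ℝ → ℝ}

theorem IsRiccatiOn.lt_of_le {a b x : ℝ} (h₀ : IsRiccatiOn p q V l₀ r₀ (Icc a b))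
    (h₁ : IsRiccatiOn p q V l₁ r (Icc a b)) (hl : l₀ < l₁) (ha : r a ≤ r₀ a) (hx : x ∈ Ioc a b) :
    r x < r₀ x := by
  refine sub_neg.1 (neg_of_deriv_neg_at_zeros (z := fun y => r y - r₀ y)
    (fun y hy => (h₁ y hy).sub (h₀ y hy)) (fun y _ hy => ?_) (sub_nonpos.2 ha) hx)
  rw [sub_eq_zero.1 hy]
  linarith

theorem IsGroundRiccati.lt_right (h₀ : IsGroundRiccati p q α V l₀ r₀)
    (h₁ : IsNodalRiccati p q α V l₁ c r s) (hl : l₀ < l₁) {x : ℝ} (hx : x ∈ Ioo c 1) :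
    r₀ x < r x := by
  by_contra! hle
  have hlt : r 1 < r₀ 1 := IsRiccatiOn.lt_of_le
    (h₀.riccati.mono (Icc_subset_Icc_left (h₁.node_mem.1.trans hx.1).le))
    (h₁.riccati_right.mono fun y hy => ⟨hx.1.trans_le hy.1, hy.2⟩) hl hle ⟨hx.2, le_rfl⟩
  exact hlt.ne (h₁.right.trans h₀.right.symm)

theorem IsGroundRiccati.lt_left (h₀ : IsGroundRiccati p q α V l₀ r₀)
    (h₁ : IsNodalRiccati p q α V l₁ c r s) (hl : l₀ < l₁) {x : ℝ} (hx : x ∈ Ioo (-1) c) :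
    s x < r₀ x :=
  IsRiccatiOn.lt_of_le (h₀.riccati.mono (Icc_subset_Icc_right (hx.2.trans h₁.node_mem.2).le))
    (h₁.riccati_left.mono fun _ hy => ⟨hy.1, hy.2.trans_lt hx.2⟩) hl
    (h₁.left.trans h₀.left.symm).le ⟨hx.1, le_rfl⟩

theorem hasDerivAt_div_of_logDeriv {a b x : ℝ} (hf : HasDerivAt f (a * f x) x)
    (hv : HasDerivAt v (b * v x) x) (hvx : v x ≠ 0) :
    HasDerivAt (fun y => f y / v y) ((a - b) * (f x / v x)) x := by
  refine (hf.div hv hvx).congr_deriv ?_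
  field_simp

theorem IsNodalProfile.strictMonoOn_div (hpq : p.HolderConjugate q) (hl : l₀ < l₁)
    (h₀ : IsGroundRiccati p q α V l₀ r₀) (hv : IsProfile p q V l₀ r₀ v ∅) (hv0 : ∀ x, 0 < v x)
    (h₁ : IsNodalRiccati p q α V l₁ c r s) (hfg : IsNodalProfile p q V l₁ c r s f g) :
    StrictMonoOn (fun x => f x / v x) (Icc c 1) := by
  refine strictMonoOn_of_deriv_pos (convex_Icc _ _)
    (hfg.right.continuous.div hv.continuous fun x => (hv0 x).ne').continuousOn fun x hx => ?_
  rw [interior_Icc] at hx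
  have hxI : x ∈ Icc (-1 : ℝ) 1 := ⟨(h₁.node_mem.1.trans hx.1).le, hx.2.le⟩
  rw [(hasDerivAt_div_of_logDeriv (hfg.right.hasDerivAt x ⟨hxI, hx.1.ne'⟩)
    (hv.hasDerivAt x ⟨hxI, notMem_empty x⟩) (hv0 x).ne').deriv]
  exact mul_pos (sub_pos.2 (strictMono_spow hpq.symm.sub_one_pos (h₀.lt_right h₁ hl hx)))
    (div_pos (hfg.right_pos x hx.1) (hv0 x))

theorem IsNodalProfile.strictAntiOn_div (hpq : p.HolderConjugate q) (hl : l₀ < l₁)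
    (h₀ : IsGroundRiccati p q α V l₀ r₀) (hv : IsProfile p q V l₀ r₀ v ∅) (hv0 : ∀ x, 0 < v x)
    (h₁ : IsNodalRiccati p q α V l₁ c r s) (hfg : IsNodalProfile p q V l₁ c r s f g) :
    StrictAntiOn (fun x => g x / v x) (Icc (-1) c) := by
  refine strictAntiOn_of_deriv_neg (convex_Icc _ _)
    (hfg.left.continuous.div hv.continuous fun x => (hv0 x).ne').continuousOn fun x hx => ?_
  rw [interior_Icc] at hx
  have hxI : x ∈ Icc (-1 : ℝ) 1 := ⟨hx.1.le, (hx.2.trans h₁.node_mem.2).le⟩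
  rw [(hasDerivAt_div_of_logDeriv (hfg.left.hasDerivAt x ⟨hxI, hx.2.ne⟩)
    (hv.hasDerivAt x ⟨hxI, notMem_empty x⟩) (hv0 x).ne').deriv]
  exact mul_neg_of_neg_of_pos
    (sub_neg.2 (strictMono_spow hpq.symm.sub_one_pos (h₀.lt_left h₁ hl hx)))
    (div_pos (hfg.left_pos x hx.2) (hv0 x))

end Comparison

/-! ### Integrals of functions with a single sign change -/

section SingleCrossing

theorem exists_zero_of_integral_mul_eq_zero {d w : ℝ → ℝ} {a b : ℝ} (hab : a < b)
    (hd : Continuous d) (hw : Continuous w) (hpos : ∀ x ∈ Ioo a b, 0 < w x)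
    (h : ∫ x in a..b, d x * w x = 0) : ∃ x ∈ Ioo a b, d x = 0 := by
  have hdw : IntervalIntegrable (fun x => d x * w x) volume a b :=
    (hd.mul hw).intervalIntegrable _ _
  obtain ⟨x, hx, hdx⟩ : ∃ x ∈ Ioo a b, d x ≤ 0 := by
    by_contra! hcon
    exact (intervalIntegral.intervalIntegral_pos_of_pos_on hdw
      (fun x hx => mul_pos (hcon x hx) (hpos x hx)) hab).ne' h
  obtain ⟨y, hy, hdy⟩ : ∃ y ∈ Ioo a b, 0 ≤ d y := by
    by_contra! hcon
    refine (intervalIntegral.intervalIntegral_pos_of_pos_on hdw.neg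
      (fun x hx => neg_pos.2 (mul_neg_of_neg_of_pos (hcon x hx) (hpos x hx))) hab).ne' ?_
    simp only [Pi.neg_apply, intervalIntegral.integral_neg, h, neg_zero]
  exact isPreconnected_Ioo.intermediate_value hx hy hd.continuousOn ⟨hdx, hdy⟩

theorem mul_rpow_div_rpow_sub_rpow_pos {p d f v k : ℝ} (hp : 0 < p) (hf : 0 ≤ f) (hv : 0 < v)
    (hk : 0 < k) (h : 0 < d * (f / v - k)) : 0 < d * (f ^ p / k ^ p - v ^ p) := by
  rw [← Real.div_rpow hf hk.le]
  rcases pos_and_pos_or_neg_and_neg_of_mul_pos h with ⟨hd, hfv⟩ | ⟨hd, hfv⟩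
  · refine mul_pos hd (sub_pos.2 (Real.rpow_lt_rpow hv.le ?_ hp))
    rwa [lt_div_iff₀ hk, mul_comm, ← lt_div_iff₀ hv, ← sub_pos]
  · refine mul_pos_of_neg_of_neg hd (sub_neg.2 (Real.rpow_lt_rpow (div_nonneg hf hk.le) ?_ hp))
    rwa [div_lt_iff₀ hk, mul_comm, ← div_lt_iff₀ hv, ← sub_neg]

theorem mul_rpow_div_rpow_sub_rpow_nonneg {p d f v k : ℝ} (hp : 0 < p) (hf : 0 ≤ f) (hv : 0 < v)
    (hk : 0 < k) (h : d ≠ 0 → 0 < d * (f / v - k)) : 0 ≤ d * (f ^ p / k ^ p - v ^ p) := by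
  rcases eq_or_ne d 0 with rfl | hd
  · rw [zero_mul]
  · exact (mul_rpow_div_rpow_sub_rpow_pos hp hf hv hk (h hd)).le

variable {p : ℝ} {d f v : ℝ → ℝ} {a b k : ℝ}

theorem integral_mul_rpow_eq_neg_integral (hp : 0 ≤ p) (hd : Continuous d) (hf : Continuous f)
    (hv : Continuous v) (h : ∫ x in a..b, d x * f x ^ p = 0) (k : ℝ) :
    ∫ x in a..b, d x * v x ^ p = -∫ x in a..b, d x * (f x ^ p / k ^ p - v x ^ p) := by
  have hdf : Continuous fun x => d x * f x ^ p := hd.mul (hf.rpow_const fun _ => Or.inr hp)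
  have hdv : Continuous fun x => d x * v x ^ p := hd.mul (hv.rpow_const fun _ => Or.inr hp)
  simp_rw [mul_sub, ← mul_div_assoc]
  rw [intervalIntegral.integral_sub ((hdf.div_const _).intervalIntegrable _ _)
    (hdv.intervalIntegrable _ _), intervalIntegral.integral_div, h, zero_div, zero_sub, neg_neg]

theorem integral_mul_rpow_nonpos (hp : 0 < p) (hd : Continuous d) (hf : Continuous f)
    (hv : Continuous v) (hf0 : ∀ x, 0 ≤ f x) (hv0 : ∀ x, 0 < v x) (hk : 0 < k)
    (hcross : ∀ x ∈ Icc a b, d x ≠ 0 → 0 < d x * (f x / v x - k))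
    (h : ∫ x in a..b, d x * f x ^ p = 0) (hab : a ≤ b) : ∫ x in a..b, d x * v x ^ p ≤ 0 := by
  rw [integral_mul_rpow_eq_neg_integral hp.le hd hf hv h k, neg_nonpos]
  exact intervalIntegral.integral_nonneg hab fun x hx =>
    mul_rpow_div_rpow_sub_rpow_nonneg hp (hf0 x) (hv0 x) hk (hcross x hx)

theorem integral_mul_rpow_neg (hp : 0 < p) (hd : Continuous d) (hf : Continuous f)
    (hv : Continuous v) (hf0 : ∀ x, 0 ≤ f x) (hv0 : ∀ x, 0 < v x) (hk : 0 < k)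
    (hcross : ∀ x ∈ Icc a b, d x ≠ 0 → 0 < d x * (f x / v x - k))
    (h : ∫ x in a..b, d x * f x ^ p = 0) (hab : a < b) {x : ℝ} (hx : x ∈ Icc a b)
    (hdx : d x ≠ 0) : ∫ x in a..b, d x * v x ^ p < 0 := by
  rw [integral_mul_rpow_eq_neg_integral hp.le hd hf hv h k, neg_lt_zero]
  have hcont : Continuous fun x => d x * (f x ^ p / k ^ p - v x ^ p) :=
    hd.mul (((hf.rpow_const fun _ => Or.inr hp.le).div_const _).sub
      (hv.rpow_const fun _ => Or.inr hp.le))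
  exact intervalIntegral.integral_pos hab hcont.continuousOn
    (fun y hy => mul_rpow_div_rpow_sub_rpow_nonneg hp (hf0 y) (hv0 y) hk
      (hcross y (Ioc_subset_Icc_self hy)))
    ⟨x, hx, mul_rpow_div_rpow_sub_rpow_pos hp (hf0 x) (hv0 x) hk (hcross x hx hdx)⟩

end SingleCrossing

/-! ### Perturbation of the first eigenvalue -/

section Perturbation

variable {p q α l : ℝ} {V d r v : ℝ → ℝ}

/- The equation for `h` is the linearization at `r` of the Riccati equation with potential `V - D`;
`v ^ (-p)` is the homogeneous solution, and orthogonality to `v ^ p` makes `h` vanish at both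
ends. -/
theorem IsProfile.exists_linearized_riccati (hv : IsProfile p q V l r v ∅) (hv0 : ∀ x, 0 < v x)
    {D : ℝ → ℝ} (hD : Continuous D) (horth : ∫ x in (-1)..1, D x * v x ^ p = 0) :
    ∃ h : ℝ → ℝ, (∀ x ∈ Icc (-1 : ℝ) 1, HasDerivAt h (-D x - p * spow (q - 1) (r x) * h x) x) ∧
      h 1 = 0 ∧ h (-1) = 0 := by
  have hDv : Continuous fun x => D x * v x ^ p :=
    hD.mul (hv.continuous.rpow_const fun x => Or.inl (hv0 x).ne')
  refine ⟨fun x => -((∫ y in (-1)..x, D y * v y ^ p) * v x ^ (-p)), fun x hx => ?_, ?_, ?_⟩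
  · refine ((hDv.integral_hasStrictDerivAt (-1) x).hasDerivAt.mul
      ((hv.hasDerivAt x ⟨hx, notMem_empty x⟩).rpow_const (p := -p)
        (Or.inl (hv0 x).ne'))).neg.congr_deriv ?_
    have hcancel : v x ^ p * v x ^ (-p) = 1 := by
      rw [← Real.rpow_add (hv0 x), add_neg_cancel, Real.rpow_zero]
    have hshift : v x ^ (-p - 1) * v x = v x ^ (-p) := by
      rw [← Real.rpow_add_one (hv0 x).ne', sub_add_cancel]
    linear_combination -D x * hcancel
      + p * spow (q - 1) (r x) * (∫ y in (-1)..x, D y * v y ^ p) * hshift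
  · simp only [horth, zero_mul, neg_zero]
  · simp only [intervalIntegral.integral_same, zero_mul, neg_zero]

theorem eventually_mul_spow_sub_lt {e : ℝ} (he : 0 < e) {K : Set ℝ} (hK : IsCompact K)
    {h : ℝ → ℝ} (hr : ∀ x ∈ K, ContinuousAt r x) (hh : ∀ x ∈ K, ContinuousAt h x) (C : ℝ) {ε : ℝ}
    (hε : 0 < ε) : ∀ᶠ t in 𝓝 (0 : ℝ), ∀ x ∈ K,
      C * (h x * (spow e (r x + t * h x) - spow e (r x))) < ε := by
  refine hK.eventually_forall_of_forall_eventually fun y hy => ?_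
  have hry : ContinuousAt (fun z : ℝ × ℝ => r z.2) (0, y) :=
    (hr y hy).comp_of_eq continuousAt_snd rfl
  have hhy : ContinuousAt (fun z : ℝ × ℝ => h z.2) (0, y) :=
    (hh y hy).comp_of_eq continuousAt_snd rfl
  have hspow := continuous_spow he
  have hcont : ContinuousAt (fun z : ℝ × ℝ =>
      C * (h z.2 * (spow e (r z.2 + z.1 * h z.2) - spow e (r z.2)))) (0, y) :=
    continuousAt_const.mul (hhy.mul ((hspow.continuousAt.comp
      (hry.add (continuousAt_fst.mul hhy))).sub (hspow.continuousAt.comp hry)))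
  refine hcont.eventually (gt_mem_nhds ?_)
  simpa only [zero_mul, add_zero, sub_self, mul_zero] using hε

theorem sub_one_mul_abs_rpow_sub_le (hpq : p.HolderConjugate q) (a b : ℝ) :
    (p - 1) * (|b| ^ q - |a| ^ q) ≤ p * (spow (q - 1) b * (b - a)) :=
  calc (p - 1) * (|b| ^ q - |a| ^ q) ≤ (p - 1) * (q * spow (q - 1) b * (b - a)) :=
        mul_le_mul_of_nonneg_left (abs_rpow_sub_le hpq.symm.lt a b) hpq.sub_one_pos.le
    _ = (p - 1) * q * (spow (q - 1) b * (b - a)) := by ring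
    _ = p * (spow (q - 1) b * (b - a)) := by rw [hpq.sub_one_mul_conj]

theorem exists_pos_integral_add_mul_eq_zero {w : ℝ → ℝ} (hd : Continuous d) (hw : Continuous w)
    (hw0 : ∀ x, 0 < w x) {a b : ℝ} (hab : a < b) (hneg : ∫ x in a..b, d x * w x < 0) :
    ∃ k > 0, ∫ x in a..b, (d x + k) * w x = 0 := by
  have hI : 0 < ∫ x in a..b, w x := intervalIntegral.intervalIntegral_pos_of_pos
    (hw.intervalIntegrable _ _) hw0 hab
  have hdw : Continuous fun x => d x * w x := hd.mul hw
  refine ⟨-(∫ x in a..b, d x * w x) / ∫ x in a..b, w x, div_pos (neg_pos.2 hneg) hI, ?_⟩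
  simp_rw [add_mul]
  rw [intervalIntegral.integral_add (hdw.intervalIntegrable _ _)
    ((hw.const_mul _).intervalIntegrable _ _), intervalIntegral.integral_const_mul,
    div_mul_cancel₀ _ hI.ne', add_neg_cancel]

theorem IsGroundRiccati.exists_le_eigenvalue_zero_sub [Fact (1 < p)] (hpq : p.HolderConjugate q)
    (hV : Continuous V) (hr : IsGroundRiccati p q α V l r) (hv : IsProfile p q V l r v ∅)
    (hv0 : ∀ x, 0 < v x) (hd : Continuous d) (hneg : ∫ x in (-1)..1, d x * v x ^ p < 0) :
    ∃ η > 0, ∀ᶠ t in 𝓝[>] (0 : ℝ), ∀ m : ℝ,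
      l + t * η - m ≤ eigenvalue p α (fun x => V x - (t * d x + m)) 0 := by
  obtain ⟨k, hk, horth⟩ := exists_pos_integral_add_mul_eq_zero hd
    (hv.continuous.rpow_const fun x => Or.inl (hv0 x).ne')
    (fun x => Real.rpow_pos_of_pos (hv0 x) p) (by norm_num) hneg
  obtain ⟨h, hh, h_right, h_left⟩ :=
    hv.exists_linearized_riccati hv0 (D := fun x => d x + k) (hd.add continuous_const) horth
  have hr_cont := hr.riccati.continuousOn
  have hh_cont : ContinuousOn h (Icc (-1) 1) := HasDerivAt.continuousOn hh
  have hspow := continuous_spow hpq.symm.sub_one_pos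
  have hsmall := eventually_mul_spow_sub_lt hpq.symm.sub_one_pos isCompact_Icc
    (fun x hx => (hr.riccati x hx).continuousAt) (fun x hx => (hh x hx).continuousAt) p
    (half_pos hk)
  refine ⟨k / 2, half_pos hk, ?_⟩
  filter_upwards [mem_nhdsWithin_of_mem_nhds hsmall, self_mem_nhdsWithin] with t ht (ht0 : 0 < t) m
  have hW : Continuous fun x => V x - (t * d x + m) :=
    hV.sub ((hd.const_mul t).add continuous_const)
  refine le_eigenvalue_zero hW (mul_mass_le_energy_of_subsolution hpq hW
    (r := fun x => r x + t * h x) (fun x hx => (hr.riccati x hx).add ((hh x hx).const_mul t))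
    ?_ (fun x hx => ?_) ?_ ?_)
  · exact (hr.riccati.continuousOn_deriv hpq.symm.nonneg hV.continuousOn).add
      (continuousOn_const.mul ((hd.add continuous_const).neg.continuousOn.sub
        ((continuousOn_const.mul (hspow.comp_continuousOn hr_cont)).mul hh_cont)))
  · have hconvex := sub_one_mul_abs_rpow_sub_le hpq (r x) (r x + t * h x)
    have herror := mul_lt_mul_of_pos_left (ht x hx) ht0
    rw [add_sub_cancel_left] at hconvex
    linarith
  · rw [h_right, hr.right, mul_zero, add_zero]
  · rw [h_left, hr.left, mul_zero, add_zero]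

end Perturbation

/-! ### Decreasing the gap of a convex potential -/

section AffineOrthogonality

variable {V w : ℝ → ℝ} {a b c : ℝ}

theorem integral_sub_affine_mul (hV : Continuous V) (hw : Continuous w) (a b k m : ℝ) :
    ∫ x in a..b, (V x - (k * x + m)) * w x
      = (∫ x in a..b, V x * w x) - k * (∫ x in a..b, x * w x) - m * ∫ x in a..b, w x := by
  have hVw : Continuous fun x => V x * w x := hV.mul hw
  have hidw : Continuous fun x => k * (x * w x) := (continuous_id.mul hw).const_mul k
  have hsum : Continuous fun x => k * (x * w x) + m * w x := hidw.add (hw.const_mul m)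
  simp_rw [sub_mul, add_mul, mul_assoc]
  rw [intervalIntegral.integral_sub (hVw.intervalIntegrable _ _) (hsum.intervalIntegrable _ _),
    intervalIntegral.integral_add (hidw.intervalIntegrable _ _)
      ((hw.const_mul m).intervalIntegrable _ _), intervalIntegral.integral_const_mul,
    intervalIntegral.integral_const_mul, sub_sub]

theorem integral_id_mul_mem_Ioo (hab : a < b) (hw : Continuous w)
    (hpos : ∀ x ∈ Ioo a b, 0 < w x) :
    ∫ x in a..b, x * w x ∈ Ioo (a * ∫ x in a..b, w x) (b * ∫ x in a..b, w x) := by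
  have hidw : Continuous fun x => x * w x := continuous_id.mul hw
  have hshift : ∀ k : ℝ, ∫ x in a..b, (x - k) * w x
      = (∫ x in a..b, x * w x) - k * ∫ x in a..b, w x := fun k => by
    simp_rw [sub_mul]
    rw [intervalIntegral.integral_sub (hidw.intervalIntegrable _ _)
      ((hw.const_mul k).intervalIntegrable _ _), intervalIntegral.integral_const_mul]
  have hint : ∀ k : ℝ, IntervalIntegrable (fun x => (x - k) * w x) volume a b := fun k =>
    ((continuous_id.sub continuous_const).mul hw).intervalIntegrable _ _
  constructor
  · rw [← sub_pos, ← hshift]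
    exact intervalIntegral.intervalIntegral_pos_of_pos_on (hint a)
      (fun x hx => mul_pos (sub_pos.2 hx.1) (hpos x hx)) hab
  · rw [← sub_neg, ← hshift, ← neg_pos, ← intervalIntegral.integral_neg]
    exact intervalIntegral.intervalIntegral_pos_of_pos_on (hint b).neg
      (fun x hx => neg_pos.2 (mul_neg_of_neg_of_pos (sub_neg.2 hx.2) (hpos x hx))) hab

theorem exists_affine_orthogonal {w' : ℝ → ℝ} (hac : a < c) (hcb : c < b) (hV : Continuous V)
    (hw : Continuous w) (hw' : Continuous w') (hpos : ∀ x ∈ Ioo c b, 0 < w x)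
    (hpos' : ∀ x ∈ Ioo a c, 0 < w' x) :
    ∃ κ m : ℝ, (∫ x in c..b, (V x - (κ * x + m)) * w x = 0) ∧
      ∫ x in a..c, (V x - (κ * x + m)) * w' x = 0 := by
  have hmass : 0 < ∫ x in c..b, w x := intervalIntegral.intervalIntegral_pos_of_pos_on
    (hw.intervalIntegrable _ _) hpos hcb
  have hmass' : 0 < ∫ x in a..c, w' x := intervalIntegral.intervalIntegral_pos_of_pos_on
    (hw'.intervalIntegrable _ _) hpos' hac
  have hdet : 0 < (∫ x in c..b, x * w x) * (∫ x in a..c, w' x)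
      - (∫ x in a..c, x * w' x) * ∫ x in c..b, w x := by
    have h := mul_lt_mul_of_pos_right (integral_id_mul_mem_Ioo hcb hw hpos).1 hmass'
    have h' := mul_lt_mul_of_pos_right (integral_id_mul_mem_Ioo hac hw' hpos').2 hmass
    linarith
  set D := (∫ x in c..b, x * w x) * (∫ x in a..c, w' x)
    - (∫ x in a..c, x * w' x) * ∫ x in c..b, w x with hD
  refine ⟨((∫ x in c..b, V x * w x) * (∫ x in a..c, w' x)
      - (∫ x in a..c, V x * w' x) * ∫ x in c..b, w x) / D,
    ((∫ x in c..b, x * w x) * (∫ x in a..c, V x * w' x)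
      - (∫ x in a..c, x * w' x) * ∫ x in c..b, V x * w x) / D, ?_, ?_⟩
  · rw [integral_sub_affine_mul hV hw]
    field_simp
    rw [hD]
    ring
  · rw [integral_sub_affine_mul hV hw']
    field_simp
    rw [hD]
    ring

end AffineOrthogonality

section SignChange

variable {d : ℝ → ℝ} {a b x : ℝ}

theorem convexOn_sub_affine {s : Set ℝ} (hd : ConvexOn ℝ s d) (k m : ℝ) :
    ConvexOn ℝ s fun x => d x - (k * x + m) := by
  refine hd.sub ⟨hd.1, fun x _ y _ a b _ _ hab => le_of_eq ?_⟩
  simp only [smul_eq_mul]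
  linear_combination m * hab

theorem mul_sub_mul_sub_pos_of_convexOn {s : Set ℝ} (hd : ConvexOn ℝ s d) (ha : a ∈ s) (hb : b ∈ s)
    (hab : a < b) (hda : d a = 0) (hdb : d b = 0) (hx : x ∈ s) (hdx : d x ≠ 0) :
    0 < d x * (x - b) * (x - a) := by
  rcases lt_trichotomy x a with hxa | rfl | hax
  · have h := hd.secant_mono_aux1 hx hb hxa hab
    rw [hda, hdb, mul_zero, mul_zero, add_zero] at h
    have hpos : 0 < d x := (nonneg_of_mul_nonneg_right h (sub_pos.2 hab)).lt_of_ne' hdx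
    exact mul_pos_of_neg_of_neg (mul_neg_of_pos_of_neg hpos (sub_neg.2 (hxa.trans hab)))
      (sub_neg.2 hxa)
  · exact absurd hda hdx
  rcases lt_trichotomy x b with hxb | rfl | hbx
  · have h := hd.le_max_of_mem_Icc ha hb ⟨hax.le, hxb.le⟩
    rw [hda, hdb, max_self] at h
    exact mul_pos (mul_pos_of_neg_of_neg (h.lt_of_ne hdx) (sub_neg.2 hxb)) (sub_pos.2 hax)
  · exact absurd hdb hdx
  · have h := hd.secant_mono_aux1 ha hx hab hbx
    rw [hda, hdb, mul_zero, mul_zero, zero_add] at h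
    have hpos : 0 < d x := (nonneg_of_mul_nonneg_right h (sub_pos.2 hab)).lt_of_ne' hdx
    exact mul_pos (mul_pos hpos (sub_pos.2 hbx)) (sub_pos.2 hax)

theorem mul_sub_right_pos_of_convexOn {s : Set ℝ} (hd : ConvexOn ℝ s d) (ha : a ∈ s) (hb : b ∈ s)
    (hab : a < b) (hda : d a = 0) (hdb : d b = 0) (hx : x ∈ s) (hax : a < x) (hdx : d x ≠ 0) :
    0 < d x * (x - b) :=
  pos_of_mul_pos_left (mul_sub_mul_sub_pos_of_convexOn hd ha hb hab hda hdb hx hdx)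
    (sub_pos.2 hax).le

theorem neg_mul_sub_left_pos_of_convexOn {s : Set ℝ} (hd : ConvexOn ℝ s d) (ha : a ∈ s)
    (hb : b ∈ s) (hab : a < b) (hda : d a = 0) (hdb : d b = 0) (hx : x ∈ s) (hxb : x < b)
    (hdx : d x ≠ 0) : 0 < -d x * (x - a) :=
  pos_of_mul_pos_left (b := b - x)
    (by linarith [mul_sub_mul_sub_pos_of_convexOn hd ha hb hab hda hdb hx hdx]) (sub_pos.2 hxb).le

theorem mul_sub_pos_of_strictMonoOn {φ : ℝ → ℝ} {s : Set ℝ} (hφ : StrictMonoOn φ s) (hx : x ∈ s)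
    (ha : a ∈ s) {y : ℝ} (h : 0 < y * (x - a)) : 0 < y * (φ x - φ a) := by
  rcases pos_and_pos_or_neg_and_neg_of_mul_pos h with ⟨hy, hxa⟩ | ⟨hy, hxa⟩
  · exact mul_pos hy (sub_pos.2 (hφ ha hx (sub_pos.1 hxa)))
  · exact mul_pos_of_neg_of_neg hy (sub_neg.2 (hφ hx ha (sub_neg.1 hxa)))

end SignChange

section GapDecrease

variable {p q α l₀ l₁ c a b : ℝ} {V r₀ r s v f g d : ℝ → ℝ}

/- On either side of the node, `d` changes sign exactly where the monotone ratio of the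
eigenfunctions crosses its value at the zero of `d`, so orthogonality to the nodal eigenfunction
forces a negative integral against the ground state. -/
theorem IsNodalProfile.integral_mul_rpow_neg (hpq : p.HolderConjugate q) (hl : l₀ < l₁)
    (h₀ : IsGroundRiccati p q α V l₀ r₀) (hv : IsProfile p q V l₀ r₀ v ∅) (hv0 : ∀ x, 0 < v x)
    (h₁ : IsNodalRiccati p q α V l₁ c r s) (hfg : IsNodalProfile p q V l₁ c r s f g)
    (hd : Continuous d) (hconv : ConvexOn ℝ (Icc (-1) 1) d)
    (hright : ∫ x in c..1, d x * f x ^ p = 0) (hleft : ∫ x in (-1)..c, d x * g x ^ p = 0)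
    (ha : a ∈ Ioo (-1) c) (hda : d a = 0) (hb : b ∈ Ioo c 1) (hdb : d b = 0)
    (hne : ∃ x ∈ Icc (-1 : ℝ) 1, d x ≠ 0) : ∫ x in (-1)..1, d x * v x ^ p < 0 := by
  have hc := h₁.node_mem
  have haI : a ∈ Icc (-1 : ℝ) 1 := ⟨ha.1.le, (ha.2.trans hc.2).le⟩
  have hbI : b ∈ Icc (-1 : ℝ) 1 := ⟨(hc.1.trans hb.1).le, hb.2.le⟩
  have hab := ha.2.trans hb.1
  have hcross_right : ∀ x ∈ Icc c 1, d x ≠ 0 → 0 < d x * (f x / v x - f b / v b) :=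
    fun x hx hdx => mul_sub_pos_of_strictMonoOn (hfg.strictMonoOn_div hpq hl h₀ hv hv0 h₁) hx
      ⟨hb.1.le, hb.2.le⟩ (mul_sub_right_pos_of_convexOn hconv haI hbI hab hda hdb
        ⟨hc.1.le.trans hx.1, hx.2⟩ (ha.2.trans_le hx.1) hdx)
  have hcross_left : ∀ x ∈ Icc (-1) c, d x ≠ 0 → 0 < d x * (g x / v x - g a / v a) :=
    fun x hx hdx => by
      linarith [mul_sub_pos_of_strictMonoOn (hfg.strictAntiOn_div hpq hl h₀ hv hv0 h₁).neg hx
        ⟨ha.1.le, ha.2.le⟩ (neg_mul_sub_left_pos_of_convexOn hconv haI hbI hab hda hdb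
          ⟨hx.1, hx.2.trans hc.2.le⟩ (hx.2.trans_lt hb.1) hdx)]
  have hfb := div_pos (hfg.right_pos b hb.1) (hv0 b)
  have hga := div_pos (hfg.left_pos a ha.2) (hv0 a)
  have hdv : Continuous fun x => d x * v x ^ p :=
    hd.mul (hv.continuous.rpow_const fun x => Or.inl (hv0 x).ne')
  rw [← intervalIntegral.integral_add_adjacent_intervals (hdv.intervalIntegrable (-1) c)
    (hdv.intervalIntegrable c 1)]
  obtain ⟨x, hx, hdx⟩ := hne
  rcases le_total x c with hxc | hcx
  · exact add_neg_of_neg_of_nonpos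
      (RobinGap.integral_mul_rpow_neg hpq.pos hd hfg.left.continuous hv.continuous hfg.left.nonneg
        hv0 hga hcross_left hleft hc.1 ⟨hx.1, hxc⟩ hdx)
      (integral_mul_rpow_nonpos hpq.pos hd hfg.right.continuous hv.continuous hfg.right.nonneg
        hv0 hfb hcross_right hright hc.2.le)
  · exact add_neg_of_nonpos_of_neg
      (integral_mul_rpow_nonpos hpq.pos hd hfg.left.continuous hv.continuous hfg.left.nonneg
        hv0 hga hcross_left hleft hc.1.le)
      (RobinGap.integral_mul_rpow_neg hpq.pos hd hfg.right.continuous hv.continuous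
        hfg.right.nonneg hv0 hfb hcross_right hright hc.2 ⟨hcx, hx.2⟩ hdx)

theorem IsNodalProfile.exists_affine_orthogonal (hp : 0 < p) (hV : Continuous V)
    (h₁ : IsNodalRiccati p q α V l₁ c r s) (hfg : IsNodalProfile p q V l₁ c r s f g) :
    ∃ κ m : ℝ, (∃ a ∈ Ioo (-1) c, V a - (κ * a + m) = 0) ∧
      (∃ b ∈ Ioo c 1, V b - (κ * b + m) = 0) ∧
      (∫ x in c..1, (V x - (κ * x + m)) * f x ^ p = 0) ∧
      ∫ x in (-1)..c, (V x - (κ * x + m)) * g x ^ p = 0 := by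
  have hc := h₁.node_mem
  have hfp : Continuous fun x => f x ^ p :=
    hfg.right.continuous.rpow_const fun _ => Or.inr hp.le
  have hgp : Continuous fun x => g x ^ p :=
    hfg.left.continuous.rpow_const fun _ => Or.inr hp.le
  have hfpos : ∀ x ∈ Ioo c 1, 0 < f x ^ p := fun x hx =>
    Real.rpow_pos_of_pos (hfg.right_pos x hx.1) p
  have hgpos : ∀ x ∈ Ioo (-1) c, 0 < g x ^ p := fun x hx =>
    Real.rpow_pos_of_pos (hfg.left_pos x hx.2) p
  obtain ⟨κ, m, hright, hleft⟩ :=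
    RobinGap.exists_affine_orthogonal hc.1 hc.2 hV hfp hgp hfpos hgpos
  have hd : Continuous fun x => V x - (κ * x + m) := by fun_prop
  exact ⟨κ, m, exists_zero_of_integral_mul_eq_zero hc.1 hd hgp hgpos hleft,
    exists_zero_of_integral_mul_eq_zero hc.2 hd hfp hfpos hright, hright, hleft⟩

theorem exists_secant_gap_lt [hp : Fact (1 < p)] (α : ℝ) (hV : Continuous V)
    (hconv : ConvexOn ℝ (Icc (-1) 1) V)
    (haff : ¬ ∃ a b : ℝ, ∀ x ∈ Icc (-1 : ℝ) 1, V x = a * x + b) :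
    ∃ κ : ℝ, (∃ a ∈ Icc (-1 : ℝ) 1, ∃ b ∈ Icc (-1 : ℝ) 1, a < b ∧ V b - V a = κ * (b - a)) ∧
      ∃ t ∈ Ioo (0 : ℝ) 1, gap p α (fun x => (1 - t) * V x + t * (κ * x)) < gap p α V := by
  have hpq := Real.HolderConjugate.conjExponent hp.out
  obtain ⟨l₀, l₁, c, r₀, r, s, hl, h₀, h₁⟩ := exists_isGroundRiccati_isNodalRiccati hpq hV α
  obtain ⟨v, hv0, hv⟩ := h₀.riccati.exists_isProfile hpq
  obtain ⟨f, g, hfg⟩ := h₁.exists_isNodalProfile hpq hV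
  have hc := h₁.node_mem
  obtain ⟨κ, m, ⟨a, ha, hda⟩, ⟨b, hb, hdb⟩, hright, hleft⟩ :=
    hfg.exists_affine_orthogonal hpq.pos hV h₁
  have hd : Continuous fun x => V x - (κ * x + m) := by fun_prop
  have hne : ∃ x ∈ Icc (-1 : ℝ) 1, V x - (κ * x + m) ≠ 0 := by
    by_contra! h
    exact haff ⟨κ, m, fun x hx => sub_eq_zero.1 (h x hx)⟩
  refine ⟨κ, ⟨a, ⟨ha.1.le, (ha.2.trans hc.2).le⟩, b, ⟨(hc.1.trans hb.1).le, hb.2.le⟩,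
    ha.2.trans hb.1, by linarith⟩, ?_⟩
  obtain ⟨η, hη, hlower⟩ := h₀.exists_le_eigenvalue_zero_sub hpq hV hv hv0 hd
    (hfg.integral_mul_rpow_neg hpq hl h₀ hv hv0 h₁ hd (convexOn_sub_affine hconv κ m)
      hright hleft ha hda hb hdb hne)
  obtain ⟨t, ht, htI⟩ := (hlower.and (Ioo_mem_nhdsGT (zero_lt_one' ℝ))).exists
  have hW : (fun x => (1 - t) * V x + t * (κ * x))
      = fun x => V x - (t * (V x - (κ * x + m)) + t * m) := by
    funext x
    ring
  refine ⟨t, htI, ?_⟩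
  rw [hW, gap, gap]
  linarith [ht (t * m), h₁.eigenvalue_one_sub_le hpq hV hfg hd hright hleft t (t * m),
    h₀.eigenvalue_zero_le hpq hV, h₁.le_eigenvalue_one hpq hV, mul_pos htI.1 hη]

end GapDecrease

/-! ### Minimizing the gap over segments from a convex to a linear potential -/

section Segments

variable {p α : ℝ} {V : ℝ → ℝ} {K : ℝ≥0}

theorem convexOn_mul_add_linear {s : Set ℝ} (hV : ConvexOn ℝ s V) {t : ℝ} (ht : 0 ≤ t) (a : ℝ) :
    ConvexOn ℝ s fun x => t * V x + a * x :=
  (hV.smul ht).add ((LinearMap.mulLeft ℝ a).convexOn hV.1)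

theorem continuous_gap_mul_add_linear [Fact (1 < p)] (α : ℝ) (hV : Continuous V) :
    Continuous fun z : ℝ × ℝ => gap p α fun x => z.1 * V x + z.2 * x := by
  obtain ⟨M, hM⟩ := isCompact_Icc.exists_bound_of_continuousOn (hV.continuousOn (s := Icc (-1) 1))
  have hle : ∀ z z' : ℝ × ℝ, ∀ x ∈ Icc (-1 : ℝ) 1,
      z.1 * V x + z.2 * x ≤ z'.1 * V x + z'.2 * x + (M + 1) * dist z z' := by
    intro z z' x hx
    have hfst : (z.1 - z'.1) * V x ≤ dist z z' * M := by
      refine (le_abs_self _).trans ?_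
      rw [abs_mul]
      exact mul_le_mul (le_max_left _ _) (hM x hx) (abs_nonneg _) dist_nonneg
    have hsnd : (z.2 - z'.2) * x ≤ dist z z' * 1 := by
      refine (le_abs_self _).trans ?_
      rw [abs_mul]
      exact mul_le_mul (le_max_right _ _) (abs_le.2 hx) (abs_nonneg _) dist_nonneg
    linarith
  refine (LipschitzWith.of_le_add_mul' (2 * (M + 1)) fun z z' => ?_).continuous
  have h := gap_le_add (p := p) (α := α) (by fun_prop) (by fun_prop) (hle z z') (hle z' z)
  rw [dist_comm z' z] at h
  linarith

theorem gap_linear_le_of_affine [Fact (1 < p)] (hV : Continuous V) {a b : ℝ}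
    (h : ∀ x ∈ Icc (-1 : ℝ) 1, V x = a * x + b) : gap p α (fun x => a * x) ≤ gap p α V := by
  have := gap_le_add (p := p) (α := α) (V := fun x => a * x) (b := -b) (continuous_const_mul a) hV
    (fun x hx => by linarith [h x hx]) (fun x hx => (h x hx).le)
  linarith

theorem exists_gap_mul_add_linear_lt [Fact (1 < p)] (α : ℝ) (hV : Continuous V)
    (hconv : ConvexOn ℝ (Icc (-1) 1) V)
    (haff : ¬ ∃ a b : ℝ, ∀ x ∈ Icc (-1 : ℝ) 1, V x = a * x + b)
    (hlip : LipschitzOnWith K V (Icc (-1) 1)) {t : ℝ} (ht : 0 < t) (a : ℝ) :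
    ∃ κ : ℝ, |κ - a| ≤ t * K ∧ ∃ s ∈ Ioo (0 : ℝ) 1,
      gap p α (fun x => (1 - s) * t * V x + ((1 - s) * a + s * κ) * x)
        < gap p α fun x => t * V x + a * x := by
  obtain ⟨κ, ⟨x, hx, y, hy, hxy, hκ⟩, s, hs, hlt⟩ := exists_secant_gap_lt (p := p) α
    (V := fun x => t * V x + a * x) (by fun_prop) (convexOn_mul_add_linear hconv ht.le a) (by
      rintro ⟨a', b, h⟩
      refine haff ⟨(a' - a) / t, b / t, fun x hx => ?_⟩
      have := h x hx
      field_simp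
      linarith)
  refine ⟨κ, ?_, s, hs, (congrArg (gap p α) (funext fun x => ?_)).trans_lt hlt⟩
  · have hslope : (κ - a) * (y - x) = t * (V y - V x) := by linarith
    refine le_of_mul_le_mul_right ?_ (sub_pos.2 hxy)
    calc |κ - a| * (y - x) = |(κ - a) * (y - x)| := by rw [abs_mul, abs_of_pos (sub_pos.2 hxy)]
      _ = t * |V y - V x| := by rw [hslope, abs_mul, abs_of_pos ht]
      _ ≤ t * (K * |y - x|) := mul_le_mul_of_nonneg_left (hlip.dist_le_mul y hy x hx) ht.le
      _ = t * K * (y - x) := by rw [abs_of_pos (sub_pos.2 hxy), mul_assoc]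
  · ring

theorem isCompact_setOf_abs_le_mul_one_sub (K : ℝ≥0) :
    IsCompact {z : ℝ × ℝ | z.1 ∈ Icc (0 : ℝ) 1 ∧ |z.2| ≤ K * (1 - z.1)} := by
  have hclosed : IsClosed {z : ℝ × ℝ | |z.2| ≤ K * (1 - z.1)} :=
    isClosed_le (by fun_prop) (by fun_prop)
  have hcompact : IsCompact (Icc (0 : ℝ) 1 ×ˢ Icc (-K : ℝ) K) := isCompact_Icc.prod isCompact_Icc
  refine hcompact.of_isClosed_subset ((isClosed_Icc.preimage continuous_fst).inter hclosed) ?_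
  rintro ⟨t, a⟩ ⟨ht, ha⟩
  exact ⟨ht, abs_le.1 (ha.trans (mul_le_of_le_one_right K.2 (sub_le_self 1 ht.1)))⟩

/- Minimize the gap of `t V + a x` over the pairs `(t, a)` reachable from `(1, 0)` by successive
replacements of a part of the potential by a secant. The gap can still be decreased wherever
`t > 0`, so the minimum is attained at a linear potential. -/
theorem exists_gap_linear_le [Fact (1 < p)] (α : ℝ) (hV : Continuous V)
    (hconv : ConvexOn ℝ (Icc (-1) 1) V) (hlip : LipschitzOnWith K V (Icc (-1) 1)) :
    ∃ a : ℝ, gap p α (fun x => a * x) ≤ gap p α V := by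
  by_cases haff : ∃ a b : ℝ, ∀ x ∈ Icc (-1 : ℝ) 1, V x = a * x + b
  · obtain ⟨a, b, h⟩ := haff
    exact ⟨a, gap_linear_le_of_affine hV h⟩
  have hstart : ((1 : ℝ), (0 : ℝ)) ∈
      {z : ℝ × ℝ | z.1 ∈ Icc (0 : ℝ) 1 ∧ |z.2| ≤ K * (1 - z.1)} := by simp
  obtain ⟨⟨t, a⟩, ⟨⟨ht0, ht1⟩, ha⟩, hmin⟩ := (isCompact_setOf_abs_le_mul_one_sub K).exists_isMinOn
    ⟨_, hstart⟩ (continuous_gap_mul_add_linear (p := p) α hV).continuousOn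
  rw [isMinOn_iff] at hmin
  dsimp only at ht0 ht1 ha hmin
  rcases ht0.eq_or_lt with rfl | ht0
  · have hle := hmin _ hstart
    simp only [zero_mul, one_mul, zero_add, add_zero] at hle
    exact ⟨a, hle⟩
  obtain ⟨κ, hκ, s, hs, hlt⟩ := exists_gap_mul_add_linear_lt (p := p) α hV hconv haff hlip ht0 a
  refine absurd (hmin ((1 - s) * t, (1 - s) * a + s * κ) ⟨⟨?_, ?_⟩, ?_⟩) hlt.not_ge
  · exact mul_nonneg (sub_nonneg.2 hs.2.le) ht0.le
  · exact mul_le_one₀ (sub_le_self 1 hs.1.le) ht0.le ht1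
  · calc |(1 - s) * a + s * κ| = |a + s * (κ - a)| := by ring_nf
      _ ≤ |a| + s * |κ - a| := by
        rw [← abs_of_pos hs.1, ← abs_mul, abs_of_pos hs.1]
        exact abs_add_le _ _
      _ ≤ K * (1 - t) + s * (t * K) := add_le_add ha (mul_le_mul_of_nonneg_left hκ hs.1.le)
      _ = K * (1 - (1 - s) * t) := by ring

end Segments

section Dilation

variable {p : ℝ} {V : ℝ → ℝ}

theorem eventually_abs_comp_mul_sub_lt {s : Set ℝ} (hs : IsCompact s) (hV : Continuous V) {ε : ℝ}
    (hε : 0 < ε) : ∀ᶠ ρ in 𝓝 (1 : ℝ), ∀ x ∈ s, |V (ρ * x) - V x| < ε := by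
  refine hs.eventually_forall_of_forall_eventually fun x _ => ?_
  have hcont : Continuous fun z : ℝ × ℝ => |V (z.1 * z.2) - V z.2| := by fun_prop
  exact hcont.continuousAt.eventually_lt continuousAt_const (by simpa using hε)

theorem exists_lipschitzOnWith_comp_mul (hV : Continuous V) (hconv : ConvexOn ℝ (Icc (-1) 1) V)
    {ρ : ℝ} (hρ : ρ ∈ Ioo (0 : ℝ) 1) :
    ∃ K, LipschitzOnWith K (fun x => V (ρ * x)) (Icc (-1) 1) := by
  have hball : Metric.ball (0 : ℝ) 1 ⊆ Icc (-1) 1 := by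
    rw [Real.ball_zero_eq_Ioo]
    exact Ioo_subset_Icc_self
  obtain ⟨ρ', hρ', hρ'1⟩ := exists_between hρ.2
  obtain ⟨K, hK⟩ := (hconv.subset hball (convex_ball 0 1)).exists_lipschitzOnWith_of_isBounded
    hρ'1 ((isCompact_Icc.image hV).isBounded.subset (image_mono hball))
  refine ⟨_, hK.comp (f := (ρ * ·)) (lipschitzWith_smul ρ).lipschitzOnWith fun x hx => ?_⟩
  rw [mem_ball_zero_iff, Real.norm_eq_abs, abs_mul, abs_of_pos hρ.1]
  exact (mul_le_of_le_one_right hρ.1.le (abs_le.2 hx)).trans_lt hρ'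

theorem convexOn_comp_mul (hconv : ConvexOn ℝ (Icc (-1) 1) V) {ρ : ℝ} (hρ : ρ ∈ Icc (0 : ℝ) 1) :
    ConvexOn ℝ (Icc (-1) 1) fun x => V (ρ * x) :=
  (hconv.comp_linearMap (LinearMap.mulLeft ℝ ρ)).subset (fun x hx => abs_le.1 (by
    rw [LinearMap.mulLeft_apply, abs_mul, abs_of_nonneg hρ.1]
    exact mul_le_one₀ hρ.2 (abs_nonneg x) (abs_le.2 hx))) (convex_Icc _ _)

theorem exists_gap_linear_le_add [Fact (1 < p)] (α : ℝ) (hV : Continuous V)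
    (hconv : ConvexOn ℝ (Icc (-1) 1) V) {ε : ℝ} (hε : 0 < ε) :
    ∃ a : ℝ, gap p α (fun x => a * x) ≤ gap p α V + ε := by
  obtain ⟨ρ, hclose, hρ⟩ := ((eventually_abs_comp_mul_sub_lt isCompact_Icc hV
    (half_pos hε)).filter_mono nhdsWithin_le_nhds |>.and (Ioo_mem_nhdsLT (zero_lt_one' ℝ))).exists
  obtain ⟨K, hK⟩ := exists_lipschitzOnWith_comp_mul hV hconv hρ
  have hVρ : Continuous fun x => V (ρ * x) := by fun_prop
  obtain ⟨a, ha⟩ := exists_gap_linear_le (p := p) α hVρ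
    (convexOn_comp_mul hconv (Ioo_subset_Icc_self hρ)) hK
  have hgap := gap_le_add (p := p) (α := α) (b := ε / 2) (b' := ε / 2) hVρ hV
    (fun x hx => by linarith [(abs_lt.1 (hclose x hx)).2])
    (fun x hx => by linarith [(abs_lt.1 (hclose x hx)).1])
  rw [add_halves] at hgap
  exact ⟨a, ha.trans hgap⟩

end Dilation

theorem exists_gap_linear_lt {p : ℝ} [Fact (1 < p)] (α : ℝ) {V : ℝ → ℝ} (hV : Continuous V)
    (hconv : ConvexOn ℝ (Icc (-1) 1) V)
    (haff : ¬ ∃ a b : ℝ, ∀ x ∈ Icc (-1 : ℝ) 1, V x = a * x + b) :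
    ∃ a : ℝ, gap p α (fun x => a * x) < gap p α V := by
  obtain ⟨κ, -, t, ht, hlt⟩ := exists_secant_gap_lt (p := p) α hV hconv haff
  obtain ⟨ε, hε, hεlt⟩ := exists_between (sub_pos.2 hlt)
  have hconv' := convexOn_mul_add_linear hconv (sub_nonneg.2 ht.2.le) (t * κ)
  simp only [mul_assoc] at hconv'
  obtain ⟨a, ha⟩ := exists_gap_linear_le_add (p := p) α (by fun_prop) hconv' hε
  exact ⟨a, by linarith⟩

end RobinGap

theorem theorem2 (p : ℝ) [Fact (1 < p)] (α : ℝ) (V : ℝ → ℝ)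
    (hVcont : ContinuousOn V (Set.Icc (-1) 1))
    (hVconv : ConvexOn ℝ (Set.Icc (-1) 1) V)
    (hVaff : ¬ ∃ a b : ℝ, ∀ x ∈ Set.Icc (-1 : ℝ) 1, V x = a * x + b) :
    ∃ a : ℝ, RobinGap.gap p α V > RobinGap.gap p α (fun x => a * x) := by
  obtain ⟨U, hU, hVU⟩ : ∃ U : ℝ → ℝ, Continuous U ∧ EqOn V U (Icc (-1) 1) :=
    ⟨IccExtend (by norm_num) ((Icc (-1 : ℝ) 1).domRestrict V), hVcont.domRestrict.Icc_extend',
      fun x hx => by rw [IccExtend_of_mem _ _ hx, domRestrict_apply]⟩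
  rw [RobinGap.gap_congr hVU]
  refine RobinGap.exists_gap_linear_lt α hU (hVconv.congr hVU) ?_
  rintro ⟨a, b, hab⟩
  exact hVaff ⟨a, b, fun x hx => (hVU hx).trans (hab x hx)⟩
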